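/- Let $BRDG$ be the class of all bounded residuated distributive lattice-ordered groupoids, i.e. of all algebras $\mathbb A=\langle A,\wedge,\vee,\circ,\backslash,/,0,1,\leqslant\rangle$ such that $\langle A,\wedge,\vee,0,1,\leqslant\rangle$ is a bounded distributive lattice (with least element $0$ and greatest element $1$; the one-element lattice is allowed) and $\circ,\backslash,/$ are binary operations on $A$ with $$x\circ y\leqslant z\iff y\leqslant x\backslash z\iff x\leqslant z/y\qquad\text{for all }x,y,z\in A.$$ A quantifier-free formula is a Boolean combination of atomic formulas $s=t$ and $s\leqslant t$, where $s,t$ are terms built from variables $x_0,x_1,x_2,\dots$, the constants $0,1$ and the operation symbols $\wedge,\vee,\circ,\backslash,/$. It is satisfiable in $BRDG$ if it is true in some $\mathbb A\in BRDG$ under some valuation of the variables in $A$. Formulas are presented as words over a fixed finite alphabet (in prefix notation, with the indices of variables in binary). **Theorem.** Satisfiability in $BRDG$ is in $\mathsf{EXPTIME}$: there are a deterministic Turing machine and a polynomial $p$ such that, on every input word $w$ of length $n$, the machine halts after at most $2^{p(n)}$ steps, and it accepts if and only if $w$ is the code of a quantifier-free formula that is satisfiable in $BRDG$. -/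

import Mathlib

universe u

/-- A bounded residuated distributive lattice-ordered groupoid: a bounded distributive lattice
(least element `⊥`, greatest element `⊤`) with three binary operations
`fus x y = x ∘ y`, `ldiv x z = x \ z` and `rdiv z y = z / y` such that
`x ∘ y ≤ z` iff `y ≤ x \ z` iff `x ≤ z / y`. The one-element algebra is included. -/
class BRDG (A : Type*) extends DistribLattice A, BoundedOrder A where
  fus : A → A → A
  ldiv : A → A → A
  rdiv : A → A → A
  fus_le_iff_le_ldiv : ∀ x y z : A, fus x y ≤ z ↔ y ≤ ldiv x z
  fus_le_iff_le_rdiv : ∀ x y z : A, fus x y ≤ z ↔ x ≤ rdiv z y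

/-- Terms over the variables `x₀, x₁, …`, the constants `0`, `1` and the binary operation symbols
`∧`, `∨`, `∘`, `\`, `/`. -/
inductive BRDGTerm : Type
  | var (i : ℕ)
  | zero
  | one
  | meet (s t : BRDGTerm)
  | join (s t : BRDGTerm)
  | fus (s t : BRDGTerm)
  | ldiv (s t : BRDGTerm)
  | rdiv (s t : BRDGTerm)

/-- Quantifier-free first-order formulas: Boolean combinations of atomic formulas `s = t` and
`s ≤ t`. -/
inductive BRDGFormula : Type
  | eq (s t : BRDGTerm)
  | le (s t : BRDGTerm)
  | not (φ : BRDGFormula)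
  | and (φ ψ : BRDGFormula)
  | or (φ ψ : BRDGFormula)
  | imp (φ ψ : BRDGFormula)

/-- The value of a term in a brdg under a valuation of the variables. -/
def BRDGTerm.eval {A : Type*} [BRDG A] (v : ℕ → A) : BRDGTerm → A
  | .var i => v i
  | .zero => ⊥
  | .one => ⊤
  | .meet s t => s.eval v ⊓ t.eval v
  | .join s t => s.eval v ⊔ t.eval v
  | .fus s t => BRDG.fus (s.eval v) (t.eval v)
  | .ldiv s t => BRDG.ldiv (s.eval v) (t.eval v)
  | .rdiv s t => BRDG.rdiv (s.eval v) (t.eval v)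

/-- Truth of a quantifier-free formula in a brdg under a valuation of the variables. -/
def BRDGFormula.Holds {A : Type*} [BRDG A] (v : ℕ → A) : BRDGFormula → Prop
  | .eq s t => s.eval v = t.eval v
  | .le s t => s.eval v ≤ t.eval v
  | .not φ => ¬ φ.Holds v
  | .and φ ψ => φ.Holds v ∧ ψ.Holds v
  | .or φ ψ => φ.Holds v ∨ ψ.Holds v
  | .imp φ ψ => φ.Holds v → ψ.Holds v

/-- `φ` is satisfiable in the class of all brdg's (with carrier in the universe `u`): it is true in
some brdg under some valuation. -/
def BRDGFormula.Satisfiable (φ : BRDGFormula) : Prop :=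
  ∃ (A : Type u) (_ : BRDG A) (v : ℕ → A), φ.Holds v

/-- The finite alphabet in which formulas are written down. A variable is written as
`var`, the binary digits of its index, `close`. -/
inductive BRDGSymbol : Type
  | var | bit0 | bit1 | close
  | zero | one | meet | join | fus | ldiv | rdiv
  | eq | le | not | and | or | imp

/-- The symbol for a binary digit. -/
def BRDGSymbol.ofBit : Bool → BRDGSymbol
  | false => .bit0
  | true => .bit1

/-- Terms as words, in Polish (prefix) notation; the index of a variable is written in binary,
least significant digit first. -/
def BRDGTerm.encode : BRDGTerm → List BRDGSymbol
  | .var i => .var :: ((Nat.bits i).map BRDGSymbol.ofBit ++ [.close])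
  | .zero => [.zero]
  | .one => [.one]
  | .meet s t => .meet :: (s.encode ++ t.encode)
  | .join s t => .join :: (s.encode ++ t.encode)
  | .fus s t => .fus :: (s.encode ++ t.encode)
  | .ldiv s t => .ldiv :: (s.encode ++ t.encode)
  | .rdiv s t => .rdiv :: (s.encode ++ t.encode)

/-- Formulas as words, in Polish (prefix) notation. -/
def BRDGFormula.encode : BRDGFormula → List BRDGSymbol
  | .eq s t => .eq :: (s.encode ++ t.encode)
  | .le s t => .le :: (s.encode ++ t.encode)
  | .not φ => .not :: φ.encode
  | .and φ ψ => .and :: (φ.encode ++ ψ.encode)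
  | .or φ ψ => .or :: (φ.encode ++ ψ.encode)
  | .imp φ ψ => .imp :: (φ.encode ++ ψ.encode)

/-- The decision problem "satisfiability in the class of all brdg's", as a formal language: all
words that are the code of a satisfiable quantifier-free formula. -/
def BRDGSat : Language BRDGSymbol :=
  {w | ∃ φ : BRDGFormula, φ.encode = w ∧ BRDGFormula.Satisfiable.{u} φ}

open Classical in
/-- The class EXPTIME of languages over a finite alphabet: some deterministic Turing machine
(Mathlib's multi-stack machines, with finitely many stacks, states and stack symbols) halts on
every input word `w` within `2 ^ p(|w|)` steps, for a fixed polynomial `p`, with output `true` if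
`w ∈ L` and output `false` if `w ∉ L`. -/
def InEXPTIME {Γ : Type} (L : Language Γ) : Prop :=
  ∃ (M : Turing.TM2ComputableInTime (id : List Γ → List Γ) Computability.encodeBool
      (fun w => decide (w ∈ L))) (p : Polynomial ℕ),
    (∀ k, Finite (M.tm.Γ k)) ∧ ∀ n : ℕ, M.time n ≤ 2 ^ p.eval n

/-! The truth of a quantifier-free formula depends only on which of its inequalities hold, an
equation counting as two. So it suffices to test, for each set `g` of these inequalities, whether
the formula is true when exactly those in `g` hold, and whether some brdg and valuation make exactly
those hold.

The second test is type elimination. A type is a set of subterms that respects `0`, `1`, `∧`, `∨`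
and `g`, as the set of subterms with value in a given prime filter would; `frameRel` is the largest
ternary relation on types compatible with `∘`, `\`, `/`. In a brdg `∘` is residuated and so
preserves finite joins; separation by prime filters then supplies, as in Jónsson–Tarski duality,
prime filters witnessing each membership `s ∘ t ∈ P` and each failure of `s \ t ∈ P` or `s / t ∈ P`
(`JoinPreserving.exists_of_mem`, `JoinPreserving.exists_of_not_le`). Hence traces of prime filters
are never eliminated. Conversely, the surviving types all have witnesses among themselves, and in
the complex algebra of `frameRel` on them every subterm evaluates to the set of types containing it
(`eval_typeAlgebra`). So `g` is realizable iff each inequality of the formula outside `g` is refuted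
by a surviving type. The one-element algebra corresponds to the empty set of types.

There are exponentially many sets `g` and sets of subterms, and a round of elimination is polynomial
in the length of the list of types; each round that changes anything removes a type, so the whole
procedure takes exponential time.

To turn this into a Turing machine, programs are built from fragments acting on binary trees stored
on a stack. Functions with a time bound are closed under composition, pairing, case distinction,
equality tests and folds over lists, and the algorithm is written with these alone: a
polynomial-time parser, an exponential-time enumeration of subsets, and a test that is polynomial in
the enumerated data. -/

/-! ### Composition of stack-machine programs, with step counts -/

section Fragments

open Turing Turing.TM2 Function

/-- Transport of a statement along a renaming of labels; halting becomes a jump to `o`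
(`none`: halt). -/
def Turing.TM2.Stmt.relabel {K : Type} {Γ : K → Type} {Λ Λ' σ : Type} (g : Λ → Λ')
    (o : Option Λ') : Stmt Γ Λ σ → Stmt Γ Λ' σ
  | .push k f q => .push k f (q.relabel g o)
  | .peek k f q => .peek k f (q.relabel g o)
  | .pop k f q => .pop k f (q.relabel g o)
  | .load a q => .load a (q.relabel g o)
  | .branch f q₁ q₂ => .branch f (q₁.relabel g o) (q₂.relabel g o)
  | .goto f => .goto fun v => g (f v)
  | .halt => match o with
    | none => .halt
    | some l => .goto fun _ => l

/-- A program fragment for stack machines: it is entered at the label `entry` and left by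
halting. -/
structure Frag (K : Type) (Γ : K → Type) (σ : Type) where
  Λ : Type
  fin : Finite Λ
  entry : Λ
  code : Λ → Stmt Γ Λ σ

variable {K : Type} [DecidableEq K] {Γ : K → Type} {Λ Λ' σ : Type}

/-- `StepsTo M n c c'`: the machine `M` gets from `c` to `c'` in exactly `n` steps. -/
inductive StepsTo (M : Λ → Stmt Γ Λ σ) : ℕ → Cfg Γ Λ σ → Cfg Γ Λ σ → Prop
  | refl (c) : StepsTo M 0 c c
  | head {n l v S c} : StepsTo M n (stepAux (M l) v S) c → StepsTo M (n + 1) ⟨some l, v, S⟩ c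

theorem StepsTo.trans {M : Λ → Stmt Γ Λ σ} {m n : ℕ} {a b c : Cfg Γ Λ σ}
    (h : StepsTo M m a b) (h' : StepsTo M n b c) : StepsTo M (m + n) a c := by
  induction h with
  | refl => simpa using h'
  | head _ ih => rw [Nat.add_right_comm]; exact .head (ih h')

theorem stepAux_relabel (g : Λ → Λ') (o : Option Λ') (q : Stmt Γ Λ σ) (v : σ)
    (S : ∀ k, List (Γ k)) :
    stepAux (q.relabel g o) v S =
      ⟨((stepAux q v S).l.elim o fun l => some (g l)), (stepAux q v S).var,
        (stepAux q v S).stk⟩ := by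
  induction q generalizing v S with
  | push k f q ih => exact ih _ _
  | peek k f q ih => exact ih _ _
  | pop k f q ih => exact ih _ _
  | load a q ih => exact ih _ _
  | branch f q₁ q₂ ih₁ ih₂ =>
    simp only [Stmt.relabel, stepAux]
    cases f v
    · exact ih₂ _ _
    · exact ih₁ _ _
  | goto f => rfl
  | halt => cases o <;> rfl

/-- A run of a fragment is a run of any machine that contains it. The number of steps is unchanged:
the jump to `o` takes the place of the halting statement and costs no step of its own. -/
theorem StepsTo.relabel {M : Λ → Stmt Γ Λ σ} {M' : Λ' → Stmt Γ Λ' σ} {g : Λ → Λ'}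
    {o : Option Λ'} (hM : ∀ l, M' (g l) = (M l).relabel g o) {n : ℕ} {c c' : Cfg Γ Λ σ}
    (h : StepsTo M n c c') :
    StepsTo M' n ⟨c.l.elim o fun l => some (g l), c.var, c.stk⟩
      ⟨c'.l.elim o fun l => some (g l), c'.var, c'.stk⟩ := by
  induction h with
  | refl => exact .refl _
  | head _ ih =>
    refine .head ?_
    rw [hM, stepAux_relabel]
    exact ih

/-- `Runs F v S v' S' t`: started with registers `v` and stacks `S`, the fragment `F` is left
after at most `t` steps, with registers `v'` and stacks `S'`. -/
def Runs (F : Frag K Γ σ) (v : σ) (S : ∀ k, List (Γ k)) (v' : σ) (S' : ∀ k, List (Γ k))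
    (t : ℕ) : Prop :=
  ∃ n ≤ t, StepsTo F.code n ⟨some F.entry, v, S⟩ ⟨none, v', S'⟩

theorem Runs.mono {F : Frag K Γ σ} {v v' : σ} {S S' : ∀ k, List (Γ k)} {t t' : ℕ}
    (h : Runs F v S v' S' t) (ht : t ≤ t') : Runs F v S v' S' t' :=
  let ⟨n, hn, hs⟩ := h
  ⟨n, hn.trans ht, hs⟩

namespace Frag

/-- A single statement. -/
def stmt (q : Stmt Γ Unit σ) : Frag K Γ σ := ⟨Unit, inferInstance, (), fun _ => q⟩

theorem runs_stmt {q : Stmt Γ Unit σ} {v v' : σ} {S S' : ∀ k, List (Γ k)}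
    (h : stepAux q v S = ⟨none, v', S'⟩) : Runs (stmt q) v S v' S' 1 :=
  ⟨1, le_rfl, .head (by rw [stmt, h]; exact .refl _)⟩

/-- One fragment after the other. -/
def seq (F G : Frag K Γ σ) : Frag K Γ σ where
  Λ := F.Λ ⊕ G.Λ
  fin := have := F.fin; have := G.fin; inferInstance
  entry := .inl F.entry
  code
    | .inl l => (F.code l).relabel .inl (some (.inr G.entry))
    | .inr l => (G.code l).relabel .inr none

theorem runs_seq {F G : Frag K Γ σ} {v v' v'' : σ} {S S' S'' : ∀ k, List (Γ k)} {t t' : ℕ}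
    (hF : Runs F v S v' S' t) (hG : Runs G v' S' v'' S'' t') :
    Runs (seq F G) v S v'' S'' (t + t') := by
  obtain ⟨m, hm, hF⟩ := hF
  obtain ⟨n, hn, hG⟩ := hG
  refine ⟨m + n, by omega, StepsTo.trans
    (hF.relabel (M' := (seq F G).code) (g := .inl) (o := some (.inr G.entry)) fun _ => rfl)
    (hG.relabel (M' := (seq F G).code) (g := .inr) (o := none) fun _ => rfl)⟩

/-- Conditional execution. -/
def ite (c : σ → Bool) (F G : Frag K Γ σ) : Frag K Γ σ where
  Λ := Option (F.Λ ⊕ G.Λ)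
  fin := have := F.fin; have := G.fin; inferInstance
  entry := none
  code
    | none => .branch c (.goto fun _ => some (.inl F.entry)) (.goto fun _ => some (.inr G.entry))
    | some (.inl l) => (F.code l).relabel (fun l => some (.inl l)) none
    | some (.inr l) => (G.code l).relabel (fun l => some (.inr l)) none

theorem runs_ite_true {c : σ → Bool} {F G : Frag K Γ σ} {v v' : σ} {S S' : ∀ k, List (Γ k)}
    {t : ℕ} (hc : c v = true) (h : Runs F v S v' S' t) : Runs (ite c F G) v S v' S' (t + 1) := by
  obtain ⟨n, hn, h⟩ := h
  refine ⟨n + 1, by omega, .head ?_⟩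
  have := h.relabel (M' := (ite c F G).code) (g := fun l => some (.inl l)) (o := none)
    fun _ => rfl
  simpa [ite, hc] using this

theorem runs_ite_false {c : σ → Bool} {F G : Frag K Γ σ} {v v' : σ} {S S' : ∀ k, List (Γ k)}
    {t : ℕ} (hc : c v = false) (h : Runs G v S v' S' t) : Runs (ite c F G) v S v' S' (t + 1) := by
  obtain ⟨n, hn, h⟩ := h
  refine ⟨n + 1, by omega, .head ?_⟩
  have := h.relabel (M' := (ite c F G).code) (g := fun l => some (.inr l)) (o := none)
    fun _ => rfl
  simpa [ite, hc] using this

/-- Repetition of `F` as long as `c` holds. -/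
def loop (c : σ → Bool) (F : Frag K Γ σ) : Frag K Γ σ where
  Λ := Option F.Λ
  fin := have := F.fin; inferInstance
  entry := none
  code
    | none => .branch c (.goto fun _ => some F.entry) .halt
    | some l => (F.code l).relabel some (some none)

theorem runs_loop_done {c : σ → Bool} {F : Frag K Γ σ} {v : σ} {S : ∀ k, List (Γ k)}
    (hc : c v = false) : Runs (loop c F) v S v S 1 :=
  ⟨1, le_rfl, .head (by simpa [loop, hc] using .refl _)⟩

theorem runs_loop_step {c : σ → Bool} {F : Frag K Γ σ} {v v' v'' : σ}
    {S S' S'' : ∀ k, List (Γ k)} {t t' : ℕ} (hc : c v = true) (hF : Runs F v S v' S' t)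
    (h : Runs (loop c F) v' S' v'' S'' t') : Runs (loop c F) v S v'' S'' (t' + (t + 1)) := by
  obtain ⟨m, hm, hF⟩ := hF
  obtain ⟨n, hn, h⟩ := h
  refine ⟨m + 1 + n, by omega, StepsTo.trans (.head ?_) h⟩
  have := hF.relabel (M' := (loop c F).code) (g := some) (o := some none) fun _ => rfl
  simpa [loop, hc] using this

end Frag

end Fragments

/-! ### Binary trees and the stacks of the machine -/

/-- Binary trees, the data on which programs operate. -/
inductive Tree₂ : Type
  | nil
  | cons (a b : Tree₂)
  deriving DecidableEq

/-- Stack symbols: the two kinds of nodes of a tree, and an end marker. -/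
inductive Tok : Type
  | leaf | node | mark
  deriving DecidableEq

instance : Fintype Tok := ⟨{.leaf, .node, .mark}, fun x => by cases x <;> simp⟩

deriving instance DecidableEq for BRDGSymbol

instance : Fintype BRDGSymbol :=
  ⟨{.var, .bit0, .bit1, .close, .zero, .one, .meet, .join, .fus, .ldiv, .rdiv, .eq, .le, .not,
    .and, .or, .imp}, fun x => by cases x <;> simp⟩

/-- The stacks of the machine. -/
inductive Stk : Type
  | main | aux₁ | aux₂ | cnt | inp | out
  deriving DecidableEq

instance : Fintype Stk :=
  ⟨{.main, .aux₁, .aux₂, .cnt, .inp, .out}, fun x => by cases x <;> simp⟩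

/-- The alphabets of the stacks. -/
def Stk.Γ : Stk → Type
  | .main => Tok
  | .aux₁ => Tok
  | .aux₂ => Tok
  | .cnt => Tok
  | .inp => BRDGSymbol
  | .out => Bool

/-- The registers of the machine. -/
abbrev Regs : Type := Option Tok × Option Tok × Option BRDGSymbol

namespace Tree₂

/-- The code of a tree: its nodes in preorder. -/
def enc : Tree₂ → List Tok
  | nil => [.leaf]
  | cons a b => .node :: (enc a ++ enc b)

/-- The size of a tree: the length of its code. -/
def size : Tree₂ → ℕ
  | nil => 1
  | cons a b => size a + size b + 1

@[simp] theorem length_enc (d : Tree₂) : d.enc.length = d.size := by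
  induction d with
  | nil => rfl
  | cons a b iha ihb => simp [enc, size, iha, ihb]

theorem size_pos (d : Tree₂) : 0 < d.size := by cases d <;> simp [size]

theorem mark_notMem_enc (d : Tree₂) : Tok.mark ∉ d.enc := by
  induction d with
  | nil => simp [enc]
  | cons a b iha ihb => simp [enc, iha, ihb]

/-- Preorder codes form a prefix code, so trees can lie on the main stack without separators. -/
theorem enc_append_inj {a b : Tree₂} {r s : List Tok} (h : a.enc ++ r = b.enc ++ s) :
    a = b ∧ r = s := by
  induction a generalizing b r s with
  | nil => cases b <;> simp_all [enc]
  | cons a₁ a₂ ih₁ ih₂ =>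
    cases b with
    | nil => simp [enc] at h
    | cons b₁ b₂ =>
      simp only [enc, List.cons_append, List.append_assoc, List.cons.injEq, true_and] at h
      obtain ⟨rfl, h₁⟩ := ih₁ h
      obtain ⟨rfl, h₂⟩ := ih₂ h₁
      exact ⟨rfl, h₂⟩

theorem enc_injective : Function.Injective enc := fun a b h =>
  (enc_append_inj (r := []) (s := []) (by simpa using h)).1

end Tree₂

/-! ### Moving, copying and splitting trees on the stack -/

section TreeMachine

open Turing.TM2 Function Frag

/-- The stacks with the given contents. -/
def stk (m a b c : List Tok) (i : List BRDGSymbol) (o : List Bool) : ∀ k, List (Stk.Γ k)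
  | .main => m
  | .aux₁ => a
  | .aux₂ => b
  | .cnt => c
  | .inp => i
  | .out => o

section
variable (m a b c : List Tok) (i : List BRDGSymbol) (o : List Bool)


@[simp] theorem update_stk_main (x : List Tok) :
    update (stk m a b c i o) .main x = stk x a b c i o := by
  funext k; cases k <;> rfl
@[simp] theorem update_stk_aux₁ (x : List Tok) :
    update (stk m a b c i o) .aux₁ x = stk m x b c i o := by
  funext k; cases k <;> rfl
@[simp] theorem update_stk_aux₂ (x : List Tok) :
    update (stk m a b c i o) .aux₂ x = stk m a x c i o := by
  funext k; cases k <;> rfl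
@[simp] theorem update_stk_cnt (x : List Tok) :
    update (stk m a b c i o) .cnt x = stk m a b x i o := by
  funext k; cases k <;> rfl
@[simp] theorem update_stk_inp (x : List BRDGSymbol) :
    update (stk m a b c i o) .inp x = stk m a b c x o := by
  funext k; cases k <;> rfl
@[simp] theorem update_stk_out (x : List Bool) :
    update (stk m a b c i o) .out x = stk m a b c i x := by
  funext k; cases k <;> rfl

end

/-- Statements of the tree machine. -/
abbrev TStmt : Type := Stmt Stk.Γ Unit Regs

/-- Fragments of the tree machine. -/
abbrev TFrag : Type 1 := Frag Stk Stk.Γ Regs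

/-- `F` transforms the stacks `S` into `S'` within `t` steps, whatever the registers hold. -/
def Acts (F : TFrag) (S S' : ∀ k, List (Stk.Γ k)) (t : ℕ) : Prop :=
  ∀ v, ∃ v', Runs F v S v' S' t

theorem Acts.mono {F : TFrag} {S S' : ∀ k, List (Stk.Γ k)} {t t' : ℕ}
    (h : Acts F S S' t) (ht : t ≤ t') : Acts F S S' t' := fun v =>
  let ⟨v', h⟩ := h v
  ⟨v', h.mono ht⟩

theorem Acts.seq {F G : TFrag} {S S' S'' : ∀ k, List (Stk.Γ k)} {t t' : ℕ}
    (hF : Acts F S S' t) (hG : Acts G S' S'' t') : Acts (F.seq G) S S'' (t + t') := fun v =>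
  let ⟨v', hF⟩ := hF v
  let ⟨v'', hG⟩ := hG v'
  ⟨v'', runs_seq hF hG⟩

namespace TStmt

/-- Push onto the stack `main`. -/
def pushMain (f : Regs → Tok) (q : TStmt) : TStmt := .push .main f q

/-- Push onto the stack `aux₁`. -/
def pushAux₁ (f : Regs → Tok) (q : TStmt) : TStmt := .push .aux₁ f q

/-- Push onto the stack `aux₂`. -/
def pushAux₂ (f : Regs → Tok) (q : TStmt) : TStmt := .push .aux₂ f q

/-- Push onto the stack `cnt`. -/
def pushCnt (f : Regs → Tok) (q : TStmt) : TStmt := .push .cnt f q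

/-- Push onto the stack `out`. -/
def pushOut (f : Regs → Bool) (q : TStmt) : TStmt := .push .out f q

/-- Pop from the stack `main`. -/
def popMain (f : Regs → Option Tok → Regs) (q : TStmt) : TStmt := .pop .main f q

/-- Pop from the stack `aux₁`. -/
def popAux₁ (f : Regs → Option Tok → Regs) (q : TStmt) : TStmt := .pop .aux₁ f q

/-- Pop from the stack `aux₂`. -/
def popAux₂ (f : Regs → Option Tok → Regs) (q : TStmt) : TStmt := .pop .aux₂ f q

/-- Pop from the stack `cnt`. -/
def popCnt (f : Regs → Option Tok → Regs) (q : TStmt) : TStmt := .pop .cnt f q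

/-- Pop from the stack `inp`. -/
def popInp (f : Regs → Option BRDGSymbol → Regs) (q : TStmt) : TStmt := .pop .inp f q

/-- Look at the top of the stack `cnt`. -/
def peekCnt (f : Regs → Option Tok → Regs) (q : TStmt) : TStmt := .peek .cnt f q

section
variable (v : Regs) (m a b c : List Tok) (i : List BRDGSymbol) (o : List Bool) (q : TStmt)

@[simp] theorem stepAux_pushMain (f : Regs → Tok) :
    stepAux (pushMain f q) v (stk m a b c i o) = stepAux q v (stk (f v :: m) a b c i o) :=
  congrArg (stepAux q v) (update_stk_main m a b c i o _)
@[simp] theorem stepAux_pushAux₁ (f : Regs → Tok) :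
    stepAux (pushAux₁ f q) v (stk m a b c i o) = stepAux q v (stk m (f v :: a) b c i o) :=
  congrArg (stepAux q v) (update_stk_aux₁ m a b c i o _)
@[simp] theorem stepAux_pushAux₂ (f : Regs → Tok) :
    stepAux (pushAux₂ f q) v (stk m a b c i o) = stepAux q v (stk m a (f v :: b) c i o) :=
  congrArg (stepAux q v) (update_stk_aux₂ m a b c i o _)
@[simp] theorem stepAux_pushCnt (f : Regs → Tok) :
    stepAux (pushCnt f q) v (stk m a b c i o) = stepAux q v (stk m a b (f v :: c) i o) :=
  congrArg (stepAux q v) (update_stk_cnt m a b c i o _)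
@[simp] theorem stepAux_pushOut (f : Regs → Bool) :
    stepAux (pushOut f q) v (stk m a b c i o) = stepAux q v (stk m a b c i (f v :: o)) :=
  congrArg (stepAux q v) (update_stk_out m a b c i o _)
@[simp] theorem stepAux_popMain (f : Regs → Option Tok → Regs) :
    stepAux (popMain f q) v (stk m a b c i o) = stepAux q (f v m.head?) (stk m.tail a b c i o) :=
  congrArg (stepAux q (f v m.head?)) (update_stk_main m a b c i o _)
@[simp] theorem stepAux_popAux₁ (f : Regs → Option Tok → Regs) :
    stepAux (popAux₁ f q) v (stk m a b c i o) = stepAux q (f v a.head?) (stk m a.tail b c i o) :=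
  congrArg (stepAux q (f v a.head?)) (update_stk_aux₁ m a b c i o _)
@[simp] theorem stepAux_popAux₂ (f : Regs → Option Tok → Regs) :
    stepAux (popAux₂ f q) v (stk m a b c i o) = stepAux q (f v b.head?) (stk m a b.tail c i o) :=
  congrArg (stepAux q (f v b.head?)) (update_stk_aux₂ m a b c i o _)
@[simp] theorem stepAux_popCnt (f : Regs → Option Tok → Regs) :
    stepAux (popCnt f q) v (stk m a b c i o) = stepAux q (f v c.head?) (stk m a b c.tail i o) :=
  congrArg (stepAux q (f v c.head?)) (update_stk_cnt m a b c i o _)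
@[simp] theorem stepAux_popInp (f : Regs → Option BRDGSymbol → Regs) :
    stepAux (popInp f q) v (stk m a b c i o) = stepAux q (f v i.head?) (stk m a b c i.tail o) :=
  congrArg (stepAux q (f v i.head?)) (update_stk_inp m a b c i o _)
@[simp] theorem stepAux_peekCnt (f : Regs → Option Tok → Regs) :
    stepAux (peekCnt f q) v (stk m a b c i o) = stepAux q (f v c.head?) (stk m a b c i o) :=
  rfl

end

end TStmt

open TStmt

/-- Push a word on the main stack. -/
def pushAll (l : List Tok) : TStmt := l.foldl (fun q t => pushMain (fun _ => t) q) .halt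

theorem stepAux_foldl_push (l : List Tok) (q : TStmt) (v : Regs) (m a b c i o) :
    stepAux (l.foldl (fun q t => pushMain (fun _ => t) q) q) v (stk m a b c i o) =
      stepAux q v (stk (l ++ m) a b c i o) := by
  induction l generalizing q with
  | nil => rfl
  | cons t l ih => simp [ih]

theorem stepAux_pushAll (l : List Tok) (v : Regs) (m a b c i o) :
    stepAux (pushAll l) v (stk m a b c i o) = ⟨none, v, stk (l ++ m) a b c i o⟩ := by
  rw [pushAll, stepAux_foldl_push, stepAux]

/-- Load the first register. -/
def setX (v : Regs) (s : Option Tok) : Regs := (s, v.2)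

/-- Load the second register. -/
def setY (v : Regs) (s : Option Tok) : Regs := (v.1, s, v.2.2)

/-- `l` or the empty word. -/
def optList (p : Bool) (l : List Tok) : List Tok := if p then l else []

/-- The body of the loop of `take`. -/
def takeBody (p q : Bool) : TStmt :=
  let s : TStmt := .branch (fun v => v.1 = some .node)
    (pushCnt (fun _ => .leaf) <| peekCnt setY .halt) (popCnt (fun v _ => v) <| peekCnt setY .halt)
  let s : TStmt := if q then pushAux₂ (fun v => v.1.getD .leaf) s else s
  popMain setX <| if p then pushAux₁ (fun v => v.1.getD .leaf) s else s

/-- The initialization of `take`. -/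
def takeInit (p q : Bool) : TStmt :=
  let s : TStmt := pushCnt (fun _ => .leaf) <| .load (fun v => (v.1, some .leaf, v.2.2)) .halt
  let s : TStmt := if q then pushAux₂ (fun _ => .mark) s else s
  if p then pushAux₁ (fun _ => .mark) s else s

/-- The loop of `take`. -/
def takeLoop (p q : Bool) : TFrag := loop (fun v => v.2.1.isSome) (stmt (takeBody p q))

/-- Remove a tree from the main stack, and push its reversed code on those of the two auxiliary
stacks that are selected by `p` and `q`. -/
def take (p q : Bool) : TFrag := seq (stmt (takeInit p q)) (takeLoop p q)

/-- The stack `cnt` holds one token for each tree still to be read: a node turns one pending tree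
into two, a leaf finishes one. The second register mirrors the top of `cnt`, so the loop ends when
nothing is pending. The hypothesis `h` is a continuation, a run from the moment `d` has been read;
for a branching tree the run for the right branch is the continuation of that for the left one. Each
symbol costs two steps, the test and the body. -/
theorem runs_takeLoop {p q : Bool} {i o} (d : Tree₂) {r a b c : List Tok} {v : Regs} {S'' t}
    (hv : v.2.1.isSome) (h : ∀ v' : Regs, v'.2.1 = c.head? → ∃ v'', Runs (takeLoop p q) v'
      (stk r (optList p d.enc.reverse ++ a) (optList q d.enc.reverse ++ b) c i o) v'' S'' t) :
    ∃ v'', Runs (takeLoop p q) v (stk (d.enc ++ r) a b (.leaf :: c) i o) v'' S''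
      (t + 2 * d.size) := by
  induction d generalizing r a b c v t with
  | nil =>
    obtain ⟨v'', h⟩ := h (some .leaf, c.head?, v.2.2) rfl
    refine ⟨v'', runs_loop_step (t' := t) (t := 1)
      (S' := stk r (optList p [.leaf] ++ a) (optList q [.leaf] ++ b) c i o) hv
      (runs_stmt ?_) h⟩
    cases p <;> cases q <;> simp [takeBody, optList, Tree₂.enc, setX, setY]
  | cons d₁ d₂ ih₁ ih₂ =>
    obtain ⟨v'', key⟩ := ih₁ (r := d₂.enc ++ r) (a := optList p [.node] ++ a)
      (b := optList q [.node] ++ b)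
      (c := .leaf :: c) (v := (some .node, some .leaf, v.2.2)) (t := t + 2 * d₂.size) rfl
      (fun v' hv' => ih₂ (by simp [hv']) (fun v₂ hv₂ => by
        convert h v₂ hv₂ using 4 <;> cases p <;> cases q <;> simp [optList, Tree₂.enc]))
    refine ⟨v'', Runs.mono (runs_loop_step (t := 1) (c := fun v : Regs => v.2.1.isSome) hv
      (runs_stmt ?_) key) (by simp only [Tree₂.size]; omega)⟩
    cases p <;> cases q <;> simp [takeBody, optList, Tree₂.enc, setX, setY]

theorem acts_take (p q : Bool) (d : Tree₂) (r a b i o) :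
    Acts (take p q) (stk (d.enc ++ r) a b [] i o)
      (stk r (optList p (d.enc.reverse ++ [.mark]) ++ a)
        (optList q (d.enc.reverse ++ [.mark]) ++ b) [] i o) (2 * d.size + 2) := fun v => by
  obtain ⟨v', h⟩ : ∃ v', Runs (takeLoop p q) (v.1, some .leaf, v.2.2)
      (stk (d.enc ++ r) (optList p [.mark] ++ a) (optList q [.mark] ++ b) [.leaf] i o) v'
      (stk r (optList p (d.enc.reverse ++ [.mark]) ++ a)
        (optList q (d.enc.reverse ++ [.mark]) ++ b) [] i o) (1 + 2 * d.size) := by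
    refine runs_takeLoop d rfl fun v' hv' => ⟨v', ?_⟩
    have hd (l : List Tok) (x : List Tok) (p : Bool) :
        optList p (l ++ [.mark]) ++ x = optList p l ++ (optList p [.mark] ++ x) := by
      cases p <;> simp [optList]
    rw [hd, hd]
    exact runs_loop_done (by simp [hv'])
  refine ⟨v', (runs_seq (t := 1) (runs_stmt ?_) h).mono (by omega)⟩
  cases p <;> cases q <;> simp [takeInit, optList]

/-- Move the part of the auxiliary stack above the topmost mark to the main stack. -/
def back₁ : TFrag :=
  seq (stmt (popAux₁ setX .halt)) (loop (fun v => v.1 ≠ some .mark)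
    (stmt (pushMain (fun v => v.1.getD .leaf) <| popAux₁ setX .halt)))

/-- Popping reverses the reversed code once more, and the mark, which occurs in no code, shows where
it ends. -/
theorem acts_back₁ (d : Tree₂) (r a b i o) :
    Acts back₁ (stk r (d.enc.reverse ++ .mark :: a) b [] i o) (stk (d.enc ++ r) a b [] i o)
      (2 * d.size + 2) := by
  -- Loop invariant: the topmost symbol has already been popped into the first register, so the
  -- stack holds only the tail.
  have key : ∀ (l r : List Tok) (v : Regs), Tok.mark ∉ l → v.1 = (l ++ [Tok.mark]).head? →
      ∃ v', Runs (loop (fun v : Regs => v.1 ≠ some .mark)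
        (stmt (pushMain (fun v => v.1.getD .leaf) <| popAux₁ setX .halt))) v
        (stk r (l ++ .mark :: a).tail b [] i o) v' (stk (l.reverse ++ r) a b [] i o)
        (2 * l.length + 1) := by
    intro l
    induction l with
    | nil => exact fun r v _ hv => ⟨v, runs_loop_done (by simpa using hv)⟩
    | cons x l ih =>
      intro r v hl hv
      simp only [List.mem_cons, not_or] at hl
      obtain ⟨v', h⟩ := ih (x :: r) (setX v (l ++ [Tok.mark]).head?) hl.2 rfl
      have hx : v.1 = some x := by simpa using hv
      refine ⟨v', ?_⟩
      have := (runs_loop_step (t := 1) (c := fun v : Regs => decide (v.1 ≠ some .mark)) (v := v)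
        (S := stk r (l ++ Tok.mark :: a) b [] i o)
        (by simpa [hx] using Ne.symm hl.1) (runs_stmt ?_) h).mono
        (t' := 2 * (x :: l).length + 1) (by simp; omega)
      · simpa using this
      · cases l <;> simp [hx]
  intro v
  obtain ⟨v', h⟩ := key d.enc.reverse r (setX v (d.enc.reverse ++ [Tok.mark]).head?)
    (by simpa using d.mark_notMem_enc) rfl
  rw [List.reverse_reverse] at h
  refine ⟨v', (runs_seq (t := 1) (runs_stmt ?_) h).mono (by simp; omega)⟩
  cases d.enc.reverse <;> simp

/-- Move the part of the auxiliary stack above the topmost mark to the main stack. -/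
def back₂ : TFrag :=
  seq (stmt (popAux₂ setX .halt)) (loop (fun v => v.1 ≠ some .mark)
    (stmt (pushMain (fun v => v.1.getD .leaf) <| popAux₂ setX .halt)))

theorem acts_back₂ (d : Tree₂) (r a b i o) :
    Acts back₂ (stk r b (d.enc.reverse ++ .mark :: a) [] i o) (stk (d.enc ++ r) b a [] i o)
      (2 * d.size + 2) := by
  have key : ∀ (l r : List Tok) (v : Regs), Tok.mark ∉ l → v.1 = (l ++ [Tok.mark]).head? →
      ∃ v', Runs (loop (fun v : Regs => v.1 ≠ some .mark)
        (stmt (pushMain (fun v => v.1.getD .leaf) <| popAux₂ setX .halt))) v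
        (stk r b (l ++ .mark :: a).tail [] i o) v' (stk (l.reverse ++ r) b a [] i o)
        (2 * l.length + 1) := by
    intro l
    induction l with
    | nil => exact fun r v _ hv => ⟨v, runs_loop_done (by simpa using hv)⟩
    | cons x l ih =>
      intro r v hl hv
      simp only [List.mem_cons, not_or] at hl
      obtain ⟨v', h⟩ := ih (x :: r) (setX v (l ++ [Tok.mark]).head?) hl.2 rfl
      have hx : v.1 = some x := by simpa using hv
      refine ⟨v', ?_⟩
      have := (runs_loop_step (t := 1) (c := fun v : Regs => decide (v.1 ≠ some .mark)) (v := v)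
        (S := stk r b (l ++ Tok.mark :: a) [] i o)
        (by simpa [hx] using Ne.symm hl.1) (runs_stmt ?_) h).mono
        (t' := 2 * (x :: l).length + 1) (by simp; omega)
      · simpa using this
      · cases l <;> simp [hx]
  intro v
  obtain ⟨v', h⟩ := key d.enc.reverse r (setX v (d.enc.reverse ++ [Tok.mark]).head?)
    (by simpa using d.mark_notMem_enc) rfl
  rw [List.reverse_reverse] at h
  refine ⟨v', (runs_seq (t := 1) (runs_stmt ?_) h).mono (by simp; omega)⟩
  cases d.enc.reverse <;> simp


/-- Exchange the two topmost trees. -/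
def swap : TFrag := (take true false).seq <| (take false true).seq <| back₁.seq back₂

theorem acts_swap (d e : Tree₂) (r a b i o) :
    Acts swap (stk (d.enc ++ (e.enc ++ r)) a b [] i o) (stk (e.enc ++ (d.enc ++ r)) a b [] i o)
      (4 * d.size + 4 * e.size + 8) := by
  have h₁ := acts_take true false d (e.enc ++ r) a b i o
  have h₂ := acts_take false true e r (d.enc.reverse ++ .mark :: a) b i o
  have h₃ := acts_back₁ d r a (e.enc.reverse ++ .mark :: b) i o
  have h₄ := acts_back₂ e (d.enc ++ r) b a i o
  simp only [optList, if_true, Bool.false_eq_true, if_false, List.nil_append, List.append_assoc,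
    List.cons_append] at h₁ h₂
  exact (h₁.seq (h₂.seq (h₃.seq h₄))).mono (by omega)

/-- Duplicate the topmost tree. -/
def dup : TFrag := (take true true).seq <| back₁.seq back₂

theorem acts_dup (d : Tree₂) (r a b i o) :
    Acts dup (stk (d.enc ++ r) a b [] i o) (stk (d.enc ++ (d.enc ++ r)) a b [] i o)
      (6 * d.size + 6) := by
  have h₁ := acts_take true true d r a b i o
  have h₃ := acts_back₁ d r a (d.enc.reverse ++ .mark :: b) i o
  have h₄ := acts_back₂ d (d.enc ++ r) b a i o
  simp only [optList, if_true, List.append_assoc, List.nil_append, List.cons_append] at h₁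
  exact (h₁.seq (h₃.seq h₄)).mono (by omega)

/-- Remove the topmost tree. -/
def drop : TFrag := take false false

theorem acts_drop (d : Tree₂) (r a b i o) :
    Acts drop (stk (d.enc ++ r) a b [] i o) (stk r a b [] i o) (2 * d.size + 2) :=
  acts_take false false d r a b i o

/-- Push a word. -/
def pushWord (l : List Tok) : TFrag := stmt (pushAll l)

theorem acts_pushWord (l r a b i o) :
    Acts (pushWord l) (stk r a b [] i o) (stk (l ++ r) a b [] i o) 1 := fun v =>
  ⟨v, runs_stmt (stepAux_pushAll ..)⟩

/-- Split the topmost tree, and run `F` or `G`, depending on whether it has branches. -/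
def split (F G : TFrag) : TFrag :=
  seq (stmt (popMain setX .halt)) (Frag.ite (fun v => v.1 = some .node) F G)

/-- In preorder, removing the root symbol leaves the codes of the two branches as two separate trees
on the stack. -/
theorem acts_split_cons {F G : TFrag} {d e : Tree₂} {r a b i o S t}
    (h : Acts F (stk (d.enc ++ (e.enc ++ r)) a b [] i o) S t) :
    Acts (split F G) (stk ((Tree₂.cons d e).enc ++ r) a b [] i o) S (t + 2) := fun v => by
  obtain ⟨v', h⟩ := h (setX v (some .node))
  refine ⟨v', (runs_seq (t := 1) (runs_stmt ?_) (runs_ite_true ?_ h)).mono (by omega)⟩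
  · simp [Tree₂.enc]
  · simp [setX]

theorem acts_split_nil {F G : TFrag} {r a b i o S t} (h : Acts G (stk r a b [] i o) S t) :
    Acts (split F G) (stk (Tree₂.nil.enc ++ r) a b [] i o) S (t + 2) := fun v => by
  obtain ⟨v', h⟩ := h (setX v (some .leaf))
  refine ⟨v', (runs_seq (t := 1) (runs_stmt ?_) (runs_ite_false ?_ h)).mono (by omega)⟩
  · simp [Tree₂.enc]
  · simp [setX]

end TreeMachine

/-! ### Basic functions on trees and their closure properties -/

section TreePrograms

open Turing.TM2 Function Frag TStmt

namespace Tree₂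

/-- The truth values as trees. -/
def ofBool : Bool → Tree₂
  | false => nil
  | true => cons nil nil

/-- The left branch. -/
def left : Tree₂ → Tree₂
  | nil => nil
  | cons a _ => a

/-- The right branch. -/
def right : Tree₂ → Tree₂
  | nil => nil
  | cons _ b => b

/-- Are the two branches equal? -/
def branchesEq : Tree₂ → Tree₂
  | nil => nil
  | cons a b => ofBool (decide (a = b))

/-- Case distinction. -/
def cases' (x y z : Tree₂) : Tree₂ :=
  match x with
  | nil => z
  | cons _ _ => y

/-- The left fold of `f` over a list of trees. -/
def fold (f : Tree₂ → Tree₂) : Tree₂ → Tree₂ → Tree₂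
  | nil, s => s
  | cons a l, s => fold f l (f (cons a s))

/-- All intermediate results of a fold have size at most `M`, and `f` is only applied to members
of `D`. -/
def FoldBdd (D : Set Tree₂) (f : Tree₂ → Tree₂) (M : ℕ) : Tree₂ → Tree₂ → Prop
  | nil, s => s.size ≤ M
  | cons a l, s => s.size ≤ M ∧ cons a s ∈ D ∧ FoldBdd D f M l (f (cons a s))

theorem FoldBdd.size_le {D : Set Tree₂} {f : Tree₂ → Tree₂} {M : ℕ} {l s : Tree₂} (h : FoldBdd D f M l s) :
    s.size ≤ M := by
  cases l
  · exact h
  · exact h.1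

theorem FoldBdd.size_fold_le {D : Set Tree₂} {f : Tree₂ → Tree₂} {M : ℕ} {l s : Tree₂} (h : FoldBdd D f M l s) :
    (fold f l s).size ≤ M := by
  induction l generalizing s with
  | nil => exact h
  | cons a l _ ih => exact ih h.2.2

/-- The tree of a list of trees. -/
def ofList : List Tree₂ → Tree₂
  | [] => nil
  | a :: l => cons a (ofList l)

end Tree₂

open Tree₂

/-- `F` replaces the topmost tree `x` by `f x` within `B x.size` steps, if `x` is in `D`. -/
def Computes (D : Set Tree₂) (F : TFrag) (f : Tree₂ → Tree₂) (B : ℕ → ℕ) : Prop :=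
  ∀ x ∈ D, ∀ r a b i o,
    Acts F (stk (x.enc ++ r) a b [] i o) (stk ((f x).enc ++ r) a b [] i o) (B x.size)

/-- Some program computes `f` on `D`, where both the number of steps and the size of the result
are bounded by `B` in terms of the size of the input. -/
def CompIn (D : Set Tree₂) (B : ℕ → ℕ) (f : Tree₂ → Tree₂) : Prop :=
  ∃ F, Computes D F f B ∧ ∀ x ∈ D, (f x).size ≤ B x.size

variable {D E : Set Tree₂}

theorem CompIn.mono {B C : ℕ → ℕ} {f : Tree₂ → Tree₂} (h : CompIn D B f) (hBC : ∀ n, B n ≤ C n) :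
    CompIn D C f :=
  let ⟨F, hF, hs⟩ := h
  ⟨F, fun x hx r a b i o => (hF x hx r a b i o).mono (hBC _), fun x hx => (hs x hx).trans (hBC _)⟩

theorem compIn_id : CompIn D (fun n => n + 1) id :=
  ⟨stmt .halt, fun x _ r a b i o v => ⟨v, (runs_stmt rfl).mono (by beta_reduce; omega)⟩,
    fun x _ => by simp⟩

theorem compIn_const (d : Tree₂) : CompIn D (fun n => 2 * n + (d.size + 3)) (fun _ => d) :=
  ⟨drop.seq (pushWord d.enc), fun x _ r a b i o =>
    ((acts_drop x r a b i o).seq (acts_pushWord d.enc r a b i o)).mono (by beta_reduce; omega),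
    fun x _ => by beta_reduce; omega⟩

theorem compIn_left : CompIn D (fun n => 6 * n + 10) left := by
  refine ⟨split ((take true false).seq <| drop.seq back₁) (pushWord [.leaf]), ?_, ?_⟩
  · rintro (_ | ⟨x, y⟩) - r a b i o
    · exact (acts_split_nil (acts_pushWord _ r a b i o)).mono (by beta_reduce; omega)
    · refine (acts_split_cons ((acts_take true false x (y.enc ++ r) a b i o).seq
        ((acts_drop y r _ _ i o).seq (t' := 2 * x.size + 2) ?_))).mono ?_
      · simpa [optList, left] using acts_back₁ x r a b i o
      · simp only [size]; omega
  · rintro (_ | ⟨x, y⟩) - <;> simp only [left, size] <;> omega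

theorem compIn_right : CompIn D (fun n => 6 * n + 10) right := by
  refine ⟨split drop (pushWord [.leaf]), ?_, ?_⟩
  · rintro (_ | ⟨x, y⟩) - r a b i o
    · exact (acts_split_nil (acts_pushWord _ r a b i o)).mono (by beta_reduce; omega)
    · exact (acts_split_cons (acts_drop x (y.enc ++ r) a b i o)).mono (by simp only [size]; omega)
  · rintro (_ | ⟨x, y⟩) - <;> simp only [right, size] <;> omega

/-- This is why `CompIn` also bounds the size of the result: the second program runs on an input of
size at most `C n`, and monotonicity of `B` carries the bound over. -/
theorem CompIn.comp {B C : ℕ → ℕ} {f g : Tree₂ → Tree₂} (hf : CompIn E B f) (hB : Monotone B)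
    (hg : CompIn D C g) (hDE : ∀ x ∈ D, g x ∈ E) : CompIn D (fun n => C n + B (C n)) (fun x => f (g x)) := by
  obtain ⟨F, hF, hfs⟩ := hf
  obtain ⟨G, hG, hgs⟩ := hg
  refine ⟨G.seq F, fun x hx r a b i o => ((hG x hx r a b i o).seq (hF (g x) (hDE x hx) r a b i o)).mono
    (Nat.add_le_add_left (hB (hgs x hx)) _), fun x hx => ?_⟩
  exact ((hfs _ (hDE x hx)).trans (hB (hgs x hx))).trans (Nat.le_add_left ..)

theorem CompIn.cons {B C : ℕ → ℕ} {f g : Tree₂ → Tree₂} (hf : CompIn D B f) (hg : CompIn D C g) :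
    CompIn D (fun n => 10 * n + 15 + 5 * C n + B n) (fun x => .cons (f x) (g x)) := by
  obtain ⟨F, hF, hfs⟩ := hf
  obtain ⟨G, hG, hgs⟩ := hg
  -- Apply `g` to a copy, bring the original back to the top and apply `f`; one node symbol then
  -- joins the two results.
  refine ⟨dup.seq <| G.seq <| swap.seq <| F.seq <| pushWord [.node], fun x hx r a b i o => ?_,
    fun x hx => ?_⟩
  · have := (acts_dup x r a b i o).seq <| (hG x hx (x.enc ++ r) a b i o).seq <|
      (acts_swap (g x) x r a b i o).seq <| (hF x hx ((g x).enc ++ r) a b i o).seq <|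
      acts_pushWord [.node] _ a b i o
    have h := hgs x hx
    simpa [enc] using this.mono
      (t' := 10 * x.size + 15 + 5 * C x.size + B x.size) (by omega)
  · have := hfs x hx
    have := hgs x hx
    simp only [size]; omega

theorem CompIn.cases' {A B C : ℕ → ℕ} {c f g : Tree₂ → Tree₂} (hc : CompIn D A c)
    (hf : CompIn D B f) (hg : CompIn D C g) :
    CompIn D (fun n => 6 * n + 12 + 3 * A n + B n + C n) (fun x => .cases' (c x) (f x) (g x)) := by
  obtain ⟨P, hP, hcs⟩ := hc
  obtain ⟨F, hF, hfs⟩ := hf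
  obtain ⟨G, hG, hgs⟩ := hg
  refine ⟨dup.seq <| P.seq <| split (drop.seq <| drop.seq F) G, fun x hx r a b i o => ?_,
    fun x hx => ?_⟩
  · have h := (acts_dup x r a b i o).seq (hP x hx (x.enc ++ r) a b i o)
    have hs := hcs x hx
    cases hc : c x with
    | nil =>
      rw [hc] at h
      refine ((acts_dup x r a b i o).seq ((hP x hx (x.enc ++ r) a b i o).seq ?_)).mono
        (t := 6 * x.size + 6 + (A x.size + (C x.size + 2))) (by beta_reduce; omega)
      simp only [hc, Tree₂.cases']
      exact acts_split_nil (hG x hx r a b i o)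
    | cons d e =>
      rw [hc, size] at hs
      refine ((acts_dup x r a b i o).seq ((hP x hx (x.enc ++ r) a b i o).seq ?_)).mono
        (t := 6 * x.size + 6 + (A x.size +
          ((2 * d.size + 2) + ((2 * e.size + 2) + B x.size) + 2))) (by beta_reduce; omega)
      simp only [hc, Tree₂.cases']
      exact acts_split_cons ((acts_drop d _ a b i o).seq <| (acts_drop e _ a b i o).seq <|
        hF x hx r a b i o)
  · have := hfs x hx
    have := hgs x hx
    beta_reduce
    cases c x <;> simp only [Tree₂.cases'] <;> omega

/-! ### Testing two trees for equality -/

section Equality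

/-- Pop from both auxiliary stacks into the registers. -/
def popXY : TStmt := popAux₁ setX <| popAux₂ setY .halt

/-- Pop from both auxiliary stacks as long as the symbols agree. -/
def cmpLoop : TFrag := loop (fun v => v.1 = v.2.1 ∧ v.1 ≠ some .mark) (stmt popXY)

/-- The loop stops at the first disagreement or when a mark is reached. The words `k₁`, `k₂` are
what is left, counting the symbols that are already in the registers; both are empty exactly if no
disagreement occurred. -/
theorem runs_cmpLoop (m a b i o) (l₁ l₂ : List Tok) (v : Regs) (h₁ : Tok.mark ∉ l₁)
    (h₂ : Tok.mark ∉ l₂) (hv₁ : v.1 = (l₁ ++ [Tok.mark]).head?)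
    (hv₂ : v.2.1 = (l₂ ++ [Tok.mark]).head?) :
    ∃ (v' : Regs) (k₁ k₂ : List Tok),
      Runs cmpLoop v (stk m (l₁ ++ Tok.mark :: a).tail (l₂ ++ Tok.mark :: b).tail [] i o)
        v' (stk m (k₁ ++ Tok.mark :: a).tail (k₂ ++ Tok.mark :: b).tail [] i o) (2 * l₁.length + 1) ∧
      Tok.mark ∉ k₁ ∧ Tok.mark ∉ k₂ ∧ k₁.length ≤ l₁.length ∧ k₂.length ≤ l₂.length ∧
      v'.1 = (k₁ ++ [Tok.mark]).head? ∧ v'.2.1 = (k₂ ++ [Tok.mark]).head? ∧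
      (l₁ = l₂ ↔ k₁ = [] ∧ k₂ = []) := by
  induction l₁ generalizing l₂ v with
  | nil =>
    refine ⟨v, [], l₂, (runs_loop_done ?_).mono (by simp), h₁, h₂, le_rfl, le_rfl, hv₁, hv₂, ?_⟩
    · simp only [List.nil_append, List.head?_cons] at hv₁
      simp [hv₁]
    · simp [eq_comm]
  | cons x l₁ ih =>
    by_cases hx : l₂.head? = some x
    · obtain ⟨l₂, rfl⟩ : ∃ l, l₂ = x :: l := by
        cases l₂ <;> simp_all
      simp only [List.mem_cons, not_or] at h₁ h₂
      obtain ⟨v', k₁, k₂, h, hk⟩ := ih l₂ (setY (setX v (l₁ ++ [Tok.mark]).head?)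
        (l₂ ++ [Tok.mark]).head?) h₁.2 h₂.2 rfl rfl
      simp only [List.cons_append, List.head?_cons] at hv₁ hv₂
      refine ⟨v', k₁, k₂, Runs.mono (runs_loop_step (t := 1) (S := stk m
        ((x :: l₁) ++ .mark :: a).tail ((x :: l₂) ++ .mark :: b).tail [] i o) ?_ (runs_stmt ?_) h)
        (by simp; omega), hk.1, hk.2.1, by simp; omega, by simp; omega, hk.2.2.2.2.1,
        hk.2.2.2.2.2.1, by simpa using hk.2.2.2.2.2.2⟩
      · simpa [hv₁, hv₂] using Ne.symm h₁.1
      · simp only [popXY, List.cons_append, List.tail_cons, stepAux_popAux₁, stepAux_popAux₂,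
          stepAux]
        cases l₁ <;> cases l₂ <;> rfl
    · refine ⟨v, x :: l₁, l₂, (runs_loop_done ?_).mono (by omega), h₁, h₂, le_rfl, le_rfl, hv₁,
        hv₂, ?_⟩
      · simp only [List.cons_append, List.head?_cons] at hv₁
        simp only [List.mem_cons, not_or] at h₁
        cases l₂ with
        | nil => simp_all [eq_comm]
        | cons y l₂ => simp_all [eq_comm]
      · cases l₂ <;> simp_all [eq_comm]

/-- Empty the first auxiliary stack down to the end marker. -/
def drainX : TFrag := loop (fun v => v.1 ≠ some .mark) (stmt (popAux₁ setX .halt))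

/-- Empty the second auxiliary stack down to the end marker. -/
def drainY : TFrag := loop (fun v => v.2.1 ≠ some .mark) (stmt (popAux₂ setY .halt))

theorem runs_drainX (m a b i o) (l : List Tok) (v : Regs) (hl : Tok.mark ∉ l)
    (hv : v.1 = (l ++ [Tok.mark]).head?) :
    ∃ v' : Regs, v'.2 = v.2 ∧ Runs drainX v (stk m (l ++ Tok.mark :: a).tail b [] i o)
        v' (stk m a b [] i o) (2 * l.length + 1) := by
  induction l generalizing v with
  | nil => exact ⟨v, rfl, runs_loop_done (by simpa using hv)⟩
  | cons x l ih =>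
    simp only [List.mem_cons, not_or] at hl
    obtain ⟨v', hv', h⟩ := ih (setX v (l ++ [Tok.mark]).head?) hl.2 rfl
    simp only [List.cons_append, List.head?_cons] at hv
    refine ⟨v', hv', Runs.mono (runs_loop_step (t := 1) (S := stk m
        ((x :: l) ++ .mark :: a).tail b [] i o) ?_ (runs_stmt ?_) h) (by simp; omega)⟩
    · simpa [hv] using Ne.symm hl.1
    · cases l <;> simp

theorem runs_drainY (m a b i o) (l : List Tok) (v : Regs) (hl : Tok.mark ∉ l)
    (hv : v.2.1 = (l ++ [Tok.mark]).head?) :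
    ∃ v' : Regs, Runs drainY v (stk m a (l ++ Tok.mark :: b).tail [] i o)
        v' (stk m a b [] i o) (2 * l.length + 1) := by
  induction l generalizing v with
  | nil => exact ⟨v, runs_loop_done (by simpa using hv)⟩
  | cons x l ih =>
    simp only [List.mem_cons, not_or] at hl
    obtain ⟨v', h⟩ := ih (setY v (l ++ [Tok.mark]).head?) hl.2 rfl
    simp only [List.cons_append, List.head?_cons] at hv
    refine ⟨v', Runs.mono (runs_loop_step (t := 1) (S := stk m a
        ((x :: l) ++ .mark :: b).tail [] i o) ?_ (runs_stmt ?_) h) (by simp; omega)⟩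
    · simpa [hv] using Ne.symm hl.1
    · cases l <;> simp

/-- Compare the words on the auxiliary stacks and push the code of the result. -/
def compare₂ : TFrag :=
  seq (stmt popXY) <| seq cmpLoop <|
    Frag.ite (fun v => v.1 = some .mark ∧ v.2.1 = some .mark) (pushWord (ofBool true).enc)
      (drainX.seq <| drainY.seq <| pushWord (ofBool false).enc)

theorem acts_compare₂ (m a b i o) (l₁ l₂ : List Tok) (h₁ : Tok.mark ∉ l₁) (h₂ : Tok.mark ∉ l₂) :
    Acts compare₂ (stk m (l₁ ++ Tok.mark :: a) (l₂ ++ Tok.mark :: b) [] i o)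
      (stk ((ofBool (decide (l₁ = l₂))).enc ++ m) a b [] i o)
      (4 * l₁.length + 2 * l₂.length + 8) := by
  intro v
  obtain ⟨v₁, k₁, k₂, hr, hk₁, hk₂, hle₁, hle₂, hv₁, hv₂, hiff⟩ := runs_cmpLoop m a b i o l₁ l₂
    (setY (setX v (l₁ ++ [Tok.mark]).head?) (l₂ ++ [Tok.mark]).head?) h₁ h₂ rfl rfl
  have start : Runs (stmt popXY) v (stk m (l₁ ++ Tok.mark :: a) (l₂ ++ Tok.mark :: b) [] i o)
      (setY (setX v (l₁ ++ [Tok.mark]).head?) (l₂ ++ [Tok.mark]).head?)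
      (stk m (l₁ ++ Tok.mark :: a).tail (l₂ ++ Tok.mark :: b).tail [] i o) 1 := by
    refine runs_stmt ?_
    simp only [popXY, stepAux_popAux₁, stepAux_popAux₂, stepAux]
    cases l₁ <;> cases l₂ <;> rfl
  by_cases h : l₁ = l₂
  · obtain ⟨rfl, rfl⟩ := hiff.1 h
    obtain ⟨v₂, h₃⟩ := acts_pushWord (ofBool true).enc m a b i o v₁
    refine ⟨v₂, (runs_seq start (runs_seq hr (runs_ite_true ?_ (t := 1) ?_))).mono ?_⟩
    rotate_left
    · simpa [h] using h₃
    · omega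
    · simp at hv₁ hv₂
      simp [hv₁, hv₂]
  · obtain ⟨v₂, hv₂', hx⟩ := runs_drainX m a (k₂ ++ Tok.mark :: b).tail i o k₁ v₁ hk₁ hv₁
    obtain ⟨v₃, hy⟩ := runs_drainY m a b i o k₂ v₂ hk₂ (by rw [hv₂', hv₂])
    obtain ⟨v₄, h₃⟩ := acts_pushWord (ofBool false).enc m a b i o v₃
    refine ⟨v₄, (runs_seq start (runs_seq hr (runs_ite_false ?_
      (runs_seq hx (runs_seq hy (t' := 1) ?_))))).mono ?_⟩
    · have hk : ¬ (k₁ = [] ∧ k₂ = []) := fun hk => h (hiff.2 hk)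
      simp only [decide_eq_false_iff_not]
      rintro ⟨h₁', h₂'⟩
      refine hk ⟨?_, ?_⟩
      · rw [hv₁] at h₁'
        cases k₁ with
        | nil => rfl
        | cons y l => exact absurd (List.mem_cons.2 (.inl (by simpa using h₁'.symm))) hk₁
      · rw [hv₂] at h₂'
        cases k₂ with
        | nil => rfl
        | cons y l => exact absurd (List.mem_cons.2 (.inl (by simpa using h₂'.symm))) hk₂
    · simpa [h] using h₃
    · omega

theorem compIn_branchesEq : CompIn D (fun n => 20 * n + 40) branchesEq := by
  refine ⟨split ((take true false).seq <| (take false true).seq compare₂) (pushWord [.leaf]), ?_, ?_⟩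
  · rintro (_ | ⟨x, y⟩) - r a b i o
    · exact (acts_split_nil (acts_pushWord _ r a b i o)).mono (by beta_reduce; omega)
    · have h₁ := acts_take true false x (y.enc ++ r) a b i o
      have h₂ := acts_take false true y r (x.enc.reverse ++ .mark :: a) b i o
      have h₃ := acts_compare₂ r a b i o x.enc.reverse y.enc.reverse
        (by simpa using x.mark_notMem_enc) (by simpa using y.mark_notMem_enc)
      simp only [optList, if_true, Bool.false_eq_true, if_false, List.nil_append,
        List.append_assoc, List.cons_append] at h₁ h₂
      have h := (acts_split_cons (G := pushWord [.leaf]) (h₁.seq (h₂.seq h₃))).mono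
        (t' := 20 * (Tree₂.cons x y).size + 40) (by simp [size]; omega)
      rw [show decide (x.enc.reverse = y.enc.reverse) = decide (x = y) by
        rw [decide_eq_decide, List.reverse_inj, enc_injective.eq_iff]] at h
      exact h
  · rintro (_ | ⟨x, y⟩) -
    · simp [branchesEq, size]
    · simp only [branchesEq]
      cases decide (x = y) <;> simp [ofBool, size]

end Equality

/-! ### Folds over lists -/

section Folding

/-- One step of a fold over a list on top of the main stack. -/
def foldBody (F : TFrag) : TFrag :=
  (take true false).seq <| swap.seq <| back₁.seq <| (pushWord [.node]).seq <| F.seq <| swap.seq <|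
    stmt (popMain setX .halt)

theorem acts_foldBody {F : TFrag} {f : Tree₂ → Tree₂} {B : ℕ → ℕ} (hF : Computes D F f B)
    (r a b i o) (d l s : Tree₂) (hD : .cons d s ∈ D) (v : Regs) :
    ∃ v' : Regs, v'.1 = l.enc.head? ∧ Runs (foldBody F) v
      (stk (d.enc ++ (l.enc ++ (s.enc ++ r))) a b [] i o) v'
      (stk (l.enc.tail ++ ((f (.cons d s)).enc ++ r)) a b [] i o)
      (4 * d.size + 8 * l.size + 4 * s.size + 4 * (f (.cons d s)).size + 22 +
        B (d.size + s.size + 1)) := by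
  have h₁ := acts_take true false d (l.enc ++ (s.enc ++ r)) a b i o
  have h₂ := acts_swap l s r (d.enc.reverse ++ .mark :: a) b i o
  have h₃ := acts_back₁ d (s.enc ++ (l.enc ++ r)) a b i o
  have h₄ := acts_pushWord [.node] (d.enc ++ (s.enc ++ (l.enc ++ r))) a b i o
  have h₅ := hF (.cons d s) hD (l.enc ++ r) a b i o
  have h₆ := acts_swap (f (.cons d s)) l r a b i o
  simp only [optList, if_true, Bool.false_eq_true, if_false, List.nil_append,
    List.append_assoc, List.cons_append, enc, size] at h₁ h₂ h₃ h₄ h₅ h₆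
  obtain ⟨v₁, h₁⟩ := h₁ v
  obtain ⟨v₂, h₂⟩ := h₂ v₁
  obtain ⟨v₃, h₃⟩ := h₃ v₂
  obtain ⟨v₄, h₄⟩ := h₄ v₃
  obtain ⟨v₅, h₅⟩ := h₅ v₄
  obtain ⟨v₆, h₆⟩ := h₆ v₅
  refine ⟨setX v₆ l.enc.head?, rfl, (runs_seq h₁ <| runs_seq h₂ <| runs_seq h₃ <|
    runs_seq h₄ <| runs_seq h₅ <| runs_seq h₆ <| runs_stmt ?_).mono (by omega)⟩
  cases l <;> simp [enc]

/-- A fold over a list on top of the main stack. -/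
def foldLoop (F : TFrag) : TFrag := loop (fun v => v.1 = some .node) (foldBody F)

/-- The leading symbol of the remaining list sits in the first register and is the loop test: a node
announces a further element. With the list bounded by `L` and all intermediate states by `M`, one
round costs at most the bracket, and there are fewer rounds than symbols in the list. -/
theorem runs_foldLoop {F : TFrag} {f : Tree₂ → Tree₂} {B : ℕ → ℕ}
    (hF : Computes D F f B) (hB : Monotone B) {L M : ℕ} (r a b i o) (l s : Tree₂)
    (v : Regs) (hv : v.1 = l.enc.head?) (hl : l.size ≤ L) (hM : FoldBdd D f M l s) :
    ∃ v', Runs (foldLoop F) v (stk (l.enc.tail ++ (s.enc ++ r)) a b [] i o) v'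
      (stk ((fold f l s).enc ++ r) a b [] i o)
      (l.size * (12 * L + 8 * M + 25 + B (L + M + 1)) + 1) := by
  induction l generalizing s v with
  | nil => exact ⟨v, (runs_loop_done (by simp [hv, enc])).mono (by omega)⟩
  | cons d l _ ih =>
    simp only [size] at hl
    have hs := hM.1
    have hs' := hM.2.2.size_le
    obtain ⟨v₁, hv₁, h₁⟩ := acts_foldBody hF r a b i o d l s hM.2.1 v
    obtain ⟨v₂, h₂⟩ := ih _ v₁ hv₁ (by omega) hM.2.2
    refine ⟨v₂, Runs.mono (runs_loop_step (t := 4 * d.size + 8 * l.size + 4 * s.size +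
      4 * (f (.cons d s)).size + 22 + B (d.size + s.size + 1)) ?_ ?_ h₂) ?_⟩
    · simp [hv, enc]
    · simpa [enc] using h₁
    · have := hB (show d.size + s.size + 1 ≤ L + M + 1 by omega)
      have := d.size_pos
      simp only [size]
      nlinarith [Nat.zero_le (d.size * (12 * L + 8 * M + 25 + B (L + M + 1)))]

theorem CompIn.fold {f : Tree₂ → Tree₂} {B M : ℕ → ℕ} (hf : CompIn E B f) (hB : Monotone B)
    (hM : ∀ x ∈ D, FoldBdd E f (M x.size) x.left x.right) :
    CompIn D (fun n => n * (12 * n + 8 * M n + 25 + B (n + M n + 1)) + M n + 5)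
      (fun x => Tree₂.fold f x.left x.right) := by
  obtain ⟨F, hF, -⟩ := hf
  refine ⟨split ((stmt (popMain setX .halt)).seq (foldLoop F)) (pushWord [.leaf]), ?_, ?_⟩
  · rintro (_ | ⟨l, s⟩) hx r a b i o
    · exact (acts_split_nil (acts_pushWord _ r a b i o)).mono (by simp only [size]; omega)
    · refine (acts_split_cons (t := 1 + (l.size * (12 * (Tree₂.cons l s).size +
        8 * M (Tree₂.cons l s).size + 25 +
        B ((Tree₂.cons l s).size + M (Tree₂.cons l s).size + 1)) + 1)) fun v => ?_).mono ?_
      · obtain ⟨v', h⟩ := runs_foldLoop hF hB (L := (Tree₂.cons l s).size) r a b i o l s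
          (setX v l.enc.head?) rfl (by simp only [size]; omega) (hM _ hx)
        refine ⟨v', runs_seq (runs_stmt ?_) h⟩
        cases l <;> simp [enc]
      · have := Nat.mul_le_mul_right (12 * (Tree₂.cons l s).size +
          8 * M (Tree₂.cons l s).size + 25 +
          B ((Tree₂.cons l s).size + M (Tree₂.cons l s).size + 1))
          (show l.size ≤ (Tree₂.cons l s).size by simp only [size]; omega)
        beta_reduce
        omega
  · rintro (_ | ⟨l, s⟩) hx
    · simp only [left, right, Tree₂.fold, size]; omega
    · exact (hM _ hx).size_fold_le.trans (by beta_reduce; omega)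

end Folding

end TreePrograms

/-! ### From tree programs to Turing machines deciding languages -/

section Deciders

open Turing Turing.TM2 Function Frag TStmt Tree₂

/-- Choose a statement according to the symbol in the third register. -/
def dispatch (g : BRDGSymbol → TStmt) : List BRDGSymbol → TStmt
  | [] => .halt
  | s :: l => .branch (fun v => v.2.2 = some s) (g s) (dispatch g l)

theorem stepAux_dispatch (g : BRDGSymbol → TStmt) (l : List BRDGSymbol) (s : BRDGSymbol)
    (hs : s ∈ l) (v : Regs) (hv : v.2.2 = some s) (S) :
    stepAux (dispatch g l) v S = stepAux (g s) v S := by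
  induction l with
  | nil => simp at hs
  | cons t l ih =>
    rw [dispatch, stepAux]
    by_cases h : s = t
    · subst h; simp [hv]
    · have : s ∈ l := by simpa [h] using hs
      simp [hv, h, ih this]

/-- Load the third register. -/
def setS (v : Regs) (s : Option BRDGSymbol) : Regs := (v.1, v.2.1, s)

/-- Move the input to the main stack, as a list of trees in reverse order. -/
noncomputable def load (c : BRDGSymbol → Tree₂) : TFrag :=
  seq (stmt (pushMain (fun _ => .leaf) <| popInp setS .halt)) <|
    loop (fun v => v.2.2.isSome) <| stmt <| dispatch (fun s =>
      (c s).enc.foldl (fun q t => pushMain (fun _ => t) q) <|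
        pushMain (fun _ => .node) (popInp setS .halt))
      Finset.univ.toList

/-- Each symbol becomes the new head of the list built so far, so the word arrives reversed. This
suits a parser that reads from right to left. -/
theorem runs_load_loop (c : BRDGSymbol → Tree₂) (w : List BRDGSymbol) (l : List Tree₂) (a b o)
    (v : Regs) (hv : v.2.2 = w.head?) :
    ∃ v', Runs (loop (fun v : Regs => v.2.2.isSome) <| stmt <| dispatch (fun s =>
      (c s).enc.foldl (fun q t => pushMain (fun _ => t) q) <|
        pushMain (fun _ => .node) (popInp setS .halt))
      Finset.univ.toList) v (stk (ofList l).enc a b [] w.tail o) v'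
      (stk (ofList (w.reverse.map c ++ l)).enc a b [] [] o) (2 * w.length + 1) := by
  induction w generalizing l v with
  | nil => exact ⟨v, runs_loop_done (by simp [hv])⟩
  | cons s w ih =>
    obtain ⟨v', h⟩ := ih (c s :: l) (setS v w.head?) rfl
    simp only [List.head?_cons] at hv
    refine ⟨v', Runs.mono (runs_loop_step (t := 1) (c := fun v : Regs => v.2.2.isSome)
      (by simp [hv]) (runs_stmt ?_) (by simpa using h)) (by simp; omega)⟩
    rw [stepAux_dispatch _ _ s (by simp) v hv, stepAux_foldl_push]
    simp [ofList, enc]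

theorem acts_load (c : BRDGSymbol → Tree₂) (w : List BRDGSymbol) (a b o) :
    Acts (load c) (stk [] a b [] w o) (stk (ofList (w.reverse.map c)).enc a b [] [] o)
      (2 * w.length + 2) := by
  intro v
  obtain ⟨v', h⟩ := runs_load_loop c w [] a b o (setS v w.head?) rfl
  rw [List.append_nil] at h
  refine ⟨v', (runs_seq (t := 1) (runs_stmt ?_) h).mono (by omega)⟩
  simp [ofList, enc]

/-- Turn the result into an output, and reset the registers. -/
def output : TFrag :=
  seq (split (drop.seq <| drop.seq <| stmt <| pushOut (fun _ => true) .halt)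
    (stmt <| pushOut (fun _ => false) .halt)) (stmt <| .load (fun _ => (none, none, none)) .halt)

theorem runs_output (x : Bool) (v : Regs) :
    Runs output v (stk (ofBool x).enc [] [] [] [] []) (none, none, none) (stk [] [] [] [] [] [x])
      13 := by
  have key : Acts (split (drop.seq <| drop.seq <| stmt <| pushOut (fun _ => true) .halt)
      (stmt <| pushOut (fun _ => false) .halt)) (stk ((ofBool x).enc ++ []) [] [] [] [] [])
      (stk [] [] [] [] [] [x]) 12 := by
    cases x
    · exact (acts_split_nil (t := 1) fun v => ⟨v, runs_stmt (by simp)⟩).mono (by omega)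
    · exact (acts_split_cons ((acts_drop _ _ _ _ _ _).seq (((acts_drop nil [] [] [] [] []).seq
        (t' := 1) fun v => ⟨v, runs_stmt (by simp)⟩)))).mono (by simp [size])
  rw [List.append_nil] at key
  obtain ⟨v', h⟩ := key v
  exact runs_seq h (runs_stmt rfl)

theorem iterate_bind_of_stepsTo {K : Type} [DecidableEq K] {Γ : K → Type} {Λ σ : Type}
    {M : Λ → Stmt Γ Λ σ} {n : ℕ} {c c' : Cfg Γ Λ σ} (h : StepsTo M n c c') :
    (flip bind (TM2.step M))^[n] (some c) = some c' := by
  induction h with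
  | refl => rfl
  | head _ ih => rw [Function.iterate_succ_apply]; exact ih

/-- The machine that loads the input, runs `F`, and produces the output. -/
noncomputable def machine (F : TFrag) : FinTM2 :=
  have := F.fin
  { K := Stk, k₀ := .inp, k₁ := .out, Γ := Stk.Γ, Λ := F.Λ, ΛFin := Fintype.ofFinite _,
    main := F.entry, σ := Regs, initialState := (none, none, none), m := F.code
    Γk₀Fin := inferInstanceAs (Fintype BRDGSymbol) }

theorem initList_machine (F : TFrag) (w : List BRDGSymbol) :
    initList (machine F) w =
      (⟨some F.entry, (none, none, none), stk [] [] [] [] w []⟩ : Cfg Stk.Γ F.Λ Regs) := by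
  refine congrArg (Cfg.mk _ _) (funext fun k => ?_)
  cases k <;> first | exact dif_pos rfl | rfl

theorem haltList_machine (F : TFrag) (x : Bool) :
    haltList (machine F) [x] =
      (⟨none, (none, none, none), stk [] [] [] [] [] [x]⟩ : Cfg Stk.Γ F.Λ Regs) := by
  refine congrArg (Cfg.mk _ _) (funext fun k => ?_)
  cases k <;> first | exact dif_pos rfl | rfl

theorem size_ofList_le {C : ℕ} (l : List Tree₂) (hl : ∀ d ∈ l, d.size ≤ C) :
    (ofList l).size ≤ (C + 1) * l.length + 1 := by
  induction l with
  | nil => simp [ofList, size]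
  | cons d l ih =>
    have := ih fun e he => hl e (by simp [he])
    have := hl d (by simp)
    simp only [ofList, size, List.length_cons, Nat.mul_add_one]
    omega

theorem inEXPTIME_of_compIn {L : Language BRDGSymbol} {c : BRDGSymbol → Tree₂}
    {f : Tree₂ → Tree₂} {B : ℕ → ℕ} {D : Set Tree₂} (hf : CompIn D B f) (hB : Monotone B) {k : ℕ}
    (hk : ∀ n, B n ≤ 2 ^ (n + 2) ^ k)
    (hD : ∀ w : List BRDGSymbol, ofList (w.reverse.map c) ∈ D)
    (hL : ∀ w : List BRDGSymbol, ∃ x, f (ofList (w.reverse.map c)) = ofBool x ∧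
      (x = true ↔ w ∈ L)) : InEXPTIME L := by
  classical
  obtain ⟨F, hF, -⟩ := hf
  set C := Finset.univ.sup fun s => (c s).size with hC
  have hsize (w : List BRDGSymbol) :
      (ofList (w.reverse.map c)).size ≤ (C + 1) * w.length + 1 := by
    refine (size_ofList_le (C := C) _ fun d hd => ?_).trans (by simp)
    obtain ⟨s, -, rfl⟩ := List.mem_map.1 hd
    exact Finset.le_sup (f := fun s => (c s).size) (Finset.mem_univ s)
  have run (w : List BRDGSymbol) : Runs ((load c).seq (F.seq output)) (none, none, none)
      (stk [] [] [] [] w []) (none, none, none) (stk [] [] [] [] [] [decide (w ∈ L)])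
      (2 * w.length + 15 + B ((C + 1) * w.length + 1)) := by
    obtain ⟨x, hx, hxL⟩ := hL w
    have hx' : decide (w ∈ L) = x := by
      cases x <;> simp_all
    obtain ⟨v₁, h₁⟩ := acts_load c w [] [] [] (none, none, none)
    obtain ⟨v₂, h₂⟩ := hF (ofList (w.reverse.map c)) (hD w) [] [] [] [] [] v₁
    rw [List.append_nil, List.append_nil, hx] at h₂
    rw [hx']
    exact (runs_seq h₁ (runs_seq h₂ (runs_output x v₂))).mono (by have := hB (hsize w); omega)
  choose n hn hs using run
  refine ⟨{
    tm := machine ((load c).seq (F.seq output))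
    inputAlphabet := Equiv.refl _
    outputAlphabet := Equiv.refl _
    time := fun n => 2 * n + 15 + B ((C + 1) * n + 1)
    outputsFun := fun w => ⟨⟨n w, ?_⟩, hn w⟩ }, .X + 4 + ((C + 1 : ℕ) * .X + 3) ^ k, ?_, ?_⟩
  · have h := iterate_bind_of_stepsTo (hs w)
    exact (congrArg (fun d => (flip bind (TM2.step ((load c).seq (F.seq output)).code))^[n w]
      (some d)) ((congrArg (initList (machine _)) (List.map_id w)).trans
        (initList_machine _ w))).trans (h.trans (congrArg some
        ((congrArg (haltList (machine _)) (List.map_id [decide (w ∈ L)])).trans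
        (haltList_machine _ _)).symm))
  · rintro (_ | _ | _ | _ | _ | _)
    exacts [inferInstanceAs (Finite Tok), inferInstanceAs (Finite Tok),
      inferInstanceAs (Finite Tok), inferInstanceAs (Finite Tok),
      inferInstanceAs (Finite BRDGSymbol), inferInstanceAs (Finite Bool)]
  · intro n
    have h₁ : 2 * n + 15 ≤ 2 ^ (n + 4) := by
      induction n with
      | zero => norm_num
      | succ n ih => rw [show n + 1 + 4 = n + 4 + 1 by omega, pow_succ]; omega
    have h₂ := hk ((C + 1) * n + 1)
    have h₃ : 2 ≤ 2 ^ ((C + 1) * n + 1 + 2) ^ k :=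
      (pow_one 2).symm.le.trans (Nat.pow_le_pow_right (by omega) (Nat.one_le_pow _ _ (by omega)))
    have h₄ : 2 ≤ 2 ^ (n + 4) := by omega
    -- The sum of two numbers that are at least 2 is at most their product, so the exponents can be
    -- added to a single polynomial.
    calc 2 * n + 15 + B ((C + 1) * n + 1) ≤ 2 ^ (n + 4) + 2 ^ ((C + 1) * n + 1 + 2) ^ k := by
          omega
      _ ≤ 2 ^ (n + 4) * 2 ^ ((C + 1) * n + 1 + 2) ^ k := Nat.add_le_mul h₄ h₃
      _ = _ := by
        rw [← pow_add]
        simp [Polynomial.eval_add, Nat.add_assoc]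

end Deciders

/-! ### Polynomial and exponential bounds -/

section Bounds

/-- Bounded by a polynomial. -/
def PolyBdd (B : ℕ → ℕ) : Prop := ∃ k, ∀ n, B n ≤ (n + 2) ^ k

/-- Bounded by an exponential function of a polynomial. -/
def ExpBdd (B : ℕ → ℕ) : Prop := ∃ k, ∀ n, B n ≤ 2 ^ (n + 2) ^ k

variable {B C : ℕ → ℕ}

/-- The base `n + 2` is at least 2, so a constant is absorbed by the exponent: `c ≤ 2 ^ c`. -/
theorem PolyBdd.const (c : ℕ) : PolyBdd fun _ => c :=
  ⟨c, fun n => c.lt_two_pow_self.le.trans (Nat.pow_le_pow_left (by omega) c)⟩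

theorem PolyBdd.id : PolyBdd fun n => n := ⟨1, fun n => by simp⟩

theorem PolyBdd.mul (hB : PolyBdd B) (hC : PolyBdd C) : PolyBdd fun n => B n * C n := by
  obtain ⟨k, hk⟩ := hB
  obtain ⟨l, hl⟩ := hC
  exact ⟨k + l, fun n => (Nat.mul_le_mul (hk n) (hl n)).trans (pow_add _ _ _).ge⟩

theorem PolyBdd.add (hB : PolyBdd B) (hC : PolyBdd C) : PolyBdd fun n => B n + C n := by
  obtain ⟨k, hk⟩ := hB
  obtain ⟨l, hl⟩ := hC
  refine ⟨k + l + 1, fun n => ?_⟩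
  have h₁ : 0 < (n + 2) ^ k := by positivity
  have h₂ : 0 < (n + 2) ^ l := by positivity
  calc B n + C n ≤ (n + 2) ^ k + (n + 2) ^ l := Nat.add_le_add (hk n) (hl n)
    _ ≤ (n + 2) ^ k * (n + 2) ^ l * 2 := by nlinarith
    _ ≤ (n + 2) ^ k * (n + 2) ^ l * (n + 2) := Nat.mul_le_mul_left _ (by omega)
    _ = _ := by rw [pow_succ, pow_add]

theorem PolyBdd.pow (hB : PolyBdd B) (k : ℕ) : PolyBdd fun n => B n ^ k := by
  obtain ⟨l, hl⟩ := hB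
  exact ⟨l * k, fun n => (Nat.pow_le_pow_left (hl n) k).trans (pow_mul _ _ _).ge⟩

theorem ExpBdd.of_le (hC : PolyBdd C) (h : ∀ n, B n ≤ 2 ^ C n) : ExpBdd B :=
  let ⟨k, hk⟩ := hC
  ⟨k, fun n => (h n).trans (Nat.pow_le_pow_right (by omega) (hk n))⟩

theorem PolyBdd.expBdd (hB : PolyBdd B) : ExpBdd B := .of_le hB fun n => (B n).lt_two_pow_self.le

theorem ExpBdd.mul (hB : ExpBdd B) (hC : ExpBdd C) : ExpBdd fun n => B n * C n := by
  obtain ⟨k, hk⟩ := hB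
  obtain ⟨l, hl⟩ := hC
  exact .of_le (((PolyBdd.id.add (.const 2)).pow k).add ((PolyBdd.id.add (.const 2)).pow l))
    fun n => (Nat.mul_le_mul (hk n) (hl n)).trans (pow_add _ _ _).ge

theorem ExpBdd.add (hB : ExpBdd B) (hC : ExpBdd C) : ExpBdd fun n => B n + C n := by
  obtain ⟨k, hk⟩ := hB
  obtain ⟨l, hl⟩ := hC
  refine .of_le ((((PolyBdd.id.add (.const 2)).pow k).add
    ((PolyBdd.id.add (.const 2)).pow l)).add (.const 1)) fun n => ?_
  have h₁ : 0 < 2 ^ (n + 2) ^ k := by positivity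
  have h₂ : 0 < 2 ^ (n + 2) ^ l := by positivity
  have := hk n
  have := hl n
  rw [pow_succ, pow_add]
  nlinarith

theorem ExpBdd.pow (hB : ExpBdd B) (k : ℕ) : ExpBdd fun n => B n ^ k := by
  obtain ⟨l, hl⟩ := hB
  exact .of_le (((PolyBdd.id.add (.const 2)).pow l).mul (.const k)) fun n =>
    (Nat.pow_le_pow_left (hl n) k).trans (pow_mul _ _ _).ge

theorem monotone_add_two_pow (k : ℕ) : Monotone fun n : ℕ => (n + 2) ^ k := fun _ _ h =>
  Nat.pow_le_pow_left (by omega) k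

end Bounds

/-! ### Polynomial and exponential time on trees -/

section TimeClasses

open Tree₂

/-- Computable in polynomial time on `D`. -/
def CompPoly (D : Set Tree₂) (f : Tree₂ → Tree₂) : Prop := ∃ k, CompIn D (fun n => (n + 2) ^ k) f

/-- Computable in exponential time on `D`. -/
def CompExp (D : Set Tree₂) (f : Tree₂ → Tree₂) : Prop :=
  ∃ k, CompIn D (fun n => 2 ^ (n + 2) ^ k) f

variable {D E : Set Tree₂} {f g c : Tree₂ → Tree₂} {B : ℕ → ℕ}

theorem CompIn.poly (h : CompIn D B f) (hB : PolyBdd B) : CompPoly D f :=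
  let ⟨k, hk⟩ := hB
  ⟨k, h.mono hk⟩

theorem CompIn.exp (h : CompIn D B f) (hB : ExpBdd B) : CompExp D f :=
  let ⟨k, hk⟩ := hB
  ⟨k, h.mono hk⟩

theorem polyBdd_add_two_pow (k : ℕ) : PolyBdd fun n => (n + 2) ^ k :=
  (PolyBdd.id.add (.const 2)).pow k

theorem expBdd_two_pow (k : ℕ) : ExpBdd fun n => 2 ^ (n + 2) ^ k := ⟨k, fun _ => le_rfl⟩

theorem CompPoly.exp (h : CompPoly D f) : CompExp D f :=
  let ⟨k, h⟩ := h
  CompIn.exp h (polyBdd_add_two_pow k).expBdd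

theorem CompPoly.comp (hf : CompPoly E f) (hg : CompPoly D g) (h : ∀ x ∈ D, g x ∈ E) :
    CompPoly D fun x => f (g x) := by
  obtain ⟨k, hf⟩ := hf
  obtain ⟨l, hg⟩ := hg
  exact (hf.comp (monotone_add_two_pow k) hg h).poly ((polyBdd_add_two_pow l).add
    (((polyBdd_add_two_pow l).add (.const 2)).pow k))

/-- The `k`-th power of `2 ^ p` is `2 ^ (k * p)`, so time polynomial in an exponentially large
intermediate result is still exponential. -/
theorem CompPoly.comp_exp (hf : CompPoly E f) (hg : CompExp D g) (h : ∀ x ∈ D, g x ∈ E) :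
    CompExp D fun x => f (g x) := by
  obtain ⟨k, hf⟩ := hf
  obtain ⟨l, hg⟩ := hg
  exact (hf.comp (monotone_add_two_pow k) hg h).exp ((expBdd_two_pow l).add
    (((expBdd_two_pow l).add (PolyBdd.const 2).expBdd).pow k))

theorem CompExp.comp_poly (hf : CompExp E f) (hg : CompPoly D g) (h : ∀ x ∈ D, g x ∈ E) :
    CompExp D fun x => f (g x) := by
  obtain ⟨k, hf⟩ := hf
  obtain ⟨l, hg⟩ := hg
  exact (hf.comp (fun _ _ h => Nat.pow_le_pow_right (by omega) (monotone_add_two_pow k h)) hg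
    h).exp ((polyBdd_add_two_pow l).expBdd.add (.of_le
      (((polyBdd_add_two_pow l).add (.const 2)).pow k) fun n => le_rfl))

theorem CompPoly.cons (hf : CompPoly D f) (hg : CompPoly D g) :
    CompPoly D fun x => .cons (f x) (g x) := by
  obtain ⟨k, hf⟩ := hf
  obtain ⟨l, hg⟩ := hg
  exact (hf.cons hg).poly (((((PolyBdd.const 10).mul .id).add (.const 15)).add
    ((PolyBdd.const 5).mul (polyBdd_add_two_pow l))).add (polyBdd_add_two_pow k))

theorem CompExp.cons (hf : CompExp D f) (hg : CompExp D g) :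
    CompExp D fun x => .cons (f x) (g x) := by
  obtain ⟨k, hf⟩ := hf
  obtain ⟨l, hg⟩ := hg
  exact (hf.cons hg).exp (((((PolyBdd.const 10).mul .id).add (.const 15)).expBdd.add
    ((PolyBdd.const 5).expBdd.mul (expBdd_two_pow l))).add (expBdd_two_pow k))

theorem CompPoly.cases' (hc : CompPoly D c) (hf : CompPoly D f) (hg : CompPoly D g) :
    CompPoly D fun x => .cases' (c x) (f x) (g x) := by
  obtain ⟨j, hc⟩ := hc
  obtain ⟨k, hf⟩ := hf
  obtain ⟨l, hg⟩ := hg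
  exact (hc.cases' hf hg).poly ((((((PolyBdd.const 6).mul .id).add (.const 12)).add
    ((PolyBdd.const 3).mul (polyBdd_add_two_pow j))).add (polyBdd_add_two_pow k)).add
    (polyBdd_add_two_pow l))

theorem compPoly_id : CompPoly D fun x => x := compIn_id.poly (PolyBdd.id.add (.const 1))

theorem compPoly_const (d : Tree₂) : CompPoly D fun _ => d :=
  (compIn_const d).poly (((PolyBdd.const 2).mul .id).add (.const _))

theorem compPoly_left : CompPoly D left :=
  compIn_left.poly (((PolyBdd.const 6).mul .id).add (.const _))

theorem compPoly_right : CompPoly D right :=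
  compIn_right.poly (((PolyBdd.const 6).mul .id).add (.const _))

theorem compPoly_branchesEq : CompPoly D branchesEq :=
  compIn_branchesEq.poly (((PolyBdd.const 20).mul .id).add (.const _))

theorem CompPoly.fold {M : ℕ → ℕ} (hM : PolyBdd M) (hf : CompPoly E f)
    (h : ∀ x ∈ D, FoldBdd E f (M x.size) x.left x.right) :
    CompPoly D fun x => Tree₂.fold f x.left x.right := by
  obtain ⟨k, hf⟩ := hf
  exact (hf.fold (monotone_add_two_pow k) h).poly (((PolyBdd.id.mul
    (((((PolyBdd.const 12).mul .id).add ((PolyBdd.const 8).mul hM)).add (.const 25)).add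
      ((((PolyBdd.id.add hM).add (.const 1)).add (.const 2)).pow k))).add hM).add (.const 5))

/-- The list belongs to the input, so there are few rounds; the state may be exponentially large as
long as each round is polynomial in it. -/
theorem CompPoly.fold_exp {M : ℕ → ℕ} (hM : ExpBdd M) (hf : CompPoly E f)
    (h : ∀ x ∈ D, FoldBdd E f (M x.size) x.left x.right) :
    CompExp D fun x => Tree₂.fold f x.left x.right := by
  obtain ⟨k, hf⟩ := hf
  have c (n : ℕ) : ExpBdd fun _ => n := (PolyBdd.const n).expBdd
  have i : ExpBdd fun n => n := PolyBdd.id.expBdd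
  exact (hf.fold (monotone_add_two_pow k) h).exp (((i.mul
    (((((c 12).mul i).add ((c 8).mul hM)).add (c 25)).add
      ((((i.add hM).add (c 1)).add (c 2)).pow k))).add hM).add (c 5))

end TimeClasses

/-! ### Time classes for functions between coded types -/

section Typed

open Tree₂

/-- Types with a coding by trees. -/
class Coded (α : Type) where
  code : α → Tree₂
  code_injective : Function.Injective code

open Coded (code code_injective)

/-- The size of the code. -/
def sz {α : Type} [Coded α] (a : α) : ℕ := (code a).size

instance : Coded Bool := ⟨ofBool, fun a b => by cases a <;> cases b <;> simp [ofBool]⟩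

instance {α β : Type} [Coded α] [Coded β] : Coded (α × β) :=
  ⟨fun p => .cons (code p.1) (code p.2), fun p q h => by
    simp only [Tree₂.cons.injEq, code_injective.eq_iff] at h
    exact Prod.ext h.1 h.2⟩

theorem Tree₂.ofList_injective : Function.Injective ofList := by
  intro l m
  induction l generalizing m with
  | nil => cases m <;> simp [ofList]
  | cons a l ih =>
    cases m with
    | nil => simp [ofList]
    | cons b m => simpa [ofList] using fun h h' => ⟨h, ih h'⟩

instance {α : Type} [Coded α] : Coded (List α) :=
  ⟨fun l => ofList (l.map code), ofList_injective.comp (List.map_injective_iff.2 code_injective)⟩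

/-- The position in the alphabet. -/
def BRDGSymbol.index : BRDGSymbol → ℕ
  | .var => 0 | .bit0 => 1 | .bit1 => 2 | .close => 3 | .zero => 4 | .one => 5 | .meet => 6
  | .join => 7 | .fus => 8 | .ldiv => 9 | .rdiv => 10 | .eq => 11 | .le => 12 | .not => 13
  | .and => 14 | .or => 15 | .imp => 16

instance : Coded BRDGSymbol :=
  ⟨fun s => ofList (List.replicate s.index nil), fun a b h => by
    have := congrArg List.length (ofList_injective h)
    cases a <;> cases b <;> simp_all [BRDGSymbol.index]⟩

variable {α β γ σ : Type} [Coded α] [Coded β] [Coded γ] [Coded σ]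

@[simp] theorem sz_pair (a : α) (b : β) : sz (a, b) = sz a + sz b + 1 := rfl

@[simp] theorem sz_nil : sz ([] : List α) = 1 := rfl

@[simp] theorem sz_cons (a : α) (l : List α) : sz (a :: l) = sz a + sz l + 1 := rfl

theorem sz_bool_le (b : Bool) : sz b ≤ 3 := by cases b <;> decide

theorem sz_pos (a : α) : 0 < sz a := size_pos _

theorem length_lt_sz (l : List α) : l.length < sz l := by
  induction l with
  | nil => simp
  | cons a l ih => simp only [sz_cons, List.length_cons]; omega

theorem sz_le_of_mem {a : α} {l : List α} (h : a ∈ l) : sz a ≤ sz l := by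
  induction l with
  | nil => simp at h
  | cons b l ih =>
    rcases List.mem_cons.1 h with rfl | h
    · simp only [sz_cons]; omega
    · have := ih h; simp only [sz_cons]; omega

/-- Computable in polynomial time. -/
def PolyTime (f : α → β) : Prop :=
  ∃ F, CompPoly (Set.range (code : α → Tree₂)) F ∧ ∀ a, F (code a) = code (f a)

/-- Computable in exponential time. -/
def ExpTime (f : α → β) : Prop :=
  ∃ F, CompExp (Set.range (code : α → Tree₂)) F ∧ ∀ a, F (code a) = code (f a)

theorem PolyTime.exists_sz_le {f : α → β} (hf : PolyTime f) :
    ∃ k, ∀ a, sz (f a) ≤ (sz a + 2) ^ k := by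
  obtain ⟨F, ⟨k, P, -, h⟩, hF⟩ := hf
  exact ⟨k, fun a => by simpa [sz, hF] using h (code a) ⟨a, rfl⟩⟩

theorem PolyTime.exp {f : α → β} (hf : PolyTime f) : ExpTime f :=
  let ⟨F, h, hF⟩ := hf
  ⟨F, h.exp, hF⟩

theorem PolyTime.comp_exp {f : β → γ} {g : α → β} (hf : PolyTime f) (hg : ExpTime g) :
    ExpTime fun a => f (g a) := by
  obtain ⟨F, h, hF⟩ := hf
  obtain ⟨G, h', hG⟩ := hg
  exact ⟨_, h.comp_exp h' (by rintro _ ⟨a, rfl⟩; exact ⟨g a, (hG a).symm⟩), fun a => by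
    rw [hG, hF]⟩

theorem ExpTime.pair {f : α → β} {g : α → γ} (hf : ExpTime f) (hg : ExpTime g) :
    ExpTime fun a => (f a, g a) := by
  obtain ⟨F, h, hF⟩ := hf
  obtain ⟨G, h', hG⟩ := hg
  exact ⟨_, h.cons h', fun a => by rw [hG, hF]; rfl⟩

namespace PolyTime

theorem comp {f : β → γ} {g : α → β} (hf : PolyTime f) (hg : PolyTime g) :
    PolyTime fun a => f (g a) := by
  obtain ⟨F, h, hF⟩ := hf
  obtain ⟨G, h', hG⟩ := hg
  exact ⟨_, h.comp h' (by rintro _ ⟨a, rfl⟩; exact ⟨g a, (hG a).symm⟩), fun a => by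
    rw [hG, hF]⟩

theorem id : PolyTime fun a : α => a := ⟨_, compPoly_id, fun _ => rfl⟩

theorem const (b : β) : PolyTime fun _ : α => b := ⟨_, compPoly_const (code b), fun _ => rfl⟩

theorem pair {f : α → β} {g : α → γ} (hf : PolyTime f) (hg : PolyTime g) :
    PolyTime fun a => (f a, g a) := by
  obtain ⟨F, h, hF⟩ := hf
  obtain ⟨G, h', hG⟩ := hg
  exact ⟨_, h.cons h', fun a => by rw [hG, hF]; rfl⟩

theorem fst {f : α → β × γ} (hf : PolyTime f) : PolyTime fun a => (f a).1 :=
  comp (f := fun p : β × γ => p.1) ⟨_, compPoly_left, fun _ => rfl⟩ hf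

theorem snd {f : α → β × γ} (hf : PolyTime f) : PolyTime fun a => (f a).2 :=
  comp (f := fun p : β × γ => p.2) ⟨_, compPoly_right, fun _ => rfl⟩ hf

theorem cons {f : α → β} {g : α → List β} (hf : PolyTime f) (hg : PolyTime g) :
    PolyTime fun a => f a :: g a := by
  obtain ⟨F, h, hF⟩ := hf
  obtain ⟨G, h', hG⟩ := hg
  exact ⟨_, h.cons h', fun a => by rw [hG, hF]; rfl⟩

theorem cond {c : α → Bool} {f g : α → β} (hc : PolyTime c) (hf : PolyTime f)
    (hg : PolyTime g) : PolyTime fun a => bif c a then f a else g a := by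
  obtain ⟨P, h₀, hP⟩ := hc
  obtain ⟨F, h, hF⟩ := hf
  obtain ⟨G, h', hG⟩ := hg
  refine ⟨_, h₀.cases' h h', fun a => ?_⟩
  rw [hP, hF, hG]
  beta_reduce
  cases c a <;> rfl

theorem ite {p : α → Prop} [DecidablePred p] {f g : α → β} (hp : PolyTime fun a => decide (p a))
    (hf : PolyTime f) (hg : PolyTime g) : PolyTime fun a => if p a then f a else g a := by
  simpa only [Bool.cond_decide] using cond hp hf hg

theorem and {f g : α → Bool} (hf : PolyTime f) (hg : PolyTime g) :
    PolyTime fun a => f a && g a := by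
  convert cond hf hg (const false) using 2 with a
  cases f a <;> rfl

theorem or {f g : α → Bool} (hf : PolyTime f) (hg : PolyTime g) :
    PolyTime fun a => f a || g a := by
  convert cond hf (const true) hg using 2 with a
  cases f a <;> rfl

theorem not {f : α → Bool} (hf : PolyTime f) : PolyTime fun a => !f a := by
  convert cond hf (const false) (const true) using 2 with a
  cases f a <;> rfl

theorem eq [DecidableEq β] {f g : α → β} (hf : PolyTime f) (hg : PolyTime g) :
    PolyTime fun a => decide (f a = g a) :=
  comp (f := fun p : β × β => decide (p.1 = p.2)) ⟨_, compPoly_branchesEq, fun p => by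
    change ofBool (decide (code p.1 = code p.2)) = ofBool (decide (p.1 = p.2))
    congr 1
    rw [decide_eq_decide, code_injective.eq_iff]⟩ (hf.pair hg)

theorem headD {f : α → List β} (b : β) (hf : PolyTime f) : PolyTime fun a => (f a).headD b :=
  comp (f := fun l : List β => l.headD b) ⟨_, compPoly_id.cases' compPoly_left
    (compPoly_const (code b)), fun l => by cases l <;> rfl⟩ hf

theorem tail {f : α → List β} (hf : PolyTime f) : PolyTime fun a => (f a).tail :=
  comp (f := fun l : List β => l.tail) ⟨_, compPoly_right, fun l => by cases l <;> rfl⟩ hf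

theorem isEmpty {f : α → List β} (hf : PolyTime f) : PolyTime fun a => (f a).isEmpty :=
  comp (f := fun l : List β => l.isEmpty) ⟨_, compPoly_id.cases' (compPoly_const (code false))
    (compPoly_const (code true)), fun l => by cases l <;> rfl⟩ hf

end PolyTime

/-- A fold on trees has no free parameters, so the parameter `c` travels inside the state. -/
theorem fold_code {f : γ → σ → α → σ} {G : Tree₂ → Tree₂}
    (hG : ∀ q : α × γ × σ, G (code q) = code (q.2.1, f q.2.1 q.2.2 q.1)) (c : γ) (l : List α)
    (s : σ) : fold G (code l) (code (c, s)) = code (c, l.foldl (f c) s) := by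
  induction l generalizing s with
  | nil => rfl
  | cons a l ih => exact (congrArg (fold G (code l)) (hG (a, c, s))).trans (ih _)

theorem foldBdd_code {f : γ → σ → α → σ} {G : Tree₂ → Tree₂}
    (hG : ∀ q : α × γ × σ, G (code q) = code (q.2.1, f q.2.1 q.2.2 q.1)) {M : ℕ} (c : γ)
    (l : List α) (s : σ) (hM : ∀ l', l' <+: l → sz (c, l'.foldl (f c) s) ≤ M) :
    FoldBdd (Set.range (code : α × γ × σ → Tree₂)) G M (code l) (code (c, s)) := by
  induction l generalizing s with
  | nil => exact hM [] List.nil_prefix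
  | cons a l ih =>
    refine ⟨hM [] List.nil_prefix, ⟨(a, c, s), rfl⟩, ?_⟩
    have := ih (f c s a) fun l' hl' => hM (a :: l') (by simpa using hl')
    rwa [show G (.cons (code a) (code (c, s))) = code (c, f c s a) from hG (a, c, s)]

theorem exists_foldStep {f : γ → σ → α → σ}
    (hf : PolyTime fun q : γ × σ × α => f q.1 q.2.1 q.2.2) :
    ∃ G, CompPoly (Set.range (code : α × γ × σ → Tree₂)) G ∧
      ∀ q : α × γ × σ, G (code q) = code (q.2.1, f q.2.1 q.2.2 q.1) :=
  (PolyTime.id.snd.fst.pair (hf.comp (PolyTime.id.snd.fst.pair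
    (PolyTime.id.snd.snd.pair PolyTime.id.fst))) :
    PolyTime fun q : α × γ × σ => (q.2.1, f q.2.1 q.2.2 q.1))

/-- Iterating a polynomial-time step can make the state grow exponentially, for instance if it
doubles each time. Hence the bound `hM` on all intermediate states, those reached after a prefix of
the list. -/
theorem PolyTime.foldl {f : γ → σ → α → σ} {l : γ → List α} {s : γ → σ}
    (hf : PolyTime fun q : γ × σ × α => f q.1 q.2.1 q.2.2) (hl : PolyTime l) (hs : PolyTime s)
    (hM : ∃ k, ∀ c l', l' <+: l c → sz (l'.foldl (f c) (s c)) ≤ (sz c + 2) ^ k) :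
    PolyTime fun c => (l c).foldl (f c) (s c) := by
  obtain ⟨G, h, hG⟩ := exists_foldStep hf
  obtain ⟨P, h₀, hP⟩ := hl.pair (PolyTime.id.pair hs)
  obtain ⟨k, hM⟩ := hM
  have key := CompPoly.fold (D := Set.range fun c => code (l c, c, s c))
    (M := fun n => n + (n + 2) ^ k + 1) ((PolyBdd.id.add (polyBdd_add_two_pow k)).add (.const 1)) h
    (by
      rintro _ ⟨c, rfl⟩
      refine foldBdd_code hG c (l c) (s c) fun l' hl' => ?_
      have h₁ := hM c l' hl'
      have h₂ : sz c ≤ (code (l c, c, s c)).size := by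
        change sz c ≤ sz (l c, c, s c)
        simp only [sz_pair]; omega
      have h₃ := Nat.pow_le_pow_left (Nat.add_le_add_right h₂ 2) k
      simp only [sz_pair]
      omega)
  refine ⟨_, compPoly_right.comp (key.comp h₀ ?_) (E := Set.univ) (fun _ _ => trivial),
    fun c => ?_⟩
  · rintro _ ⟨c, rfl⟩
    exact ⟨c, (hP c).symm⟩
  · rw [hP]
    exact congrArg right (fold_code hG c (l c) (s c))

theorem ExpTime.foldl {f : γ → σ → α → σ} {l : γ → List α} {s : γ → σ}
    (hf : PolyTime fun q : γ × σ × α => f q.1 q.2.1 q.2.2) (hl : PolyTime l) (hs : PolyTime s)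
    (hM : ∃ k, ∀ c l', l' <+: l c → sz (l'.foldl (f c) (s c)) ≤ 2 ^ (sz c + 2) ^ k) :
    ExpTime fun c => (l c).foldl (f c) (s c) := by
  obtain ⟨G, h, hG⟩ := exists_foldStep hf
  obtain ⟨P, h₀, hP⟩ := hl.pair (PolyTime.id.pair hs)
  obtain ⟨k, hM⟩ := hM
  have key := CompPoly.fold_exp (D := Set.range fun c => code (l c, c, s c))
    (M := fun n => n + 2 ^ (n + 2) ^ k + 1)
    ((PolyBdd.id.expBdd.add (expBdd_two_pow k)).add (PolyBdd.const 1).expBdd) h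
    (by
      rintro _ ⟨c, rfl⟩
      refine foldBdd_code hG c (l c) (s c) fun l' hl' => ?_
      have h₁ := hM c l' hl'
      have h₂ : sz c ≤ (code (l c, c, s c)).size := by
        change sz c ≤ sz (l c, c, s c)
        simp only [sz_pair]; omega
      have h₃ : 2 ^ (sz c + 2) ^ k ≤ 2 ^ ((code (l c, c, s c)).size + 2) ^ k :=
        Nat.pow_le_pow_right (by omega) (Nat.pow_le_pow_left (Nat.add_le_add_right h₂ 2) k)
      simp only [sz_pair]
      omega)
  refine ⟨_, compPoly_right.comp_exp (key.comp_poly h₀ ?_) (E := Set.univ) (fun _ _ => trivial),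
    fun c => ?_⟩
  · rintro _ ⟨c, rfl⟩
    exact ⟨c, (hP c).symm⟩
  · rw [hP]
    exact congrArg right (fold_code hG c (l c) (s c))

end Typed

/-! ### List operations in polynomial time, subsets in exponential time -/

section Lists

open Coded (code)

variable {α β γ σ : Type} [Coded α] [Coded β] [Coded γ] [Coded σ]

theorem sz_append (l m : List α) : sz (l ++ m) + 1 = sz l + sz m := by
  induction l with
  | nil => simp [Nat.add_comm]
  | cons a l ih => simp only [List.cons_append, sz_cons]; omega

namespace PolyTime

theorem ite_eq [DecidableEq γ] {f g : α → γ} {h h' : α → β} (hf : PolyTime f) (hg : PolyTime g)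
    (hh : PolyTime h) (hh' : PolyTime h') : PolyTime fun a => if f a = g a then h a else h' a :=
  ite (hf.eq hg) hh hh'

/-- If a step enlarges the state by an amount independent of the state, the growth is linear in the
number of steps and no separate bound on intermediate states is needed. -/
theorem foldl_of_add {f : γ → σ → α → σ} {l : γ → List α} {s : γ → σ}
    (hf : PolyTime fun q : γ × σ × α => f q.1 q.2.1 q.2.2) (hl : PolyTime l) (hs : PolyTime s)
    (hM : ∃ k, ∀ c s a, sz (f c s a) ≤ sz s + (sz c + sz a + 2) ^ k) :
    PolyTime fun c => (l c).foldl (f c) (s c) := by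
  obtain ⟨k, hM⟩ := hM
  obtain ⟨kl, hkl⟩ := hl.exists_sz_le
  obtain ⟨ks, hks⟩ := hs.exists_sz_le
  have key (c : γ) (m : ℕ) (l : List α) (s : σ) (hm : ∀ a ∈ l, sz a ≤ m) :
      sz (l.foldl (f c) s) ≤ sz s + l.length * (sz c + m + 2) ^ k := by
    induction l generalizing s with
    | nil => simp
    | cons a l ih =>
      have h₁ := ih (f c s a) fun a ha => hm a (by simp [ha])
      have h₂ := hM c s a
      have h₃ : (sz c + sz a + 2) ^ k ≤ (sz c + m + 2) ^ k :=
        Nat.pow_le_pow_left (by have := hm a (by simp); omega) k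
      simp only [List.foldl_cons, List.length_cons, Nat.add_one_mul]
      omega
  have hP : PolyBdd fun n => (n + 2) ^ ks + (n + 2) ^ kl * (n + (n + 2) ^ kl + 2) ^ k :=
    (polyBdd_add_two_pow ks).add ((polyBdd_add_two_pow kl).mul
      (((PolyBdd.id.add (polyBdd_add_two_pow kl)).add (.const 2)).pow k))
  obtain ⟨j, hj⟩ := hP
  refine foldl hf hl hs ⟨j, fun c l' hl' => ?_⟩
  refine (key c (sz (l c)) l' (s c) fun a ha => sz_le_of_mem (hl'.subset ha)).trans
    ((Nat.add_le_add (hks c) (Nat.mul_le_mul ?_ (Nat.pow_le_pow_left ?_ k))).trans (hj (sz c)))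
  · exact (hl'.length_le.trans (length_lt_sz _).le).trans (hkl c)
  · have := hkl c
    omega

theorem reverse {f : α → List β} (hf : PolyTime f) : PolyTime fun a => (f a).reverse := by
  have := foldl_of_add (f := fun (_ : α) (s : List β) a => a :: s) (l := f) (s := fun _ => [])
    (cons id.snd.snd id.snd.fst) hf (const []) ⟨1, fun c s a => by simp; omega⟩
  convert this using 2 with a
  simp

theorem foldr_of_add {f : γ → α → σ → σ} {l : γ → List α} {s : γ → σ}
    (hf : PolyTime fun q : γ × σ × α => f q.1 q.2.2 q.2.1) (hl : PolyTime l) (hs : PolyTime s)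
    (hM : ∃ k, ∀ c s a, sz (f c a s) ≤ sz s + (sz c + sz a + 2) ^ k) :
    PolyTime fun c => (l c).foldr (f c) (s c) := by
  have := foldl_of_add (f := fun c s a => f c a s) hf hl.reverse hs hM
  convert this using 2 with a
  simp

theorem append {f g : α → List β} (hf : PolyTime f) (hg : PolyTime g) :
    PolyTime fun a => f a ++ g a := by
  have := foldr_of_add (f := fun (_ : α) a (s : List β) => a :: s) (l := f) (s := g)
    (cons id.snd.snd id.snd.fst) hf hg ⟨1, fun c s a => by simp; omega⟩
  convert this using 2 with a
  simp

theorem map {f : γ → α → β} {l : γ → List α} (hf : PolyTime fun q : γ × α => f q.1 q.2)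
    (hl : PolyTime l) : PolyTime fun c => (l c).map (f c) := by
  obtain ⟨k, hk⟩ := hf.exists_sz_le
  obtain ⟨j, hj⟩ := (((PolyBdd.id.add (.const 1)).add (.const 2)).pow k).add (.const 1)
  have := foldr_of_add (f := fun c a s => f c a :: s) (l := l) (s := fun _ => [])
    (cons (hf.comp (id.fst.pair id.snd.snd)) id.snd.fst) hl (const []) ⟨j, fun c s a => by
      have h₁ := hk (c, a)
      have h₂ := hj (sz c + sz a)
      simp only [sz_pair, sz_cons] at *
      omega⟩
  convert this using 2 with a
  simp

theorem filter {p : γ → α → Bool} {l : γ → List α} (hp : PolyTime fun q : γ × α => p q.1 q.2)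
    (hl : PolyTime l) : PolyTime fun c => (l c).filter (p c) := by
  have := foldr_of_add (f := fun c a s => bif p c a then a :: s else s) (l := l)
    (s := fun _ => []) (cond (hp.comp (id.fst.pair id.snd.snd)) (cons id.snd.snd id.snd.fst)
      id.snd.fst) hl (const []) ⟨1, fun c s a => by cases p c a <;> simp; omega⟩
  convert this using 2 with c
  induction l c with
  | nil => rfl
  | cons a l ih => rw [List.foldr_cons, ← ih, List.filter_cons]; cases p c a <;> simp

theorem any {p : γ → α → Bool} {l : γ → List α} (hl : PolyTime l)
    (hp : PolyTime fun q : γ × α => p q.1 q.2) : PolyTime fun c => (l c).any (p c) := by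
  have := foldr_of_add (f := fun c a s => p c a || s) (l := l)
    (s := fun _ => false) (or (hp.comp (id.fst.pair id.snd.snd)) id.snd.fst) hl (const false)
    ⟨2, fun c s a => (sz_bool_le _).trans (by nlinarith [sz_pos c, sz_pos a])⟩
  convert this using 2 with c
  induction l c with
  | nil => rfl
  | cons a l ih => rw [List.foldr_cons, ← ih, List.any_cons]

theorem all {p : γ → α → Bool} {l : γ → List α} (hl : PolyTime l)
    (hp : PolyTime fun q : γ × α => p q.1 q.2) : PolyTime fun c => (l c).all (p c) := by
  have := (any (p := fun c a => !p c a) hl hp.not).not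
  convert this using 2 with c
  simp [List.not_any_eq_all_not]

theorem mem {f : α → β} {l : α → List β} [∀ a, Decidable (f a ∈ l a)] (hl : PolyTime l)
    (hf : PolyTime f) : PolyTime fun a => decide (f a ∈ l a) := by
  classical
  have := any (p := fun a b => decide (b = f a)) hl (eq id.snd (hf.comp id.fst))
  convert this using 2 with a
  rw [Bool.eq_iff_iff]
  simp

end PolyTime

/-- Sublists of the reverse of a list. -/
def subs {α : Type} (l : List α) : List (List α) :=
  l.foldl (fun acc a => acc ++ acc.map (a :: ·)) [[]]

/-- At each element, follow the copy that contains it if `p` holds and the one that does not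
otherwise. The induction starts from an arbitrary member `G` of an arbitrary accumulator. -/
theorem exists_mem_subs {α : Type} (l : List α) (p : α → Prop) :
    ∃ F ∈ subs l, ∀ a, a ∈ F ↔ a ∈ l ∧ p a := by
  have key (acc : List (List α)) (G : List α) (hG : G ∈ acc) :
      ∃ F ∈ l.foldl (fun acc a => acc ++ acc.map (a :: ·)) acc,
        ∀ a, a ∈ F ↔ a ∈ G ∨ a ∈ l ∧ p a := by
    induction l generalizing acc G with
    | nil => exact ⟨G, hG, by simp⟩
    | cons b l ih =>
      by_cases hb : p b
      · obtain ⟨F, hF, h⟩ := ih (acc ++ acc.map (b :: ·)) (b :: G) (by simp [hG])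
        refine ⟨F, hF, fun a => (h a).trans ?_⟩
        simp only [List.mem_cons]
        constructor
        · rintro ((rfl | h) | h)
          exacts [.inr ⟨.inl rfl, hb⟩, .inl h, .inr ⟨.inr h.1, h.2⟩]
        · rintro (h | ⟨rfl | h, h'⟩)
          exacts [.inl (.inr h), .inl (.inl rfl), .inr ⟨h, h'⟩]
      · obtain ⟨F, hF, h⟩ := ih (acc ++ acc.map (b :: ·)) G (by simp [hG])
        refine ⟨F, hF, fun a => (h a).trans ?_⟩
        simp only [List.mem_cons]
        constructor
        · rintro (h | h)
          exacts [.inl h, .inr ⟨.inr h.1, h.2⟩]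
        · rintro (h | ⟨rfl | h, h'⟩)
          exacts [.inl h, absurd h' hb, .inr ⟨h, h'⟩]
  obtain ⟨F, hF, h⟩ := key [[]] [] (by simp)
  exact ⟨F, hF, by simpa using h⟩

theorem ExpTime.subs {l : γ → List α} (hl : PolyTime l) : ExpTime fun c => subs (l c) := by
  obtain ⟨k, hk⟩ := hl.exists_sz_le
  have hmap (acc : List (List α)) (a : α) :
      sz (acc.map (a :: ·)) = sz acc + acc.length * (sz a + 1) := by
    induction acc with
    | nil => simp
    | cons b acc ih =>
      simp only [List.map_cons, sz_cons, ih, List.length_cons, Nat.add_one_mul]; omega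
  -- One round doubles the accumulator and adds an element to each of the fewer than `sz acc` new
  -- members, so its size grows at most by the factor `m + 3`.
  have key (m : ℕ) (l : List α) (acc : List (List α)) (hm : ∀ a ∈ l, sz a ≤ m) :
      sz (l.foldl (fun acc a => acc ++ acc.map (a :: ·)) acc) ≤ sz acc * (m + 3) ^ l.length := by
    induction l generalizing acc with
    | nil => simp
    | cons a l ih =>
      refine (ih _ fun b hb => hm b (by simp [hb])).trans ?_
      rw [List.length_cons, pow_succ']
      rw [← Nat.mul_assoc]
      refine Nat.mul_le_mul_right _ ?_
      have h₁ := sz_append acc (acc.map (a :: ·))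
      have h₂ := length_lt_sz acc
      have h₃ := hm a (by simp)
      have h₄ : acc.length * (sz a + 1) ≤ sz acc * (m + 1) :=
        Nat.mul_le_mul h₂.le (by omega)
      rw [hmap] at h₁
      have h₅ : sz acc * (m + 3) = sz acc * (m + 1) + 2 * sz acc := by ring
      beta_reduce
      omega
  -- The 2 pays for the initial accumulator `[[]]`, of size 3 ≤ 2 ^ 2. The product comes from
  -- replacing the base `b = sz (l c) + 3` by `2 ^ b`.
  obtain ⟨j, hj⟩ := (PolyBdd.const 2).add (((polyBdd_add_two_pow k).add (.const 3)).mul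
    (polyBdd_add_two_pow k))
  refine ExpTime.foldl (f := fun (_ : γ) (acc : List (List α)) a => acc ++ acc.map (a :: ·))
    (s := fun _ => [[]]) ?_ hl (PolyTime.const _) ⟨j, fun c l' hl' => ?_⟩
  · exact PolyTime.append PolyTime.id.snd.fst (PolyTime.map (f := fun q s => q.2.2 :: s)
      (PolyTime.cons PolyTime.id.fst.snd.snd PolyTime.id.snd) PolyTime.id.snd.fst)
  · have h₁ := key (sz (l c)) l' [[]] fun a ha => sz_le_of_mem (hl'.subset ha)
    have h₂ := hl'.length_le
    have h₃ := length_lt_sz (l c)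
    have h₄ := hk c
    refine h₁.trans (le_trans ?_ (Nat.pow_le_pow_right (by omega) (hj (sz c))))
    rw [pow_add, pow_mul]
    refine Nat.mul_le_mul (by simp) ?_
    refine (Nat.pow_le_pow_left (Nat.lt_two_pow_self (n := sz (l c) + 3)).le _).trans ?_
    rw [← pow_mul, ← pow_mul]
    exact Nat.pow_le_pow_right (by omega) (Nat.mul_le_mul (by omega) (by omega))

end Lists

/-! ### The decision procedure and its running time -/

section Algorithm

open Coded (code)

/-- Words over the alphabet of formulas. -/
abbrev BWord : Type := List BRDGSymbol

/-- A node of a syntax tree: an operation symbol, the code of a term, and the codes of its immediate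
subterms (if there are two of them). -/
abbrev TNode : Type := BRDGSymbol × BWord × BWord × BWord

/-- The states of the parser, which reads words from right to left: a flag that tells if no error
has been found, the part of a variable that has been read, the stack of terms, the stack of truth
values of formulas, the nodes of all terms, and the inequalities between terms. -/
abbrev PState : Type :=
  Bool × BWord × List BWord × List Bool × List TNode × List (BWord × BWord)

/-- The state after an error. -/
def PState.fail : PState := (false, [], [], [], [], [])

/-- Is `s` a constant? -/
def BRDGSymbol.isConst (s : BRDGSymbol) : Bool := decide (s = .zero) || decide (s = .one)

/-- Is `s` a binary operation symbol? -/
def BRDGSymbol.isTermOp (s : BRDGSymbol) : Bool :=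
  decide (s = .meet) || (decide (s = .join) || (decide (s = .fus) || (decide (s = .ldiv) ||
    decide (s = .rdiv))))

/-- Is `s` a relation symbol? -/
def BRDGSymbol.isAtomOp (s : BRDGSymbol) : Bool := decide (s = .eq) || decide (s = .le)

/-- Is `s` a binary connective? -/
def BRDGSymbol.isConnective (s : BRDGSymbol) : Bool :=
  decide (s = .and) || (decide (s = .or) || decide (s = .imp))

/-- The truth table of a binary connective. -/
def BRDGSymbol.truth (s : BRDGSymbol) (p q : Bool) : Bool :=
  if s = .and then p && q else if s = .or then p || q else !p || q

/-- One step of the parser, where `g` is the list of inequalities that are assumed to hold. -/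
def PState.step (g : List (BWord × BWord)) (st : PState) (s : BRDGSymbol) : PState :=
  let m := st.2.1
  let ts := st.2.2.1
  let fs := st.2.2.2.1
  let N := st.2.2.2.2.1
  let A := st.2.2.2.2.2
  let a := ts.headD []
  let b := ts.tail.headD []
  if st.1 = true then
    if m.isEmpty = true then
      if s = .close then (true, [.close], ts, fs, N, A)
      else if s.isConst = true then (true, [], [s] :: ts, fs, (s, [s], [], []) :: N, A)
      else if s.isTermOp = true then
        if ts.tail.isEmpty = true then .fail
        else (true, [], (s :: (a ++ b)) :: ts.tail.tail, fs, (s, s :: (a ++ b), a, b) :: N, A)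
      else if s.isAtomOp = true then
        if ts.tail.isEmpty = true then .fail
        -- A relation symbol must find exactly two terms; below, a connective must find none.
        else if ts.tail.tail.isEmpty = true then
          if s = .le then (true, [], [], decide ((a, b) ∈ g) :: fs, N, (a, b) :: A)
          else (true, [], [], (decide ((a, b) ∈ g) && decide ((b, a) ∈ g)) :: fs, N,
            (a, b) :: (b, a) :: A)
        else .fail
      else if ts.isEmpty = true then
        if s = .not then
          if fs.isEmpty = true then .fail
          else (true, [], [], (!fs.headD false) :: fs.tail, N, A)
        else if s.isConnective = true then
          if fs.tail.isEmpty = true then .fail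
          else (true, [], [], s.truth (fs.headD false) (fs.tail.headD false) :: fs.tail.tail, N, A)
        else .fail
      else .fail
    else if s = .var then (true, [], (.var :: m) :: ts, fs, (.var, .var :: m, [], []) :: N, A)
    else if s = .bit1 then (true, .bit1 :: m, ts, fs, N, A)
    else if s = .bit0 then
      -- The digit next to `close` is the most significant one and must not be 0, since `Nat.bits`
      -- produces no such digits.
      if m.tail.isEmpty = true then .fail else (true, .bit0 :: m, ts, fs, N, A)
    else .fail
  else .fail

/-- The parser on a reversed word. -/
def PState.run (g : List (BWord × BWord)) (r : BWord) : PState :=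
  r.foldl (PState.step g) (true, [], [], [], [], [])

/-- Is `F` the trace of a proper prime filter of a bounded distributive lattice, as far as the
lattice operations and the inequalities in `g` are concerned? -/
def isType (N : List TNode) (g : List (BWord × BWord)) (F : List BWord) : Bool :=
  (N.all fun n =>
    if n.1 = .zero then !decide (n.2.1 ∈ F)
    else if n.1 = .one then decide (n.2.1 ∈ F)
    else if n.1 = .meet then
      decide (decide (n.2.1 ∈ F) = (decide (n.2.2.1 ∈ F) && decide (n.2.2.2 ∈ F)))
    else if n.1 = .join then
      decide (decide (n.2.1 ∈ F) = (decide (n.2.2.1 ∈ F) || decide (n.2.2.2 ∈ F)))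
    else true) &&
  g.all fun p => !decide (p.1 ∈ F) || decide (p.2 ∈ F)

/-- The largest ternary relation between types that respects `∘`, `\` and `/`. -/
def frameRel (N : List TNode) (G H F : List BWord) : Bool :=
  N.all fun n =>
    if n.1 = .fus then !(decide (n.2.2.1 ∈ G) && decide (n.2.2.2 ∈ H)) || decide (n.2.1 ∈ F)
    else if n.1 = .ldiv then
      !(decide (n.2.2.1 ∈ G) && decide (n.2.1 ∈ H)) || decide (n.2.2.2 ∈ F)
    else if n.1 = .rdiv then
      !(decide (n.2.1 ∈ G) && decide (n.2.2.2 ∈ H)) || decide (n.2.2.1 ∈ F)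
    else true

/-- Does `F` have all the witnesses it needs in `S`? -/
def hasWitnesses (N : List TNode) (S : List (List BWord)) (F : List BWord) : Bool :=
  N.all fun n =>
    if n.1 = .fus then !decide (n.2.1 ∈ F) || S.any fun G => S.any fun H =>
      frameRel N G H F && (decide (n.2.2.1 ∈ G) && decide (n.2.2.2 ∈ H))
    else if n.1 = .ldiv then decide (n.2.1 ∈ F) || S.any fun G => S.any fun F' =>
      frameRel N G F F' && (decide (n.2.2.1 ∈ G) && !decide (n.2.2.2 ∈ F'))
    else if n.1 = .rdiv then decide (n.2.1 ∈ F) || S.any fun H => S.any fun F' =>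
      frameRel N F H F' && (decide (n.2.2.2 ∈ H) && !decide (n.2.2.1 ∈ F'))
    else true

/-- Repeated elimination of the types without witnesses, as many times as `U` has members. -/
def eliminate (N : List TNode) (U S : List (List BWord)) : List (List BWord) :=
  U.foldl (fun S _ => S.filter (hasWitnesses N S)) S

/-- Are there types in `U` that realize exactly the inequalities of `A` that are in `g`? -/
def realizable (N : List TNode) (A : List (BWord × BWord)) (U : List (List BWord))
    (g : List (BWord × BWord)) : Bool :=
  A.all fun p => decide (p ∈ g) ||
    (eliminate N U (U.filter (isType N g))).any fun F => decide (p.1 ∈ F) && !decide (p.2 ∈ F)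

/-- The second part of the decision procedure. -/
def decideWith (x : BWord × List (List (BWord × BWord)) × List (List BWord)) : Bool :=
  let st := PState.run [] x.1
  (st.1 && (st.2.1.isEmpty && (st.2.2.1.isEmpty && (!st.2.2.2.1.isEmpty &&
    st.2.2.2.1.tail.isEmpty)))) &&
  x.2.1.any fun g => (PState.run g x.1).2.2.2.1.headD false &&
    realizable st.2.2.2.2.1 st.2.2.2.2.2 x.2.2 g

/-- The decision procedure, on reversed words. -/
def decideSat (r : BWord) : Bool :=
  decideWith (r, subs (PState.run [] r).2.2.2.2.2,
    subs ((PState.run [] r).2.2.2.2.1.map fun n => n.2.1))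

variable {α β γ σ : Type} [Coded α] [Coded β] [Coded γ] [Coded σ]

namespace PolyTime

theorem ifTrue {c : α → Bool} {f g : α → β} (hc : PolyTime c) (hf : PolyTime f)
    (hg : PolyTime g) : PolyTime fun a => if c a = true then f a else g a := by
  convert cond hc hf hg using 2 with a
  cases c a <;> rfl

theorem frameRel {N : γ → List TNode} {G H F : γ → List BWord} (hN : PolyTime N)
    (hG : PolyTime G) (hH : PolyTime H) (hF : PolyTime F) :
    PolyTime fun c => frameRel (N c) (G c) (H c) (F c) := by
  have op : PolyTime fun q : γ × TNode => q.2.1 := id.snd.fst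
  have t : PolyTime fun q : γ × TNode => q.2.2.1 := id.snd.snd.fst
  have a : PolyTime fun q : γ × TNode => q.2.2.2.1 := id.snd.snd.snd.fst
  have b : PolyTime fun q : γ × TNode => q.2.2.2.2 := id.snd.snd.snd.snd
  have hG' : PolyTime fun q : γ × TNode => G q.1 := hG.comp id.fst
  have hH' : PolyTime fun q : γ × TNode => H q.1 := hH.comp id.fst
  have hF' : PolyTime fun q : γ × TNode => F q.1 := hF.comp id.fst
  unfold _root_.frameRel
  refine all hN ?_
  exact ite_eq op (const _) ((((mem hG' a).and (mem hH' b)).not).or (mem hF' t)) <|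
    ite_eq op (const _) ((((mem hG' a).and (mem hH' t)).not).or (mem hF' b)) <|
    ite_eq op (const _) ((((mem hG' t).and (mem hH' b)).not).or (mem hF' a)) (const _)

theorem isType {N : γ → List TNode} {g : γ → List (BWord × BWord)} {F : γ → List BWord}
    (hN : PolyTime N) (hg : PolyTime g) (hF : PolyTime F) :
    PolyTime fun c => isType (N c) (g c) (F c) := by
  have op : PolyTime fun q : γ × TNode => q.2.1 := id.snd.fst
  have t : PolyTime fun q : γ × TNode => q.2.2.1 := id.snd.snd.fst
  have a : PolyTime fun q : γ × TNode => q.2.2.2.1 := id.snd.snd.snd.fst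
  have b : PolyTime fun q : γ × TNode => q.2.2.2.2 := id.snd.snd.snd.snd
  have hF' : PolyTime fun q : γ × TNode => F q.1 := hF.comp id.fst
  have hF₂ : PolyTime fun q : γ × (BWord × BWord) => F q.1 := hF.comp id.fst
  unfold _root_.isType
  refine and (all hN ?_) (all hg ?_)
  · exact ite_eq op (const _) (mem hF' t).not <| ite_eq op (const _) (mem hF' t) <|
      ite_eq op (const _) (eq (mem hF' t) ((mem hF' a).and (mem hF' b))) <|
      ite_eq op (const _) (eq (mem hF' t) ((mem hF' a).or (mem hF' b))) (const _)
  · exact (mem hF₂ id.snd.fst).not.or (mem hF₂ id.snd.snd)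

theorem hasWitnesses {N : γ → List TNode} {S : γ → List (List BWord)} {F : γ → List BWord}
    (hN : PolyTime N) (hS : PolyTime S) (hF : PolyTime F) :
    PolyTime fun c => hasWitnesses (N c) (S c) (F c) := by
  have op : PolyTime fun q : γ × TNode => q.2.1 := id.snd.fst
  have t : PolyTime fun q : γ × TNode => q.2.2.1 := id.snd.snd.fst
  have hF' : PolyTime fun q : γ × TNode => F q.1 := hF.comp id.fst
  have hS' : PolyTime fun q : γ × TNode => S q.1 := hS.comp id.fst
  have hS₂ : PolyTime fun q : (γ × TNode) × List BWord => S q.1.1 := hS.comp id.fst.fst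
  have hN₃ : PolyTime fun q : ((γ × TNode) × List BWord) × List BWord => N q.1.1.1 :=
    hN.comp id.fst.fst.fst
  have hF₃ : PolyTime fun q : ((γ × TNode) × List BWord) × List BWord => F q.1.1.1 :=
    hF.comp id.fst.fst.fst
  have a₃ : PolyTime fun q : ((γ × TNode) × List BWord) × List BWord => q.1.1.2.2.2.1 :=
    id.fst.fst.snd.snd.snd.fst
  have b₃ : PolyTime fun q : ((γ × TNode) × List BWord) × List BWord => q.1.1.2.2.2.2 :=
    id.fst.fst.snd.snd.snd.snd
  have X : PolyTime fun q : ((γ × TNode) × List BWord) × List BWord => q.1.2 := id.fst.snd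
  have Y : PolyTime fun q : ((γ × TNode) × List BWord) × List BWord => q.2 := id.snd
  unfold _root_.hasWitnesses
  refine all hN (ite_eq op (const _) (or (mem hF' t).not (any hS' (any hS₂ ?_))) <|
    ite_eq op (const _) (or (mem hF' t) (any hS' (any hS₂ ?_))) <|
    ite_eq op (const _) (or (mem hF' t) (any hS' (any hS₂ ?_))) (const _))
  · exact and (frameRel hN₃ X Y hF₃) (and (mem X a₃) (mem Y b₃))
  · exact and (frameRel hN₃ X hF₃ Y) (and (mem X a₃) (mem Y b₃).not)
  · exact and (frameRel hN₃ hF₃ X Y) (and (mem X b₃) (mem Y a₃).not)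

theorem _root_.sz_filter_le (p : α → Bool) (l : List α) : sz (l.filter p) ≤ sz l := by
  induction l with
  | nil => simp
  | cons a l ih => rw [List.filter_cons]; split <;> simp only [sz_cons] <;> omega

theorem eliminate {N : γ → List TNode} {U S : γ → List (List BWord)}
    (hN : PolyTime N) (hU : PolyTime U) (hS : PolyTime S) :
    PolyTime fun c => eliminate (N c) (U c) (S c) := by
  unfold _root_.eliminate
  refine foldl_of_add (f := fun c S _ => S.filter (_root_.hasWitnesses (N c) S)) ?_ hU hS
    ⟨0, fun c s a => (sz_filter_le _ _).trans (by omega)⟩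
  exact filter (hasWitnesses (hN.comp id.fst.fst) id.fst.snd.fst id.snd) id.snd.fst

theorem realizable {N : γ → List TNode} {A : γ → List (BWord × BWord)} {U : γ → List (List BWord)}
    {g : γ → List (BWord × BWord)} (hN : PolyTime N) (hA : PolyTime A) (hU : PolyTime U)
    (hg : PolyTime g) : PolyTime fun c => realizable (N c) (A c) (U c) (g c) := by
  unfold _root_.realizable
  refine all hA (or (mem (hg.comp id.fst) id.snd) (any ?_ ?_))
  · exact eliminate (hN.comp id.fst) (hU.comp id.fst) (filter
      (isType (hN.comp id.fst.fst) (hg.comp id.fst.fst) id.snd) (hU.comp id.fst))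
  · exact and (mem id.snd id.fst.snd.fst) (mem id.snd id.fst.snd.snd).not

theorem step {g : γ → List (BWord × BWord)} {st : γ → PState} {s : γ → BRDGSymbol}
    (hg : PolyTime g) (hst : PolyTime st) (hs : PolyTime s) :
    PolyTime fun c => PState.step (g c) (st c) (s c) := by
  have m := hst.snd.fst
  have ts := hst.snd.snd.fst
  have fs := hst.snd.snd.snd.fst
  have N := hst.snd.snd.snd.snd.fst
  have A := hst.snd.snd.snd.snd.snd
  have a := ts.headD []
  have b := ts.tail.headD []
  have e (x : BRDGSymbol) : PolyTime fun c => decide (s c = x) := hs.eq (const x)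
  have mk {m : γ → BWord} {ts fs N A} (m' : PolyTime m) (ts' : PolyTime ts) (fs' : PolyTime fs)
      (N' : PolyTime N) (A' : PolyTime A) :
      PolyTime fun c => ((true, m c, ts c, fs c, N c, A c) : PState) :=
    (const true).pair (m'.pair (ts'.pair (fs'.pair (N'.pair A'))))
  have nil {β : Type} [Coded β] : PolyTime fun _ : γ => ([] : List β) := const []
  have fl : PolyTime fun _ : γ => PState.fail := const _
  have app := cons hs (a.append b)
  unfold PState.step BRDGSymbol.isConst BRDGSymbol.isTermOp BRDGSymbol.isAtomOp
    BRDGSymbol.isConnective BRDGSymbol.truth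
  refine ifTrue hst.fst (ifTrue m.isEmpty ?_ ?_) fl
  · refine ite (e _) (mk (const _) ts fs N A) <| ifTrue ((e _).or (e _))
      (mk nil (cons (cons hs nil) ts) fs
        (cons (hs.pair ((cons hs nil).pair (nil.pair nil))) N) A) <|
      ifTrue ((e _).or ((e _).or ((e _).or ((e _).or (e _)))))
        (ifTrue ts.tail.isEmpty fl (mk nil (cons app ts.tail.tail) fs
          (cons (hs.pair (app.pair (a.pair b))) N) A)) <|
      ifTrue ((e _).or (e _)) (ifTrue ts.tail.isEmpty fl (ifTrue ts.tail.tail.isEmpty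
        (ite (e _) ?_ ?_) fl)) (ifTrue ts.isEmpty (ite (e _) (ifTrue fs.isEmpty fl ?_)
          (ifTrue ((e _).or ((e _).or (e _))) (ifTrue fs.tail.isEmpty fl ?_) fl)) fl)
    · exact mk nil nil (cons (mem hg (a.pair b)) fs) N (cons (a.pair b) A)
    · exact mk nil nil (cons ((mem hg (a.pair b)).and (mem hg (b.pair a))) fs) N
        (cons (a.pair b) (cons (b.pair a) A))
    · exact mk nil nil (cons (fs.headD false).not fs.tail) N A
    · have p := fs.headD false
      have q := fs.tail.headD false
      exact mk nil nil (cons (ite (e _) (p.and q) (ite (e _) (p.or q) (p.not.or q)))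
        fs.tail.tail) N A
  · exact ite (e _) (mk nil (cons (cons (const _) m) ts) fs
      (cons ((const _).pair ((cons (const _) m).pair (nil.pair nil))) N) A) <|
      ite (e _) (mk (cons (const _) m) ts fs N A) <|
      ite (e _) (ifTrue m.tail.isEmpty fl (mk (cons (const _) m) ts fs N A)) fl

end PolyTime

theorem BRDGSymbol.sz_le (s : BRDGSymbol) : sz s ≤ 33 := by cases s <;> decide

/-- The size of the parts of a state that are moved around. -/
def PState.inner (st : PState) : ℕ := sz st.2.1 + sz st.2.2.1 + sz st.2.2.2.1

/-- The size of the parts of a state that are only collected. -/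
def PState.outer (st : PState) : ℕ := sz st.2.2.2.2.1 + sz st.2.2.2.2.2

theorem sz_tail_le (l : List α) : sz l.tail ≤ sz l := by
  cases l <;> simp; omega

theorem sz_headD_add_sz_tail_le (l : List (List α)) : sz (l.headD []) + sz l.tail ≤ sz l + 1 := by
  cases l <;> simp; omega

/-- The growth of a state in one step. -/
def PState.StepLE (st st' : PState) : Prop :=
  st'.inner ≤ st.inner + 80 ∧ st'.outer ≤ st.outer + 4 * st.inner + 80

theorem PState.StepLE.ite {st st₁ st₂ : PState} {c : Prop} {_ : Decidable c} (h₁ : st.StepLE st₁)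
    (h₂ : st.StepLE st₂) : st.StepLE (if c then st₁ else st₂) := by
  split_ifs <;> assumption

-- Subterms on the stacks are moved rather than copied, so the inner part grows by a constant; the
-- outer part receives a bounded number of copies of inner material. Over a whole word this gives
-- linear and quadratic growth. The constant 80 leaves room for two symbols of size at most 33 and
-- the nodes that join the pieces.
set_option maxHeartbeats 1000000 in
theorem PState.sz_step (g : List (BWord × BWord)) (st : PState) (s : BRDGSymbol) :
    st.StepLE (step g st s) := by
  have hs := s.sz_le
  have h₁ := BRDGSymbol.close.sz_le
  have h₂ := BRDGSymbol.var.sz_le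
  have h₃ := BRDGSymbol.bit0.sz_le
  have h₄ := BRDGSymbol.bit1.sz_le
  obtain ⟨ok, m, ts, fs, N, A⟩ := st
  have hm := sz_pos m
  have hts := sz_headD_add_sz_tail_le ts
  have hts' := sz_headD_add_sz_tail_le ts.tail
  have happ := sz_append (ts.headD []) (ts.tail.headD [])
  have hfs := sz_tail_le fs
  have hfs' := sz_tail_le fs.tail
  have h₅ := sz_pos ts.tail
  have h₆ := sz_pos ts.tail.tail
  have h₇ := sz_pos fs
  have hN := sz_pos N
  have hA := sz_pos A
  have hb₁ := sz_bool_le (decide ((ts.headD [], ts.tail.headD []) ∈ g))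
  have hb₂ := sz_bool_le (decide ((ts.headD [], ts.tail.headD []) ∈ g) &&
    decide ((ts.tail.headD [], ts.headD []) ∈ g))
  have hb₃ := sz_bool_le (!fs.headD false)
  have hb₄ := sz_bool_le (s.truth (fs.headD false) (fs.tail.headD false))
  unfold step
  repeat' apply StepLE.ite
  all_goals
    simp only [StepLE, inner, outer, fail, sz_cons, sz_nil, sz_pair]
    omega

theorem PState.sz_foldl_step (g : List (BWord × BWord)) (r : BWord) (st : PState) :
    (r.foldl (step g) st).inner ≤ st.inner + 80 * r.length ∧
      (r.foldl (step g) st).outer ≤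
        st.outer + r.length * (4 * (st.inner + 80 * r.length) + 80) := by
  induction r generalizing st with
  | nil => simp
  | cons s r ih =>
    obtain ⟨h₁, h₂⟩ := sz_step g st s
    obtain ⟨h₃, h₄⟩ := ih (step g st s)
    simp only [List.foldl_cons, List.length_cons]
    refine ⟨by omega, h₄.trans ?_⟩
    have h₅ : r.length * (4 * ((step g st s).inner + 80 * r.length) + 80) ≤
        r.length * (4 * (st.inner + 80 * (r.length + 1)) + 80) :=
      Nat.mul_le_mul_left _ (by omega)
    rw [Nat.add_one_mul r.length]
    omega

theorem PolyTime.run {g : γ → List (BWord × BWord)} {r : γ → BWord}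
    (hg : PolyTime g) (hr : PolyTime r) : PolyTime fun c => PState.run (g c) (r c) := by
  obtain ⟨k, hk⟩ := hr.exists_sz_le
  have hn := polyBdd_add_two_pow k
  obtain ⟨j, hj⟩ := ((PolyBdd.const 16).add ((PolyBdd.const 80).mul hn)).add
    (hn.mul (((PolyBdd.const 4).mul ((PolyBdd.const 8).add ((PolyBdd.const 80).mul hn))).add
      (.const 80)))
  refine foldl (f := fun c st s => PState.step (g c) st s) ?_ hr (const _) ⟨j, fun c l' hl' => ?_⟩
  · exact step (hg.comp id.fst) id.snd.fst id.snd.snd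
  · refine le_trans ?_ (hj (sz c))
    obtain ⟨h₁, h₂⟩ := PState.sz_foldl_step (g c) l' (true, [], [], [], [], [])
    have h₃ : l'.length ≤ (sz c + 2) ^ k :=
      (hl'.length_le.trans (length_lt_sz _).le).trans (hk c)
    have h₄ : (4 * (8 + 80 * l'.length) + 80) ≤ (4 * (8 + 80 * (sz c + 2) ^ k) + 80) := by omega
    have h₅ := Nat.mul_le_mul h₃ h₄
    generalize l'.foldl (PState.step (g c)) (true, [], [], [], [], []) = st at *
    obtain ⟨ok, m, ts, fs, N, A⟩ := st
    have hok := sz_bool_le ok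
    have e₁ : PState.inner (true, [], [], [], [], []) = 3 := rfl
    have e₂ : PState.outer (true, [], [], [], [], []) = 2 := rfl
    rw [e₁] at h₁ h₂
    rw [e₂] at h₂
    have h₆ : l'.length * (4 * (3 + 80 * l'.length) + 80) ≤
        l'.length * (4 * (8 + 80 * l'.length) + 80) := Nat.mul_le_mul_left _ (by omega)
    simp only [PState.inner, PState.outer] at h₁ h₂
    simp only [sz_pair]
    omega

theorem polyTime_decideWith : PolyTime decideWith := by
  have st : PolyTime fun x : BWord × List (List (BWord × BWord)) × List (List BWord) =>
    PState.run [] x.1 := .run (.const _) (.fst .id)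
  unfold decideWith
  have ts := st.snd.snd.fst
  have fs := st.snd.snd.snd.fst
  refine .and (.and st.fst (.and st.snd.fst.isEmpty (.and ts.isEmpty
    (.and fs.isEmpty.not fs.tail.isEmpty)))) (.any (.fst (.snd .id)) (.and ?_ ?_))
  · exact (PolyTime.run (.snd .id) (.fst (.fst .id))).snd.snd.snd.fst.headD _
  · have st' := st.comp (PolyTime.fst (PolyTime.id (α :=
      (BWord × List (List (BWord × BWord)) × List (List BWord)) × List (BWord × BWord))))
    exact .realizable st'.snd.snd.snd.snd.fst st'.snd.snd.snd.snd.snd (.snd (.snd (.fst .id)))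
      (.snd .id)

/-- Only the two enumerations of subsets are exponential; parsing before them and testing after them
are polynomial in their respective inputs. -/
theorem expTime_decideSat : ExpTime decideSat := by
  have st : PolyTime fun r : BWord => PState.run [] r := .run (.const _) .id
  exact polyTime_decideWith.comp_exp (PolyTime.id.exp.pair
    ((ExpTime.subs st.snd.snd.snd.snd.snd).pair (ExpTime.subs
      (PolyTime.map (f := fun _ n => n.2.1) (.fst (.snd (.snd .id))) st.snd.snd.snd.snd.fst))))

/-- A language is in EXPTIME if some function in exponential time decides it on reversed words. -/
theorem inEXPTIME_of_expTime {L : Language BRDGSymbol} {f : BWord → Bool} (hf : ExpTime f)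
    (h : ∀ w, f w.reverse = true ↔ w ∈ L) : InEXPTIME L := by
  obtain ⟨F, ⟨k, hF⟩, hfF⟩ := hf
  exact inEXPTIME_of_compIn (c := code) hF
    (fun _ _ h => Nat.pow_le_pow_right (by omega) (monotone_add_two_pow k h)) (k := k)
    (fun _ => le_rfl) (fun w => ⟨w.reverse, rfl⟩) fun w => ⟨f w.reverse, hfF _, h w⟩

end Algorithm

/-! ### Correctness of the parser -/

section Parser

/-- The nodes of the syntax tree of a term. -/
def BRDGTerm.nodes : BRDGTerm → List TNode
  | .var i => [(.var, (BRDGTerm.var i).encode, [], [])]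
  | .zero => [(.zero, [.zero], [], [])]
  | .one => [(.one, [.one], [], [])]
  | .meet s t => (.meet, (meet s t).encode, s.encode, t.encode) :: (s.nodes ++ t.nodes)
  | .join s t => (.join, (join s t).encode, s.encode, t.encode) :: (s.nodes ++ t.nodes)
  | .fus s t => (.fus, (fus s t).encode, s.encode, t.encode) :: (s.nodes ++ t.nodes)
  | .ldiv s t => (.ldiv, (ldiv s t).encode, s.encode, t.encode) :: (s.nodes ++ t.nodes)
  | .rdiv s t => (.rdiv, (rdiv s t).encode, s.encode, t.encode) :: (s.nodes ++ t.nodes)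

/-- The nodes of all terms in a formula. -/
def BRDGFormula.nodes : BRDGFormula → List TNode
  | .eq s t => s.nodes ++ t.nodes
  | .le s t => s.nodes ++ t.nodes
  | .not φ => φ.nodes
  | .and φ ψ => φ.nodes ++ ψ.nodes
  | .or φ ψ => φ.nodes ++ ψ.nodes
  | .imp φ ψ => φ.nodes ++ ψ.nodes

/-- The inequalities in a formula. -/
def BRDGFormula.atoms : BRDGFormula → List (BWord × BWord)
  | .eq s t => [(s.encode, t.encode), (t.encode, s.encode)]
  | .le s t => [(s.encode, t.encode)]
  | .not φ => φ.atoms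
  | .and φ ψ => φ.atoms ++ ψ.atoms
  | .or φ ψ => φ.atoms ++ ψ.atoms
  | .imp φ ψ => φ.atoms ++ ψ.atoms

/-- The truth value of a formula if exactly the inequalities in `g` hold. -/
def BRDGFormula.evalWith (g : List (BWord × BWord)) : BRDGFormula → Bool
  | .eq s t => decide ((s.encode, t.encode) ∈ g) && decide ((t.encode, s.encode) ∈ g)
  | .le s t => decide ((s.encode, t.encode) ∈ g)
  | .not φ => !φ.evalWith g
  | .and φ ψ => φ.evalWith g && ψ.evalWith g
  | .or φ ψ => φ.evalWith g || ψ.evalWith g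
  | .imp φ ψ => !φ.evalWith g || ψ.evalWith g

namespace PState

/-- The parser reading a word from right to left, starting in any state. -/
def parse (g : List (BWord × BWord)) (w : BWord) (st : PState) : PState :=
  w.foldr (fun s st => step g st s) st

variable (g : List (BWord × BWord))

theorem run_reverse (w : BWord) : run g w.reverse = parse g w (true, [], [], [], [], []) :=
  List.foldl_reverse

theorem parse_cons (s : BRDGSymbol) (w : BWord) (st : PState) :
    parse g (s :: w) st = step g (parse g w st) s := rfl

theorem parse_append (v w : BWord) (st : PState) :
    parse g (v ++ w) st = parse g v (parse g w st) := List.foldr_append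

theorem bits_ne_nil {n : ℕ} (hn : n ≠ 0) : Nat.bits n ≠ [] := by
  cases n using Nat.binaryRec' with
  | zero => exact absurd rfl hn
  | bit b n h => simp [Nat.bits_append_bit n b h]

theorem parse_bits (i : ℕ) (ts fs N A) :
    parse g ((Nat.bits i).map BRDGSymbol.ofBit) (true, [.close], ts, fs, N, A) =
      (true, (Nat.bits i).map BRDGSymbol.ofBit ++ [.close], ts, fs, N, A) := by
  induction i using Nat.binaryRec' with
  | zero => simp [parse]
  | bit b n h ih =>
    rw [Nat.bits_append_bit n b h, List.map_cons, parse_cons, ih]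
    cases b with
    | true => simp [step, BRDGSymbol.ofBit]
    | false =>
      -- A digit 0 is never the leading one: `h` gives `n ≠ 0`, so further digits stand between it
      -- and `close`, and the check of the parser succeeds.
      obtain ⟨c, l, hl⟩ := List.exists_cons_of_ne_nil
        (bits_ne_nil fun hn => Bool.false_ne_true (h hn))
      simp [step, BRDGSymbol.ofBit, hl]

theorem parse_term (t : BRDGTerm) (ts fs N A) :
    parse g t.encode (true, [], ts, fs, N, A) =
      (true, [], t.encode :: ts, fs, t.nodes ++ N, A) := by
  induction t generalizing ts N with
  | var i =>
    simp only [BRDGTerm.encode, BRDGTerm.nodes, parse_cons, parse_append]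
    rw [show step g (parse g [] (true, [], ts, fs, N, A)) .close =
      (true, [.close], ts, fs, N, A) from rfl, parse_bits]
    simp [step]
  | zero | one => rfl
  | meet _ _ hs ht | join _ _ hs ht | fus _ _ hs ht | ldiv _ _ hs ht | rdiv _ _ hs ht =>
    simp only [BRDGTerm.encode, BRDGTerm.nodes, parse_cons, parse_append, hs, ht,
      List.cons_append, List.append_assoc]
    rfl

/-- The nodes and inequalities collected do not depend on `g`; only the truth value does. Hence one
run with `[]` yields the syntax, and further runs serve as evaluations. -/
theorem parse_formula (φ : BRDGFormula) (fs N A) :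
    parse g φ.encode (true, [], [], fs, N, A) =
      (true, [], [], φ.evalWith g :: fs, φ.nodes ++ N, φ.atoms ++ A) := by
  induction φ generalizing fs N A with
  | eq | le =>
    simp only [BRDGFormula.encode, BRDGFormula.nodes, parse_cons, parse_append, parse_term,
      List.append_assoc]
    rfl
  | not _ hs =>
    simp only [BRDGFormula.encode, BRDGFormula.nodes, parse_cons, hs]
    rfl
  | and _ _ hs ht | or _ _ hs ht | imp _ _ hs ht =>
    simp only [BRDGFormula.encode, BRDGFormula.nodes, parse_cons, parse_append, hs, ht,
      List.append_assoc, BRDGFormula.atoms]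
    rfl

theorem run_encode (φ : BRDGFormula) :
    run g φ.encode.reverse = (true, [], [], [φ.evalWith g], φ.nodes, φ.atoms) := by
  rw [run_reverse, parse_formula, List.append_nil, List.append_nil]

/-- If no error was found, then the word that was read consists of a part of a variable, terms and
formulas. -/
def Valid (w : BWord) (st : PState) : Prop :=
  st.1 = true → ∃ (tl : List BRDGTerm) (φl : List BRDGFormula),
    st.2.2.1 = tl.map BRDGTerm.encode ∧ st.2.2.2.1.length = φl.length ∧
    w = st.2.1 ++ ((tl.map BRDGTerm.encode).flatten ++ (φl.map BRDGFormula.encode).flatten) ∧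
    (st.2.1 = [] ∨ ∃ i, st.2.1 = (Nat.bits i).map BRDGSymbol.ofBit ++ [.close])

theorem Valid.fail (w : BWord) : Valid w fail := by rintro ⟨⟩

/-- In a state without error, all pending terms lie to the left of all pending formulas, because
relation symbols and connectives leave no terms pending. Each accepted symbol then applies one
constructor to the leftmost pieces. -/
theorem Valid.step {w : BWord} {st : PState} (h : Valid w st) (s : BRDGSymbol) :
    Valid (s :: w) (step g st s) := by
  obtain ⟨ok, m, ts, fs, N, A⟩ := st
  cases ok with
  | false => exact .fail _
  | true =>
  obtain ⟨tl, φl, rfl, hfs, rfl, hm⟩ := h rfl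
  simp only at hfs hm
  rcases m with _ | ⟨c, m⟩
  · cases s with
    | close => exact fun _ => ⟨tl, φl, rfl, hfs, rfl, .inr ⟨0, rfl⟩⟩
    | zero => exact fun _ => ⟨.zero :: tl, φl, rfl, hfs, rfl, .inl rfl⟩
    | one => exact fun _ => ⟨.one :: tl, φl, rfl, hfs, rfl, .inl rfl⟩
    | var | bit0 | bit1 =>
      rcases tl with _ | ⟨a, tl⟩ <;> exact .fail _
    | meet =>
      rcases tl with _ | ⟨a, _ | ⟨b, tl⟩⟩
      · exact .fail _
      · exact .fail _
      · exact fun _ => ⟨.meet a b :: tl, φl, rfl, hfs, by change _ = [] ++ _; simp [BRDGTerm.encode],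
          .inl rfl⟩
    | join =>
      rcases tl with _ | ⟨a, _ | ⟨b, tl⟩⟩
      · exact .fail _
      · exact .fail _
      · exact fun _ => ⟨.join a b :: tl, φl, rfl, hfs, by change _ = [] ++ _; simp [BRDGTerm.encode],
          .inl rfl⟩
    | fus =>
      rcases tl with _ | ⟨a, _ | ⟨b, tl⟩⟩
      · exact .fail _
      · exact .fail _
      · exact fun _ => ⟨.fus a b :: tl, φl, rfl, hfs, by change _ = [] ++ _; simp [BRDGTerm.encode],
          .inl rfl⟩
    | ldiv =>
      rcases tl with _ | ⟨a, _ | ⟨b, tl⟩⟩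
      · exact .fail _
      · exact .fail _
      · exact fun _ => ⟨.ldiv a b :: tl, φl, rfl, hfs, by change _ = [] ++ _; simp [BRDGTerm.encode],
          .inl rfl⟩
    | rdiv =>
      rcases tl with _ | ⟨a, _ | ⟨b, tl⟩⟩
      · exact .fail _
      · exact .fail _
      · exact fun _ => ⟨.rdiv a b :: tl, φl, rfl, hfs, by change _ = [] ++ _; simp [BRDGTerm.encode],
          .inl rfl⟩
    | eq =>
      rcases tl with _ | ⟨a, _ | ⟨b, _ | ⟨c, tl⟩⟩⟩
      · exact .fail _
      · exact .fail _
      · exact fun _ => ⟨[], .eq a b :: φl, rfl, congrArg (· + 1) hfs,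
          by change _ = [] ++ _; simp [BRDGFormula.encode], .inl rfl⟩
      · exact .fail _
    | le =>
      rcases tl with _ | ⟨a, _ | ⟨b, _ | ⟨c, tl⟩⟩⟩
      · exact .fail _
      · exact .fail _
      · exact fun _ => ⟨[], .le a b :: φl, rfl, congrArg (· + 1) hfs,
          by change _ = [] ++ _; simp [BRDGFormula.encode], .inl rfl⟩
      · exact .fail _
    | not =>
      rcases tl with _ | ⟨a, tl⟩
      · rcases fs with _ | ⟨p, fs⟩
        · exact .fail _
        · obtain ⟨φ, φl, rfl⟩ := List.exists_cons_of_length_eq_add_one hfs.symm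
          exact fun _ => ⟨[], .not φ :: φl, rfl, hfs, by change _ = [] ++ _; simp [BRDGFormula.encode],
            .inl rfl⟩
      · exact .fail _
    | and =>
      rcases tl with _ | ⟨a, tl⟩
      · rcases fs with _ | ⟨p, _ | ⟨q, fs⟩⟩
        · exact .fail _
        · exact .fail _
        · rcases φl with _ | ⟨φ, _ | ⟨ψ, φl⟩⟩ <;> simp at hfs
          exact fun _ => ⟨[], .and φ ψ :: φl, rfl, congrArg (· + 1) hfs,
            by change _ = [] ++ _; simp [BRDGFormula.encode], .inl rfl⟩
      · exact .fail _
    | or =>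
      rcases tl with _ | ⟨a, tl⟩
      · rcases fs with _ | ⟨p, _ | ⟨q, fs⟩⟩
        · exact .fail _
        · exact .fail _
        · rcases φl with _ | ⟨φ, _ | ⟨ψ, φl⟩⟩ <;> simp at hfs
          exact fun _ => ⟨[], .or φ ψ :: φl, rfl, congrArg (· + 1) hfs,
            by change _ = [] ++ _; simp [BRDGFormula.encode], .inl rfl⟩
      · exact .fail _
    | imp =>
      rcases tl with _ | ⟨a, tl⟩
      · rcases fs with _ | ⟨p, _ | ⟨q, fs⟩⟩
        · exact .fail _
        · exact .fail _
        · rcases φl with _ | ⟨φ, _ | ⟨ψ, φl⟩⟩ <;> simp at hfs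
          exact fun _ => ⟨[], .imp φ ψ :: φl, rfl, congrArg (· + 1) hfs,
            by change _ = [] ++ _; simp [BRDGFormula.encode], .inl rfl⟩
      · exact .fail _
  · obtain ⟨i, hi⟩ := hm.resolve_left (by simp)
    cases s with
    | var =>
      exact fun _ => ⟨.var i :: tl, φl, by simp [PState.step, hi, BRDGTerm.encode], hfs,
        by simp [PState.step, hi, BRDGTerm.encode], .inl rfl⟩
    | bit1 =>
      -- The least significant digit is written first, so putting a digit in front doubles the
      -- number.
      exact fun _ => ⟨tl, φl, rfl, hfs, rfl, .inr ⟨2 * i + 1, by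
        simp [PState.step, hi, BRDGSymbol.ofBit]⟩⟩
    | bit0 =>
      rcases m with _ | ⟨d, m⟩
      · exact .fail _
      · have hi0 : i ≠ 0 := by
          rintro rfl
          simp at hi
        exact fun _ => ⟨tl, φl, rfl, hfs, rfl, .inr ⟨2 * i, by
          change BRDGSymbol.bit0 :: c :: d :: m = _
          simp [hi, hi0, BRDGSymbol.ofBit]⟩⟩
    | _ => exact .fail _

theorem valid_parse (w : BWord) : Valid w (parse g w (true, [], [], [], [], [])) := by
  induction w with
  | nil => exact fun _ => ⟨[], [], rfl, rfl, rfl, .inl rfl⟩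
  | cons s w ih => exact ih.step g s

end PState

/-- If the final state has no pending variable, no term and a single truth value, then
`PState.Valid` says that the word is the code of one formula; on such codes the runs are known
explicitly. -/
theorem decideSat_reverse (w : BWord) : decideSat w.reverse = true ↔
    ∃ φ : BRDGFormula, φ.encode = w ∧ ∃ g ∈ subs φ.atoms, φ.evalWith g = true ∧
      realizable φ.nodes φ.atoms (subs (φ.nodes.map fun n => n.2.1)) g = true := by
  constructor
  · intro h
    obtain ⟨φ, rfl⟩ : ∃ φ : BRDGFormula, φ.encode = w := by
      have hv := PState.valid_parse [] w
      simp only [decideSat, decideWith, Bool.and_eq_true, PState.run_reverse] at h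
      obtain ⟨⟨h₁, h₂, h₃, h₄, h₅⟩, -⟩ := h
      obtain ⟨tl, φl, h₆, h₇, h₈, -⟩ := hv h₁
      rw [List.isEmpty_iff] at h₂ h₃ h₅
      rw [h₃, eq_comm, List.map_eq_nil_iff] at h₆
      obtain ⟨p, hp⟩ : ∃ p, (PState.parse [] w (true, [], [], [], [], [])).2.2.2.1 = [p] := by
        revert h₄ h₅
        rcases (PState.parse [] w (true, [], [], [], [], [])).2.2.2.1 with _ | ⟨p, l⟩ <;> simp
      rw [hp] at h₇
      obtain ⟨φ, rfl⟩ := List.length_eq_one_iff.1 h₇.symm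
      exact ⟨φ, by simpa [h₂, h₆] using h₈.symm⟩
    simp only [decideSat, decideWith, PState.run_encode, Bool.and_eq_true, List.any_eq_true,
      List.headD_cons] at h
    exact ⟨φ, rfl, h.2⟩
  · rintro ⟨φ, rfl, h⟩
    simp only [decideSat, decideWith, PState.run_encode, Bool.and_eq_true, List.any_eq_true,
      List.headD_cons]
    exact ⟨by simp, h⟩

end Parser

/-! ### Prime filters and join-preserving operations -/

section PrimeFilters

variable {A : Type*} [DistribLattice A] [BoundedOrder A]

/-- A filter of a bounded lattice. -/
structure LatticeFilter (P : Set A) : Prop where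
  top_mem : ⊤ ∈ P
  mem_of_le {a b} : a ≤ b → a ∈ P → b ∈ P
  inf_mem {a b} : a ∈ P → b ∈ P → a ⊓ b ∈ P

/-- A proper prime filter of a bounded lattice. -/
structure PrimeFilter (P : Set A) : Prop extends LatticeFilter P where
  bot_notMem : ⊥ ∉ P
  mem_or_mem {a b} : a ⊔ b ∈ P → a ∈ P ∨ b ∈ P

/-- An ideal of a bounded lattice. -/
structure LatticeIdeal (I : Set A) : Prop where
  bot_mem : ⊥ ∈ I
  mem_of_le {a b} : a ≤ b → b ∈ I → a ∈ I
  sup_mem {a b} : a ∈ I → b ∈ I → a ⊔ b ∈ I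

theorem latticeFilter_Ici (a : A) : LatticeFilter (Set.Ici a) :=
  ⟨le_top, fun h h' => le_trans h' h, le_inf⟩

theorem latticeIdeal_Iic (a : A) : LatticeIdeal (Set.Iic a) := ⟨bot_le, le_trans, sup_le⟩

/-- In a distributive lattice a prime ideal above `I` avoids `F`; its complement is the prime
filter. -/
theorem LatticeFilter.exists_primeFilter {F I : Set A} (hF : LatticeFilter F)
    (hI : LatticeIdeal I) (h : ∀ a ∈ F, a ∉ I) :
    ∃ P, PrimeFilter P ∧ F ⊆ P ∧ ∀ a ∈ P, a ∉ I := by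
  have hF' : Order.IsPFilter F := .of_def ⟨⊤, hF.top_mem⟩
    (fun a ha b hb => ⟨a ⊓ b, hF.inf_mem ha hb, inf_le_left, inf_le_right⟩)
    fun h => hF.mem_of_le h
  have hI' : Order.IsIdeal I := ⟨fun a b h hb => hI.mem_of_le h hb, ⟨⊥, hI.bot_mem⟩,
    fun a ha b hb => ⟨a ⊔ b, hI.sup_mem ha hb, le_sup_left, le_sup_right⟩⟩
  obtain ⟨J, hJ, hIJ, hFJ⟩ := DistribLattice.prime_ideal_of_disjoint_filter_ideal
    (F := hF'.toPFilter) (I := hI'.toIdeal) (Set.disjoint_left.2 h)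
  refine ⟨(J : Set A)ᶜ, ⟨⟨?_, ?_, ?_⟩, ?_, ?_⟩, ?_, ?_⟩
  · exact Set.disjoint_left.1 hFJ hF.top_mem
  · exact fun hab ha hb => ha (J.lower hab hb)
  · exact fun ha hb hab => (hJ.mem_or_mem hab).elim ha hb
  · exact fun h => h J.bot_mem
  · intro a b hab
    by_contra! h
    exact hab (Order.Ideal.sup_mem (not_not.1 h.1) (not_not.1 h.2))
  · exact fun a ha => Set.disjoint_left.1 hFJ ha
  · exact fun a ha haI => ha (hIJ haI)

theorem exists_primeFilter_of_not_le {a b : A} (h : ¬ a ≤ b) :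
    ∃ P, PrimeFilter P ∧ a ∈ P ∧ b ∉ P := by
  obtain ⟨P, hP, h₁, h₂⟩ := (latticeFilter_Ici a).exists_primeFilter (latticeIdeal_Iic b)
    fun c hac hcb => h (le_trans hac hcb)
  exact ⟨P, hP, h₁ le_rfl, fun h => h₂ b h le_rfl⟩

/-- A binary operation that preserves finite joins in both arguments. -/
structure JoinPreserving (f : A → A → A) : Prop where
  sup_left (a b c) : f (a ⊔ b) c = f a c ⊔ f b c
  sup_right (a b c) : f a (b ⊔ c) = f a b ⊔ f a c
  bot_left (a) : f ⊥ a = ⊥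
  bot_right (a) : f a ⊥ = ⊥

namespace JoinPreserving

variable {f : A → A → A}

theorem mono (hf : JoinPreserving f) {a a' b b' : A} (h : a ≤ a') (h' : b ≤ b') :
    f a b ≤ f a' b' := by
  rw [← sup_eq_right.2 h, ← sup_eq_right.2 h', hf.sup_left, hf.sup_right, sup_assoc]
  exact le_sup_left

/-- The elements `a` with `f a b ∉ R` for some `b ∈ G` form an ideal, because `f` preserves joins,
`R` is prime and `G` is closed under meets. A prime filter through `s` that avoids this ideal is as
desired. -/
theorem exists_left (hf : JoinPreserving f) {G R : Set A} (hG : LatticeFilter G)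
    (hR : PrimeFilter R) {s : A} (h : ∀ b ∈ G, f s b ∈ R) :
    ∃ P, PrimeFilter P ∧ s ∈ P ∧ ∀ a ∈ P, ∀ b ∈ G, f a b ∈ R := by
  have hI : LatticeIdeal {a | ∃ b ∈ G, f a b ∉ R} := by
    refine ⟨⟨⊤, hG.top_mem, by rw [hf.bot_left]; exact hR.bot_notMem⟩, ?_, ?_⟩
    · rintro a a' haa' ⟨b, hb, hab⟩
      exact ⟨b, hb, fun h => hab (hR.mem_of_le (hf.mono haa' le_rfl) h)⟩
    · rintro a a' ⟨b, hb, hab⟩ ⟨b', hb', hab'⟩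
      refine ⟨b ⊓ b', hG.inf_mem hb hb', fun h => ?_⟩
      rw [hf.sup_left] at h
      exact (hR.mem_or_mem h).elim (fun h => hab (hR.mem_of_le (hf.mono le_rfl inf_le_left) h))
        fun h => hab' (hR.mem_of_le (hf.mono le_rfl inf_le_right) h)
  obtain ⟨P, hP, h₁, h₂⟩ := (latticeFilter_Ici s).exists_primeFilter hI
    fun a ha ⟨b, hb, hab⟩ => hab (hR.mem_of_le (hf.mono ha le_rfl) (h b hb))
  refine ⟨P, hP, h₁ le_rfl, fun a ha b hb => ?_⟩
  by_contra hab
  exact h₂ a ha ⟨b, hb, hab⟩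

theorem swap (hf : JoinPreserving f) : JoinPreserving fun a b => f b a :=
  ⟨fun a b c => hf.sup_right c a b, fun a b c => hf.sup_left b c a, hf.bot_right, hf.bot_left⟩

/-- One argument at a time: first find `P` for the principal filter of `t`, then, with `P` fixed,
find a prime filter `Q` through `t`. -/
theorem exists_of_mem (hf : JoinPreserving f) {R : Set A} (hR : PrimeFilter R) {s t : A}
    (h : f s t ∈ R) :
    ∃ P Q, PrimeFilter P ∧ PrimeFilter Q ∧ s ∈ P ∧ t ∈ Q ∧ ∀ a ∈ P, ∀ b ∈ Q, f a b ∈ R := by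
  obtain ⟨P, hP, hs, h₁⟩ := hf.exists_left (latticeFilter_Ici t) hR
    fun b hb => hR.mem_of_le (hf.mono le_rfl hb) h
  obtain ⟨Q, hQ, ht, h₂⟩ := hf.swap.exists_left hP.toLatticeFilter hR
    fun b hb => h₁ b hb t le_rfl
  exact ⟨P, Q, hP, hQ, hs, ht, fun a ha b hb => h₂ b hb a ha⟩

/-- The filter generated by all `f s b` with `b ∈ Q` misses `t`. Extend it to a prime filter `R`
without `t`, then find `P` by `exists_left`. -/
theorem exists_of_not_le (hf : JoinPreserving f) {Q : Set A} (hQ : PrimeFilter Q) {s t : A}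
    (h : ∀ b ∈ Q, ¬ f s b ≤ t) :
    ∃ P R, PrimeFilter P ∧ PrimeFilter R ∧ s ∈ P ∧ t ∉ R ∧ ∀ a ∈ P, ∀ b ∈ Q, f a b ∈ R := by
  have hF : LatticeFilter {c | ∃ b ∈ Q, f s b ≤ c} := by
    refine ⟨⟨⊤, hQ.top_mem, le_top⟩, ?_, ?_⟩
    · rintro c d hcd ⟨b, hb, hbc⟩
      exact ⟨b, hb, hbc.trans hcd⟩
    · rintro c d ⟨b, hb, hbc⟩ ⟨b', hb', hbd⟩
      exact ⟨b ⊓ b', hQ.inf_mem hb hb', le_inf ((hf.mono le_rfl inf_le_left).trans hbc)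
        ((hf.mono le_rfl inf_le_right).trans hbd)⟩
  obtain ⟨R, hR, h₁, h₂⟩ := hF.exists_primeFilter (latticeIdeal_Iic t)
    fun c ⟨b, hb, hbc⟩ hct => h b hb (hbc.trans hct)
  obtain ⟨P, hP, hs, h₃⟩ := hf.exists_left hQ.toLatticeFilter hR
    fun b hb => h₁ ⟨b, hb, le_rfl⟩
  exact ⟨P, R, hP, hR, hs, fun h => h₂ t h le_rfl, h₃⟩

end JoinPreserving

end PrimeFilters

/-! ### Residuation and complex algebras -/

namespace BRDG

theorem joinPreserving (A : Type*) [BRDG A] : JoinPreserving (fus : A → A → A) where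
  sup_left a b c := eq_of_forall_ge_iff fun d => by simp [fus_le_iff_le_rdiv]
  sup_right a b c := eq_of_forall_ge_iff fun d => by simp [fus_le_iff_le_ldiv]
  bot_left a := eq_bot_iff.2 <| (fus_le_iff_le_rdiv _ _ _).2 bot_le
  bot_right a := eq_bot_iff.2 <| (fus_le_iff_le_ldiv _ _ _).2 bot_le

/-- The complex algebra of a ternary relation. -/
@[reducible] def ofFrame {X : Type*} (R : X → X → X → Prop) : BRDG (Set X) where
  fus P Q := {z | ∃ x ∈ P, ∃ y ∈ Q, R x y z}
  ldiv P Q := {y | ∀ x ∈ P, ∀ z, R x y z → z ∈ Q}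
  rdiv Q P := {x | ∀ y ∈ P, ∀ z, R x y z → z ∈ Q}
  fus_le_iff_le_ldiv _ _ _ := ⟨fun h y hy x hx _ hz => h ⟨x, hx, y, hy, hz⟩,
    fun h z ⟨x, hx, _, hy, hz⟩ => h hy x hx z hz⟩
  fus_le_iff_le_rdiv _ _ _ := ⟨fun h x hx y hy _ hz => h ⟨x, hx, y, hy, hz⟩,
    fun h z ⟨_, hx, y, hy, hz⟩ => h hx y hy z hz⟩

end BRDG

/-! ### Unique readability of terms -/

section Encoding

theorem Nat.bits_injective : Function.Injective Nat.bits := fun m n h =>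
  Nat.eq_of_testBit_eq fun i => by rw [Nat.testBit_eq_inth, Nat.testBit_eq_inth, h]

theorem map_ofBit_append_close_inj {l l' : List Bool} {u u' : BWord}
    (h : l.map BRDGSymbol.ofBit ++ .close :: u = l'.map BRDGSymbol.ofBit ++ .close :: u') :
    l = l' ∧ u = u' := by
  induction l generalizing l' with
  | nil =>
    rcases l' with _ | ⟨_ | _, l'⟩
    · simpa using h
    · simp [BRDGSymbol.ofBit] at h
    · simp [BRDGSymbol.ofBit] at h
  | cons b l ih =>
    rcases l' with _ | ⟨c, l'⟩
    · cases b <;> simp [BRDGSymbol.ofBit] at h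
    · simp only [List.map_cons, List.cons_append, List.cons.injEq] at h
      obtain ⟨rfl, rfl⟩ := ih h.2
      refine ⟨?_, rfl⟩
      cases b <;> cases c <;> simp_all [BRDGSymbol.ofBit]

namespace BRDGTerm

/-- Prefix notation needs no brackets, and `close` ends the digits of a variable. Types contain
codes in place of terms, so a code must determine its term. -/
theorem encode_append_inj {s t : BRDGTerm} {u v : BWord} (h : s.encode ++ u = t.encode ++ v) :
    s = t ∧ u = v := by
  induction s generalizing t u v with
  | var i =>
    cases t <;> simp only [encode, List.cons_append, List.append_assoc, List.nil_append,
      List.cons.injEq, reduceCtorEq, true_and, false_and] at h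
    obtain ⟨h', rfl⟩ := map_ofBit_append_close_inj h
    exact ⟨congrArg _ (Nat.bits_injective h'), rfl⟩
  | zero | one =>
    cases t <;> simp only [encode, List.cons_append, List.nil_append,
      List.cons.injEq, reduceCtorEq, true_and, false_and] at h
    exact ⟨rfl, h⟩
  | meet _ _ h₁ h₂ | join _ _ h₁ h₂ | fus _ _ h₁ h₂ | ldiv _ _ h₁ h₂ | rdiv _ _ h₁ h₂ =>
    cases t <;> simp only [encode, List.cons_append, List.append_assoc, List.nil_append,
      List.cons.injEq, reduceCtorEq, true_and, false_and] at h
    obtain ⟨rfl, h'⟩ := h₁ h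
    obtain ⟨rfl, rfl⟩ := h₂ h'
    exact ⟨rfl, rfl⟩

theorem encode_injective : Function.Injective encode := fun s t h =>
  (encode_append_inj (u := []) (v := []) (by simpa using h)).1

end BRDGTerm

end Encoding

/-! ### Nodes, inequalities and truth values -/

section Semantics

/-- The terms in a list of nodes. -/
abbrev names (N : List TNode) : List BWord := N.map fun n => n.2.1

/-- The nodes of terms that belong, with their immediate subterms, to a given list. -/
inductive NodeOf (L : List BWord) : TNode → Prop
  | var (i : ℕ) : NodeOf L (.var, (BRDGTerm.var i).encode, [], [])
  | zero : BRDGTerm.zero.encode ∈ L → NodeOf L (.zero, BRDGTerm.zero.encode, [], [])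
  | one : BRDGTerm.one.encode ∈ L → NodeOf L (.one, BRDGTerm.one.encode, [], [])
  | meet {s t : BRDGTerm} : s.encode ∈ L → t.encode ∈ L → (s.meet t).encode ∈ L →
      NodeOf L (.meet, (s.meet t).encode, s.encode, t.encode)
  | join {s t : BRDGTerm} : s.encode ∈ L → t.encode ∈ L → (s.join t).encode ∈ L →
      NodeOf L (.join, (s.join t).encode, s.encode, t.encode)
  | fus {s t : BRDGTerm} : s.encode ∈ L → t.encode ∈ L → (s.fus t).encode ∈ L →
      NodeOf L (.fus, (s.fus t).encode, s.encode, t.encode)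
  | ldiv {s t : BRDGTerm} : s.encode ∈ L → t.encode ∈ L → (s.ldiv t).encode ∈ L →
      NodeOf L (.ldiv, (s.ldiv t).encode, s.encode, t.encode)
  | rdiv {s t : BRDGTerm} : s.encode ∈ L → t.encode ∈ L → (s.rdiv t).encode ∈ L →
      NodeOf L (.rdiv, (s.rdiv t).encode, s.encode, t.encode)

theorem BRDGTerm.encode_mem_names (t : BRDGTerm) : t.encode ∈ names t.nodes := by
  cases t <;> exact List.mem_cons_self

theorem BRDGTerm.nodeOf (t : BRDGTerm) {L : List BWord} (h : names t.nodes ⊆ L) :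
    ∀ n ∈ t.nodes, NodeOf L n := by
  have h₀ := h t.encode_mem_names
  induction t with
  | var => exact List.forall_mem_singleton.2 (.var _)
  | zero => exact List.forall_mem_singleton.2 (.zero h₀)
  | one => exact List.forall_mem_singleton.2 (.one h₀)
  | meet s t hs ht | join s t hs ht | fus s t hs ht | ldiv s t hs ht | rdiv s t hs ht =>
    simp only [names, nodes, List.map_cons, List.map_append, List.cons_subset,
      List.append_subset] at h
    have h₁ := h.2.1 s.encode_mem_names
    have h₂ := h.2.2 t.encode_mem_names
    refine List.forall_mem_cons.2 ⟨by constructor <;> assumption, fun n hn => ?_⟩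
    exact (List.mem_append.1 hn).elim (hs h.2.1 h₁ n) (ht h.2.2 h₂ n)

namespace BRDGFormula

theorem nodeOf (φ : BRDGFormula) {L : List BWord} (h : names φ.nodes ⊆ L) :
    ∀ n ∈ φ.nodes, NodeOf L n := by
  induction φ with
  | eq s t | le s t =>
    simp only [names, nodes, List.map_append, List.append_subset] at h
    exact fun n hn => (List.mem_append.1 hn).elim (s.nodeOf h.1 n) (t.nodeOf h.2 n)
  | not φ hφ => exact hφ h
  | and φ ψ hφ hψ | or φ ψ hφ hψ | imp φ ψ hφ hψ =>
    simp only [names, nodes, List.map_append, List.append_subset] at h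
    exact fun n hn => (List.mem_append.1 hn).elim (hφ h.1 n) (hψ h.2 n)

theorem exists_of_mem_atoms {φ : BRDGFormula} {p : BWord × BWord} (h : p ∈ φ.atoms) :
    ∃ s t : BRDGTerm, p = (s.encode, t.encode) ∧ s.nodes ⊆ φ.nodes ∧ t.nodes ⊆ φ.nodes := by
  induction φ with
  | eq s t =>
    simp only [atoms, List.mem_cons, List.not_mem_nil, or_false] at h
    rcases h with rfl | rfl
    · exact ⟨s, t, rfl, List.subset_append_left _ _, List.subset_append_right _ _⟩
    · exact ⟨t, s, rfl, List.subset_append_right _ _, List.subset_append_left _ _⟩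
  | le s t =>
    exact ⟨s, t, List.mem_singleton.1 h, List.subset_append_left _ _,
      List.subset_append_right _ _⟩
  | not φ hφ => exact hφ h
  | and φ ψ hφ hψ | or φ ψ hφ hψ | imp φ ψ hφ hψ =>
    rcases List.mem_append.1 h with h | h
    · obtain ⟨s, t, rfl, hs, ht⟩ := hφ h
      exact ⟨s, t, rfl, List.subset_append_of_subset_left _ hs,
        List.subset_append_of_subset_left _ ht⟩
    · obtain ⟨s, t, rfl, hs, ht⟩ := hψ h
      exact ⟨s, t, rfl, List.subset_append_of_subset_right _ hs,
        List.subset_append_of_subset_right _ ht⟩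

theorem evalWith_iff {A : Type*} [BRDG A] {v : ℕ → A} {g : List (BWord × BWord)} (φ : BRDGFormula)
    (h : ∀ s t : BRDGTerm, (s.encode, t.encode) ∈ φ.atoms →
      ((s.encode, t.encode) ∈ g ↔ s.eval v ≤ t.eval v)) :
    φ.evalWith g = true ↔ φ.Holds v := by
  induction φ with
  | eq s t =>
    have h₁ := h s t (by simp [atoms])
    have h₂ := h t s (by simp [atoms])
    rw [evalWith, Bool.and_eq_true, decide_eq_true_eq, decide_eq_true_eq, h₁, h₂]
    exact le_antisymm_iff.symm
  | le s t => simpa [evalWith, Holds] using h s t (by simp [atoms])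
  | not φ hφ => simp [evalWith, Holds, ← hφ h]
  | and φ ψ hφ hψ | or φ ψ hφ hψ | imp φ ψ hφ hψ =>
    have h₁ := hφ fun s t hst => h s t (List.mem_append_left _ hst)
    have h₂ := hψ fun s t hst => h s t (List.mem_append_right _ hst)
    simp [evalWith, Holds, ← h₁, ← h₂, imp_iff_not_or]

end BRDGFormula

theorem decide_eq_decide_and_iff {p q r : Prop} [Decidable p] [Decidable q] [Decidable r] :
    decide p = (decide q && decide r) ↔ (p ↔ q ∧ r) := by
  rw [← Bool.decide_and, decide_eq_decide]

theorem decide_eq_decide_or_iff {p q r : Prop} [Decidable p] [Decidable q] [Decidable r] :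
    decide p = (decide q || decide r) ↔ (p ↔ q ∨ r) := by
  rw [← Bool.decide_or, decide_eq_decide]

/-! ### Satisfiable formulas pass the test -/

section Traces

variable {A : Type*} [BRDG A] {v : ℕ → A} {L : List BWord} {N : List TNode}
  {g : List (BWord × BWord)}

/-- `F` is the set of those terms in `L` whose value is in `P`. -/
def IsTrace (L : List BWord) (v : ℕ → A) (P : Set A) (F : List BWord) : Prop :=
  ∀ t : BRDGTerm, t.encode ∈ L → (t.encode ∈ F ↔ t.eval v ∈ P)

theorem exists_isTrace (L : List BWord) (v : ℕ → A) (P : Set A) :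
    ∃ F ∈ subs L, IsTrace L v P F := by
  obtain ⟨F, hF, h⟩ := exists_mem_subs L fun w => ∃ t : BRDGTerm, t.encode = w ∧ t.eval v ∈ P
  refine ⟨F, hF, fun t ht => (h _).trans ⟨?_, fun h => ⟨ht, t, rfl, h⟩⟩⟩
  rintro ⟨-, s, hs, h⟩
  rwa [← BRDGTerm.encode_injective hs]

theorem IsTrace.isType {P : Set A} {F : List BWord} (hF : IsTrace L v P F) (hP : PrimeFilter P)
    (hN : ∀ n ∈ N, NodeOf L n) (hg : ∀ p ∈ g, ∃ s t : BRDGTerm, p = (s.encode, t.encode) ∧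
      s.encode ∈ L ∧ t.encode ∈ L ∧ s.eval v ≤ t.eval v) : isType N g F = true := by
  simp only [_root_.isType, Bool.and_eq_true, List.all_eq_true]
  constructor
  · intro n hn
    cases hN n hn with
    | var => rfl
    | zero h => simpa using mt (hF _ h).1 hP.bot_notMem
    | one h => simpa using (hF _ h).2 hP.top_mem
    | meet h₁ h₂ h₃ =>
      simp only [reduceCtorEq, if_false, if_true, decide_eq_true_eq, decide_eq_decide_and_iff]
      rw [hF _ h₁, hF _ h₂, hF _ h₃]
      exact ⟨fun h => ⟨hP.mem_of_le inf_le_left h, hP.mem_of_le inf_le_right h⟩,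
        fun h => hP.inf_mem h.1 h.2⟩
    | join h₁ h₂ h₃ =>
      simp only [reduceCtorEq, if_false, if_true, decide_eq_true_eq, decide_eq_decide_or_iff]
      rw [hF _ h₁, hF _ h₂, hF _ h₃]
      exact ⟨hP.mem_or_mem,
        fun h => h.elim (hP.mem_of_le le_sup_left) (hP.mem_of_le le_sup_right)⟩
    | fus | ldiv | rdiv => rfl
  · intro p hp
    obtain ⟨s, t, rfl, hs, ht, h⟩ := hg p hp
    simp only [Bool.or_eq_true, Bool.not_eq_true', decide_eq_false_iff_not, decide_eq_true_eq]
    rw [hF _ hs, hF _ ht, ← imp_iff_not_or]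
    exact hP.mem_of_le h

/-- All three clauses are instances of one fact: if `a ∘ b ≤ c`, `a ∈ P` and `b ∈ Q`, then `c ∈ R`.
For the residuals use `s ∘ (s \ t) ≤ t` and `(s / t) ∘ t ≤ s`. -/
theorem IsTrace.frameRel {P Q R : Set A} {G H F : List BWord} (hG : IsTrace L v P G)
    (hH : IsTrace L v Q H) (hF : IsTrace L v R F) (hR : PrimeFilter R)
    (hN : ∀ n ∈ N, NodeOf L n) (h : ∀ a ∈ P, ∀ b ∈ Q, BRDG.fus a b ∈ R) :
    frameRel N G H F = true := by
  simp only [_root_.frameRel, List.all_eq_true]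
  intro n hn
  have h' (a b c : A) (habc : BRDG.fus a b ≤ c) : (a ∈ P ∧ b ∈ Q) → c ∈ R := fun hab =>
    hR.mem_of_le habc (h a hab.1 b hab.2)
  cases hN n hn with
  | fus h₁ h₂ h₃ =>
    simp only [if_true, Bool.or_eq_true, Bool.not_eq_true', ← Bool.decide_and,
      decide_eq_false_iff_not, decide_eq_true_eq]
    rw [hG _ h₁, hH _ h₂, hF _ h₃, ← imp_iff_not_or]
    exact h' _ _ _ le_rfl
  | ldiv h₁ h₂ h₃ =>
    simp only [reduceCtorEq, if_false, if_true, Bool.or_eq_true, Bool.not_eq_true',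
      ← Bool.decide_and, decide_eq_false_iff_not, decide_eq_true_eq]
    rw [hG _ h₁, hH _ h₃, hF _ h₂, ← imp_iff_not_or]
    exact h' _ _ _ ((BRDG.fus_le_iff_le_ldiv _ _ _).2 le_rfl)
  | rdiv h₁ h₂ h₃ =>
    simp only [reduceCtorEq, if_false, if_true, Bool.or_eq_true, Bool.not_eq_true',
      ← Bool.decide_and, decide_eq_false_iff_not, decide_eq_true_eq]
    rw [hG _ h₃, hH _ h₂, hF _ h₁, ← imp_iff_not_or]
    exact h' _ _ _ ((BRDG.fus_le_iff_le_rdiv _ _ _).2 le_rfl)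
  | _ => rfl

/-- Every prime filter has a trace in `S`. -/
def HasTraces (L : List BWord) (v : ℕ → A) (S : List (List BWord)) : Prop :=
  ∀ P : Set A, PrimeFilter P → ∃ F ∈ S, IsTrace L v P F

theorem IsTrace.hasWitnesses {S : List (List BWord)} {P : Set A} {F : List BWord}
    (hF : IsTrace L v P F) (hP : PrimeFilter P) (hN : ∀ n ∈ N, NodeOf L n)
    (hS : HasTraces L v S) : hasWitnesses N S F = true := by
  have hf := BRDG.joinPreserving A
  simp only [_root_.hasWitnesses, List.all_eq_true]
  intro n hn
  cases hN n hn with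
  | fus h₁ h₂ h₃ =>
    simp only [if_true, Bool.or_eq_true, Bool.not_eq_true', decide_eq_false_iff_not,
      List.any_eq_true, Bool.and_eq_true, decide_eq_true_eq]
    rw [hF _ h₃, ← imp_iff_not_or]
    intro h
    obtain ⟨Q, R, hQ, hR, hsQ, htR, h⟩ := hf.exists_of_mem hP h
    obtain ⟨G, hGS, hG⟩ := hS Q hQ
    obtain ⟨H, hHS, hH⟩ := hS R hR
    exact ⟨G, hGS, H, hHS, hG.frameRel hH hF hP hN h, (hG _ h₁).2 hsQ, (hH _ h₂).2 htR⟩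
  | @ldiv s t h₁ h₂ h₃ =>
    simp only [reduceCtorEq, if_false, if_true, Bool.or_eq_true, Bool.not_eq_true',
      decide_eq_false_iff_not, List.any_eq_true, Bool.and_eq_true, decide_eq_true_eq]
    rw [hF _ h₃, or_iff_not_imp_left]
    intro h
    -- If `s ∘ b ≤ t` for some `b ∈ P`, then `b ≤ s \ t` would put `s \ t` into `P`.
    obtain ⟨Q, R, hQ, hR, hsQ, htR, h⟩ := hf.exists_of_not_le hP
      (s := s.eval v) (t := t.eval v)
      fun b hb hbt => h (hP.mem_of_le ((BRDG.fus_le_iff_le_ldiv _ _ _).1 hbt) hb)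
    obtain ⟨G, hGS, hG⟩ := hS Q hQ
    obtain ⟨H, hHS, hH⟩ := hS R hR
    exact ⟨G, hGS, H, hHS, hG.frameRel hF hH hR hN h, (hG _ h₁).2 hsQ,
      fun h => htR ((hH _ h₂).1 h)⟩
  | @rdiv t s h₂ h₁ h₃ =>
    simp only [reduceCtorEq, if_false, if_true, Bool.or_eq_true, Bool.not_eq_true',
      decide_eq_false_iff_not, List.any_eq_true, Bool.and_eq_true, decide_eq_true_eq]
    rw [hF _ h₃, or_iff_not_imp_left]
    intro h
    -- Right division is left division for the opposite product.
    obtain ⟨Q, R, hQ, hR, hsQ, htR, h⟩ := hf.swap.exists_of_not_le hP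
      (s := s.eval v) (t := t.eval v)
      fun b hb hbt => h (hP.mem_of_le ((BRDG.fus_le_iff_le_rdiv _ _ _).1 hbt) hb)
    obtain ⟨G, hGS, hG⟩ := hS Q hQ
    obtain ⟨H, hHS, hH⟩ := hS R hR
    exact ⟨G, hGS, H, hHS, hF.frameRel hG hH hR hN fun a ha b hb => h b hb a ha,
      (hG _ h₁).2 hsQ, fun h => htR ((hH _ h₂).1 h)⟩
  | _ => simp

/-- The witnesses that a trace needs can be chosen as traces of prime filters, hence in `S`, so no
round removes a trace. -/
theorem HasTraces.eliminate {S : List (List BWord)} (hS : HasTraces L v S)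
    (hN : ∀ n ∈ N, NodeOf L n) (U : List (List BWord)) :
    HasTraces L v (eliminate N U S) := by
  unfold _root_.eliminate
  induction U generalizing S with
  | nil => exact hS
  | cons _ U ih =>
    refine ih fun P hP => ?_
    obtain ⟨F, hFS, hF⟩ := hS P hP
    exact ⟨F, List.mem_filter.2 ⟨hFS, hF.hasWitnesses hP hN hS⟩, hF⟩

/-- Take for `g` the inequalities that hold under `v`. Every other one is refuted by a prime filter,
whose trace survives the elimination. -/
theorem BRDGFormula.Holds.exists_realizable {φ : BRDGFormula} (h : φ.Holds v) :
    ∃ g ∈ subs φ.atoms, φ.evalWith g = true ∧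
      realizable φ.nodes φ.atoms (subs (names φ.nodes)) g = true := by
  obtain ⟨g, hg, hgφ⟩ := exists_mem_subs φ.atoms fun p =>
    ∃ s t : BRDGTerm, p = (s.encode, t.encode) ∧ s.eval v ≤ t.eval v
  have key (s t : BRDGTerm) (hst : (s.encode, t.encode) ∈ φ.atoms) :
      (s.encode, t.encode) ∈ g ↔ s.eval v ≤ t.eval v := by
    refine (hgφ _).trans ⟨?_, fun h => ⟨hst, s, t, rfl, h⟩⟩
    rintro ⟨-, s', t', h, h'⟩
    obtain ⟨h₁, h₂⟩ := Prod.ext_iff.1 h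
    rwa [BRDGTerm.encode_injective h₁, BRDGTerm.encode_injective h₂]
  have hL {p : BWord × BWord} (hp : p ∈ φ.atoms) : ∃ s t : BRDGTerm, p = (s.encode, t.encode) ∧
      s.encode ∈ names φ.nodes ∧ t.encode ∈ names φ.nodes := by
    obtain ⟨s, t, rfl, hs, ht⟩ := BRDGFormula.exists_of_mem_atoms hp
    exact ⟨s, t, rfl, List.map_subset _ hs s.encode_mem_names,
      List.map_subset _ ht t.encode_mem_names⟩
  refine ⟨g, hg, (φ.evalWith_iff key).2 h, List.all_eq_true.2 fun p hp => ?_⟩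
  have hN := φ.nodeOf (List.Subset.refl _)
  obtain ⟨s, t, rfl, hs, ht⟩ := hL hp
  rw [Bool.or_eq_true, decide_eq_true_eq, or_iff_not_imp_left, key s t hp]
  intro hst
  obtain ⟨P, hP, hsP, htP⟩ := exists_primeFilter_of_not_le hst
  have hS : HasTraces (names φ.nodes) v
      ((subs (names φ.nodes)).filter (isType φ.nodes g)) := fun P hP => by
    obtain ⟨F, hFU, hF⟩ := exists_isTrace (names φ.nodes) v P
    refine ⟨F, List.mem_filter.2 ⟨hFU, hF.isType hP hN fun p hp => ?_⟩, hF⟩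
    have hpA := ((hgφ p).1 hp).1
    obtain ⟨s, t, rfl, hs, ht⟩ := hL hpA
    exact ⟨s, t, rfl, hs, ht, (key s t hpA).1 hp⟩
  obtain ⟨F, hFS, hF⟩ := hS.eliminate hN (subs (names φ.nodes)) P hP
  refine List.any_eq_true.2 ⟨F, hFS, ?_⟩
  simp [hF _ hs, hF _ ht, hsP, htP]

end Traces

/-! ### Formulas that pass the test are satisfiable -/

section Frames

variable {N : List TNode} {S : List (List BWord)} {g : List (BWord × BWord)}

theorem eliminate_subset (N : List TNode) (U S : List (List BWord)) : eliminate N U S ⊆ S := by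
  unfold eliminate
  induction U generalizing S with
  | nil => exact List.Subset.refl _
  | cons _ U ih => exact fun F hF => List.mem_of_mem_filter (ih _ hF)

/-- A round either changes nothing, and then all later rounds do not either, or it shortens the
list. So as many rounds as `S` has members reach a fixed point. -/
theorem hasWitnesses_of_mem_eliminate (N : List TNode) {U S : List (List BWord)}
    (h : S.length ≤ U.length) {F : List BWord} (hF : F ∈ eliminate N U S) :
    hasWitnesses N (eliminate N U S) F = true := by
  suffices (eliminate N U S).filter (hasWitnesses N (eliminate N U S)) = eliminate N U S from
    List.filter_eq_self.1 this F hF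
  clear hF
  unfold eliminate
  induction U generalizing S with
  | nil => rw [List.length_nil, Nat.le_zero, List.length_eq_zero_iff] at h; simp [h]
  | cons _ U ih =>
    rw [List.foldl_cons]
    by_cases hS : S.filter (hasWitnesses N S) = S
    · rw [hS]
      have (U : List (List BWord)) : U.foldl (fun S _ => S.filter (hasWitnesses N S)) S = S := by
        induction U with
        | nil => rfl
        | cons _ U ih => rw [List.foldl_cons, hS, ih]
      rw [this, hS]
    · refine ih ?_
      have := lt_of_le_of_ne (List.length_filter_le (hasWitnesses N S) S) fun h' =>
        hS (List.filter_sublist.eq_of_length h')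
      rw [List.length_cons] at h
      omega

/-- The complex algebra of a set of types. -/
@[reducible] def typeAlgebra (N : List TNode) (S : List (List BWord)) :
    BRDG (Set (ULift.{u} {F // F ∈ S})) :=
  .ofFrame fun x y z => frameRel N x.down y.down z.down = true

/-- The truth lemma, by induction on the term. The lattice operations are handled by `isType`. For
`∘`, `\`, `/`, one inclusion is a clause of `frameRel` and the other is the existence of witnesses.
All sets of types are admitted as values, so no order on types is needed. -/
theorem eval_typeAlgebra (hS : ∀ F ∈ S, isType N g F = true)
    (hW : ∀ F ∈ S, hasWitnesses N S F = true) (t : BRDGTerm) (ht : t.nodes ⊆ N) :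
    letI := typeAlgebra.{u} N S
    t.eval (fun i => {x : ULift.{u} {F // F ∈ S} | (BRDGTerm.var i).encode ∈ x.down.1}) =
      {x | t.encode ∈ x.down.1} := by
  let _ := typeAlgebra.{u} N S
  have hN : ∀ n ∈ t.nodes, n ∈ N := fun n hn => ht hn
  have hS' (x : ULift.{u} {F // F ∈ S}) :=
    List.all_eq_true.1 (Bool.and_eq_true_iff.1 (hS x.down.1 x.down.2)).1
  have hW' (x : ULift.{u} {F // F ∈ S}) := List.all_eq_true.1 (hW x.down.1 x.down.2)
  induction t with
  | var i => rfl
  | zero =>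
    ext x
    have := hS' x _ (hN _ List.mem_cons_self)
    simp only [if_true, Bool.not_eq_true', decide_eq_false_iff_not] at this
    exact ⟨False.elim, this⟩
  | one =>
    ext x
    have := hS' x _ (hN _ List.mem_cons_self)
    simp only [reduceCtorEq, if_false, if_true, decide_eq_true_eq] at this
    exact ⟨fun _ => this, fun _ => trivial⟩
  | meet s t hs ht' =>
    simp only [BRDGTerm.nodes, List.cons_subset, List.append_subset] at ht
    rw [BRDGTerm.eval, hs ht.2.1 ht.2.1, ht' ht.2.2 ht.2.2]
    ext x
    have := hS' x _ ht.1
    simp only [reduceCtorEq, if_false, if_true, decide_eq_true_eq, decide_eq_decide_and_iff]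
      at this
    exact this.symm
  | join s t hs ht' =>
    simp only [BRDGTerm.nodes, List.cons_subset, List.append_subset] at ht
    rw [BRDGTerm.eval, hs ht.2.1 ht.2.1, ht' ht.2.2 ht.2.2]
    ext x
    have := hS' x _ ht.1
    simp only [reduceCtorEq, if_false, if_true, decide_eq_true_eq, decide_eq_decide_or_iff]
      at this
    exact this.symm
  | fus s t hs ht' =>
    simp only [BRDGTerm.nodes, List.cons_subset, List.append_subset] at ht
    rw [BRDGTerm.eval, hs ht.2.1 ht.2.1, ht' ht.2.2 ht.2.2]
    ext x
    have hx := hW' x _ ht.1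
    simp only [if_true, Bool.or_eq_true, Bool.not_eq_true', decide_eq_false_iff_not,
      List.any_eq_true, Bool.and_eq_true, decide_eq_true_eq, ← imp_iff_not_or] at hx
    constructor
    · rintro ⟨y, hy, z, hz, hR⟩
      have := List.all_eq_true.1 hR _ ht.1
      simp only [if_true, Bool.or_eq_true, Bool.not_eq_true', ← Bool.decide_and,
        decide_eq_false_iff_not, decide_eq_true_eq, ← imp_iff_not_or] at this
      exact this ⟨hy, hz⟩
    · intro h
      obtain ⟨G, hG, H, hH, hR, h₁, h₂⟩ := hx h
      exact ⟨⟨G, hG⟩, h₁, ⟨H, hH⟩, h₂, hR⟩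
  | ldiv s t hs ht' =>
    simp only [BRDGTerm.nodes, List.cons_subset, List.append_subset] at ht
    rw [BRDGTerm.eval, hs ht.2.1 ht.2.1, ht' ht.2.2 ht.2.2]
    ext x
    have hx := hW' x _ ht.1
    simp only [reduceCtorEq, if_false, if_true, Bool.or_eq_true, Bool.not_eq_true',
      decide_eq_false_iff_not, List.any_eq_true, Bool.and_eq_true, decide_eq_true_eq] at hx
    constructor
    · intro h
      refine hx.resolve_right ?_
      rintro ⟨G, hG, H, hH, hR, h₁, h₂⟩
      exact h₂ (h ⟨G, hG⟩ h₁ ⟨H, hH⟩ hR)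
    · intro h y hy z hR
      have := List.all_eq_true.1 hR _ ht.1
      simp only [reduceCtorEq, if_false, if_true, Bool.or_eq_true, Bool.not_eq_true',
        ← Bool.decide_and, decide_eq_false_iff_not, decide_eq_true_eq, ← imp_iff_not_or] at this
      exact this ⟨hy, h⟩
  | rdiv s t hs ht' =>
    simp only [BRDGTerm.nodes, List.cons_subset, List.append_subset] at ht
    rw [BRDGTerm.eval, hs ht.2.1 ht.2.1, ht' ht.2.2 ht.2.2]
    ext x
    have hx := hW' x _ ht.1
    simp only [reduceCtorEq, if_false, if_true, Bool.or_eq_true, Bool.not_eq_true',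
      decide_eq_false_iff_not, List.any_eq_true, Bool.and_eq_true, decide_eq_true_eq] at hx
    constructor
    · intro h
      refine hx.resolve_right ?_
      rintro ⟨G, hG, H, hH, hR, h₁, h₂⟩
      exact h₂ (h ⟨G, hG⟩ h₁ ⟨H, hH⟩ hR)
    · intro h y hy z hR
      have := List.all_eq_true.1 hR _ ht.1
      simp only [reduceCtorEq, if_false, if_true, Bool.or_eq_true, Bool.not_eq_true',
        ← Bool.decide_and, decide_eq_false_iff_not, decide_eq_true_eq, ← imp_iff_not_or] at this
      exact this ⟨h, hy⟩

/-- In the algebra of surviving types, inequalities in `g` hold because every type respects `g`, and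
the remaining ones in the formula fail at the type that `realizable` provides. -/
theorem BRDGFormula.satisfiable_of_realizable {φ : BRDGFormula} (hφ : φ.evalWith g = true)
    (h : realizable φ.nodes φ.atoms (subs (names φ.nodes)) g = true) :
    Satisfiable.{u} φ := by
  have h' := List.all_eq_true.1 h
  have hW (F) := hasWitnesses_of_mem_eliminate φ.nodes (F := F) (List.length_filter_le
    (isType φ.nodes g) (subs (names φ.nodes)))
  have hS (F) (hF : F ∈ eliminate φ.nodes (subs (names φ.nodes))
      ((subs (names φ.nodes)).filter (isType φ.nodes g))) : isType φ.nodes g F = true :=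
    (List.mem_filter.1 (eliminate_subset _ _ _ hF)).2
  generalize eliminate φ.nodes (subs (names φ.nodes))
    ((subs (names φ.nodes)).filter (isType φ.nodes g)) = S at *
  let i := typeAlgebra.{u} φ.nodes S
  refine ⟨_, i, fun i => {x : ULift.{u} {F // F ∈ S} | (BRDGTerm.var i).encode ∈ x.down.1},
    (φ.evalWith_iff fun s t hst => ?_).1 hφ⟩
  · obtain ⟨s', t', hp, hs, ht⟩ := exists_of_mem_atoms hst
    obtain ⟨h₁, h₂⟩ := Prod.ext_iff.1 hp
    obtain rfl := BRDGTerm.encode_injective h₁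
    obtain rfl := BRDGTerm.encode_injective h₂
    rw [eval_typeAlgebra hS hW s hs, eval_typeAlgebra hS hW t ht]
    constructor
    · intro hg x hx
      have := List.all_eq_true.1 (Bool.and_eq_true_iff.1 (hS _ x.down.2)).2 _ hg
      simp only [Bool.or_eq_true, Bool.not_eq_true', decide_eq_false_iff_not,
        decide_eq_true_eq, ← imp_iff_not_or] at this
      exact this hx
    · intro hle
      have := h' _ hst
      rw [Bool.or_eq_true, decide_eq_true_eq] at this
      refine this.resolve_right fun hany => ?_
      obtain ⟨F, hF, hFst⟩ := List.any_eq_true.1 hany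
      simp only [Bool.and_eq_true, Bool.not_eq_true', decide_eq_false_iff_not,
        decide_eq_true_eq] at hFst
      exact hFst.2 (hle (a := ⟨F, hF⟩) hFst.1)

end Frames

end Semantics

theorem mainTheorem4 : InEXPTIME BRDGSat.{u} := by
  refine inEXPTIME_of_expTime expTime_decideSat fun w => (decideSat_reverse w).trans ?_
  refine exists_congr fun φ => and_congr_right fun _ => ⟨?_, ?_⟩
  · rintro ⟨g, -, hg, h⟩
    exact BRDGFormula.satisfiable_of_realizable hg h
  · rintro ⟨A, _, v, h⟩
    exact h.exists_realizable
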